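/- Let $(M,g)$ be a smooth spacetime of dimension $n>2$, with $g$ of signature $(-,+,\dots,+)$ and Levi-Civita connection $\nabla$. Let $\Delta\subset M$ be an $(n-1)$-dimensional null submanifold, i.e. the pullback $q_{ab}$ of $g$ to $\Delta$ is degenerate at every point, and let $\ell$ be a smooth nowhere vanishing null vector field on $\Delta$, tangent to $\Delta$. Suppose that $(\Delta,[\ell])$ is an isolated null surface, where $[\ell]=\{c\,\ell : c\neq 0 \text{ constant}\}$; that is, $\Delta$ is non-expanding (the trace of $\nabla_a\ell_b$ over $T\Delta/\mathbb R\ell$ vanishes), $$\mathcal L_\ell q_{ab}=0 ,\qquad [\mathcal L_\ell,D_a]=0 ,$$ where $D_XY=\nabla_XY$ is the covariant derivative induced on $\Delta$ (for $X,Y$ tangent to $\Delta$, $\nabla_XY$ is again tangent to $\Delta$ because $\mathcal L_\ell q_{ab}=0$). Let the rotation 1-form potential $\omega$ be given by $D_a\ell^b=\omega_a\ell^b$ and the surface gravity $\kappa$ by $\nabla_\ell\ell=\kappa\,\ell$, and suppose that $(\Delta,[\ell])$ is extremal: $\kappa=0$ on $\Delta$. Then for every $(n-2)$-dimensional spacelike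 submanifold $\mathcal S\subset\Delta$ transversal to the orbits of $\ell$, $$\tilde D_{(A}\tilde\omega_{B)}+\tilde\omega_A\tilde\omega_B-\tfrac12 R^{(n-2)}_{AB}+\tfrac12\tilde R_{AB}=0$$ on $\mathcal S$, where $\tilde q_{AB}$ is the metric induced by $g$ on $\mathcal S$, $\tilde D_A$ and $R^{(n-2)}_{AB}$ are its Levi-Civita connection and its Ricci tensor, $\tilde\omega_A$ and $\tilde R_{AB}$ are the pullbacks to $\mathcal S$ of $\omega$ and of the Ricci tensor of $g$, and $\tilde D_{(A}\tilde\omega_{B)}=\tfrac12(\tilde D_A\tilde\omega_B+\tilde D_B\tilde\omega_A)$. Here the Ricci tensor of a metric with Riemann tensor $R(u,v)w=\nabla_u\nabla_vw-\nabla_v\nabla_uw-\nabla_{[u,v]}w$ is $\mathrm{Ric}(v,w)=\operatorname{tr}(z\mapsto R(z,v)w)$. -/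

import Mathlib

open scoped Manifold ContDiff Topology Bundle

noncomputable section

namespace NullGeom

variable {E : Type*} [NormedAddCommGroup E] [NormedSpace ℝ E] [FiniteDimensional ℝ E]
  {M : Type*} [TopologicalSpace M] [ChartedSpace E M] [IsManifold 𝓘(ℝ, E) ∞ M]

/-- A smooth pseudo-Riemannian metric (of any signature) on the smooth manifold `M`: a smooth field
of nondegenerate symmetric bilinear forms on the tangent spaces. -/
structure PseudoMetric (E : Type*) [NormedAddCommGroup E] [NormedSpace ℝ E]
    (M : Type*) [TopologicalSpace M] [ChartedSpace E M] [IsManifold 𝓘(ℝ, E) ∞ M] where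
  val (x : M) : TangentSpace 𝓘(ℝ, E) x →L[ℝ] TangentSpace 𝓘(ℝ, E) x →L[ℝ] ℝ
  symm (x : M) (v w : TangentSpace 𝓘(ℝ, E) x) : val x v w = val x w v
  nondeg (x : M) (v : TangentSpace 𝓘(ℝ, E) x) : (∀ w, val x v w = 0) → v = 0
  contMDiff : ContMDiff 𝓘(ℝ, E) (𝓘(ℝ, E).prod 𝓘(ℝ, E →L[ℝ] E →L[ℝ] ℝ)) ∞
    (fun x => Bundle.TotalSpace.mk' (E →L[ℝ] E →L[ℝ] ℝ) x (val x))

namespace PseudoMetric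
variable (g : PseudoMetric E M)

/-- The function `x ↦ g_x(X x, Y x)`. -/
def pair (X Y : Π x : M, TangentSpace 𝓘(ℝ, E) x) (x : M) : ℝ := g.val x (X x) (Y x)

theorem mdiff_pair {X Y : Π x : M, TangentSpace 𝓘(ℝ, E) x} {x : M}
    (hX : MDiffAt (T% X) x) (hY : MDiffAt (T% Y) x) : MDiffAt (g.pair X Y) x := by
  have h : MDifferentiableAt 𝓘(ℝ, E) (𝓘(ℝ, E).prod 𝓘(ℝ))
      (fun m ↦ Bundle.TotalSpace.mk' ℝ (E := Bundle.Trivial M ℝ) m (g.pair X Y m)) x := by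
    apply MDifferentiableAt.clm_bundle_apply₂ (F₁ := E) (F₂ := E)
    · exact (g.contMDiff.mdifferentiable (by simp)) x
    · exact hX
    · exact hY
  simp only [mdifferentiableAt_totalSpace] at h
  exact h.2

/-- The right-hand side of the Koszul formula for `2 g(∇_X Y, Z)`. -/
def koszul (X Y Z : Π x : M, TangentSpace 𝓘(ℝ, E) x) (x : M) : ℝ :=
  mvfderiv 𝓘(ℝ, E) (g.pair Y Z) x (X x) + mvfderiv 𝓘(ℝ, E) (g.pair X Z) x (Y x)
    - mvfderiv 𝓘(ℝ, E) (g.pair X Y) x (Z x)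
    + g.val x (VectorField.mlieBracket 𝓘(ℝ, E) X Y x) (Z x)
    - g.val x (VectorField.mlieBracket 𝓘(ℝ, E) X Z x) (Y x)
    - g.val x (VectorField.mlieBracket 𝓘(ℝ, E) Y Z x) (X x)

variable {g}

theorem pair_smul_left (f : M → ℝ) (X Y : Π x : M, TangentSpace 𝓘(ℝ, E) x) :
    g.pair (f • X) Y = f * g.pair X Y := by
  funext x; simp [pair]
theorem pair_smul_right (f : M → ℝ) (X Y : Π x : M, TangentSpace 𝓘(ℝ, E) x) :
    g.pair X (f • Y) = f * g.pair X Y := by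
  funext x; simp [pair]
theorem pair_add_left (X X' Y : Π x : M, TangentSpace 𝓘(ℝ, E) x) :
    g.pair (X + X') Y = g.pair X Y + g.pair X' Y := by
  funext x; simp [pair]
theorem pair_add_right (X Y Y' : Π x : M, TangentSpace 𝓘(ℝ, E) x) :
    g.pair X (Y + Y') = g.pair X Y + g.pair X Y' := by
  funext x; simp [pair]

theorem koszul_tensorial_left {Y Z : Π x : M, TangentSpace 𝓘(ℝ, E) x} {x : M}
    (hY : MDiffAt (T% Y) x) (hZ : MDiffAt (T% Z) x) :
    TensorialAt 𝓘(ℝ, E) E (fun X => g.koszul X Y Z x) x where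
  smul {f X} hf hX := by
    have := g.symm x
    simp only [koszul, pair_smul_left, mvfderiv_mul hf (g.mdiff_pair hX hY),
      mvfderiv_mul hf (g.mdiff_pair hX hZ), VectorField.mlieBracket_smul_left hf hX]
    simp [pair, this (X x)]
    ring
  add {X X'} hX hX' := by
    simp only [koszul, pair_add_left, mvfderiv_add (g.mdiff_pair hX hY) (g.mdiff_pair hX' hY),
      mvfderiv_add (g.mdiff_pair hX hZ) (g.mdiff_pair hX' hZ),
      VectorField.mlieBracket_add_left hX hX']
    simp
    ring

theorem koszul_tensorial_right {X Y : Π x : M, TangentSpace 𝓘(ℝ, E) x} {x : M}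
    (hX : MDiffAt (T% X) x) (hY : MDiffAt (T% Y) x) :
    TensorialAt 𝓘(ℝ, E) E (fun Z => g.koszul X Y Z x) x where
  smul {f Z} hf hZ := by
    have := g.symm x
    simp only [koszul, pair_smul_right, mvfderiv_mul hf (g.mdiff_pair hX hZ),
      mvfderiv_mul hf (g.mdiff_pair hY hZ), VectorField.mlieBracket_smul_right hf hZ]
    simp [pair, this _ (Y x), this _ (X x)]
    ring
  add {Z Z'} hZ hZ' := by
    simp only [koszul, pair_add_right, mvfderiv_add (g.mdiff_pair hX hZ) (g.mdiff_pair hX hZ'),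
      mvfderiv_add (g.mdiff_pair hY hZ) (g.mdiff_pair hY hZ'),
      VectorField.mlieBracket_add_right hZ hZ']
    simp
    ring

theorem koszul_add {X Y Y' Z : Π x : M, TangentSpace 𝓘(ℝ, E) x} {x : M}
    (hX : MDiffAt (T% X) x) (hY : MDiffAt (T% Y) x) (hY' : MDiffAt (T% Y') x)
    (hZ : MDiffAt (T% Z) x) :
    g.koszul X (Y + Y') Z x = g.koszul X Y Z x + g.koszul X Y' Z x := by
  simp only [koszul, pair_add_right, pair_add_left,
    mvfderiv_add (g.mdiff_pair hX hY) (g.mdiff_pair hX hY'),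
    mvfderiv_add (g.mdiff_pair hY hZ) (g.mdiff_pair hY' hZ),
    VectorField.mlieBracket_add_right hY hY', VectorField.mlieBracket_add_left hY hY']
  simp
  ring

theorem koszul_smul {f : M → ℝ} {X Y Z : Π x : M, TangentSpace 𝓘(ℝ, E) x} {x : M}
    (hf : MDiffAt f x) (hX : MDiffAt (T% X) x) (hY : MDiffAt (T% Y) x)
    (hZ : MDiffAt (T% Z) x) :
    g.koszul X (f • Y) Z x =
      f x * g.koszul X Y Z x + 2 * (mvfderiv 𝓘(ℝ, E) f x (X x) * g.val x (Y x) (Z x)) := by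
  have := g.symm x
  simp only [koszul, pair_smul_right, pair_smul_left, mvfderiv_mul hf (g.mdiff_pair hX hY),
    mvfderiv_mul hf (g.mdiff_pair hY hZ), VectorField.mlieBracket_smul_right hf hY,
    VectorField.mlieBracket_smul_left hf hY]
  simp [pair, this _ (X x)]
  ring

variable (g) in
/-- The musical isomorphism `v ↦ g(v, ·)`. -/
def flat (x : M) : TangentSpace 𝓘(ℝ, E) x ≃ₗ[ℝ] (TangentSpace 𝓘(ℝ, E) x →L[ℝ] ℝ) :=
  have : FiniteDimensional ℝ (TangentSpace 𝓘(ℝ, E) x) := inferInstanceAs (FiniteDimensional ℝ E)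
  have : T2Space (TangentSpace 𝓘(ℝ, E) x) := inferInstanceAs (T2Space E)
  LinearEquiv.ofInjectiveOfFinrankEq (g.val x).toLinearMap
    ((injective_iff_map_eq_zero _).2 fun v hv => g.nondeg x v fun w =>
      congrArg (fun L : TangentSpace 𝓘(ℝ, E) x →L[ℝ] ℝ => L w) hv)
    ((Subspace.dual_finrank_eq (K := ℝ) (V := TangentSpace 𝓘(ℝ, E) x)).symm.trans
      (LinearMap.toContinuousLinearMap (𝕜 := ℝ) (E := TangentSpace 𝓘(ℝ, E) x)
        (F' := ℝ)).finrank_eq)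

theorem flat_apply (x : M) (v w : TangentSpace 𝓘(ℝ, E) x) : g.flat x v w = g.val x v w := rfl

open scoped Classical in
variable (g) in
/-- `g.nabla Y x v` is the Levi-Civita derivative `∇_v Y` at `x`, given by the Koszul formula
(with junk value `0` when `Y` is not differentiable at `x`). -/
def nabla (Y : Π x : M, TangentSpace 𝓘(ℝ, E) x) (x : M) :
    TangentSpace 𝓘(ℝ, E) x →L[ℝ] TangentSpace 𝓘(ℝ, E) x :=
  have : FiniteDimensional ℝ (TangentSpace 𝓘(ℝ, E) x) := inferInstanceAs (FiniteDimensional ℝ E)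
  have : T2Space (TangentSpace 𝓘(ℝ, E) x) := inferInstanceAs (T2Space E)
  if hY : MDiffAt (T% Y) x then
    LinearMap.toContinuousLinearMap <| (g.flat x).symm.toLinearMap ∘ₗ
      ((1 / 2 : ℝ) • (TensorialAt.mkHom₂ (fun X Z => g.koszul X Y Z x) x
        (fun _ hZ => koszul_tensorial_left hY hZ)
        (fun _ hX => koszul_tensorial_right hX hY)).toLinearMap)
  else 0

theorem two_mul_nabla {X Y Z : Π x : M, TangentSpace 𝓘(ℝ, E) x} {x : M}
    (hX : MDiffAt (T% X) x) (hY : MDiffAt (T% Y) x) (hZ : MDiffAt (T% Z) x) :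
    2 * g.val x (g.nabla Y x (X x)) (Z x) = g.koszul X Y Z x := by
  rw [← flat_apply, nabla]
  simp only [hY, dif_pos, LinearMap.coe_toContinuousLinearMap', LinearMap.comp_apply,
    LinearEquiv.coe_coe, LinearEquiv.apply_symm_apply, LinearMap.smul_apply,
    smul_apply, smul_eq_mul, ContinuousLinearMap.coe_coe]
  rw [TensorialAt.mkHom₂_apply _ _ hX hZ]
  ring

theorem eq_of_forall_val {x : M} {v w : TangentSpace 𝓘(ℝ, E) x}
    (h : ∀ z, g.val x v z = g.val x w z) : v = w := by
  rw [← sub_eq_zero]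
  exact g.nondeg x _ fun z => by simp [h]

variable (g) in
/-- The Levi-Civita connection of `g`; `g.leviCivita Y x v` is `∇_v Y` at `x`. -/
def leviCivita : CovariantDerivative 𝓘(ℝ, E) E (fun x : M => TangentSpace 𝓘(ℝ, E) x) where
  toFun := g.nabla
  isCovariantDerivativeOnUniv :=
    { add := by
        intro Y Y' x hY hY' _
        ext v
        refine eq_of_forall_val (g := g) fun z => ?_
        have hv := FiberBundle.mdifferentiableAt_extend 𝓘(ℝ, E) E v
        have hz := FiberBundle.mdifferentiableAt_extend 𝓘(ℝ, E) E z
        have hs : MDiffAt (T% (Y + Y')) x := mdifferentiableAt_add_section hY hY'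
        have h1 := two_mul_nabla (g := g) hv hs hz
        have h2 := two_mul_nabla (g := g) hv hY hz
        have h3 := two_mul_nabla (g := g) hv hY' hz
        rw [koszul_add hv hY hY' hz] at h1
        simp at h1 h2 h3 ⊢
        linarith
      leibniz := by
        intro Y f x hY hf _
        ext v
        refine eq_of_forall_val (g := g) fun z => ?_
        have hv := FiberBundle.mdifferentiableAt_extend 𝓘(ℝ, E) E v
        have hz := FiberBundle.mdifferentiableAt_extend 𝓘(ℝ, E) E z
        have hs : MDiffAt (T% (f • Y)) x := hf.smul_section hY
        have h1 := two_mul_nabla (g := g) hv hs hz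
        have h2 := two_mul_nabla (g := g) hv hY hz
        rw [koszul_smul hf hv hY hz] at h1
        simp at h1 h2 ⊢
        linear_combination h1 / 2 - f x * h2 / 2 }

/-- The Levi-Civita connection is metric. -/
theorem leviCivita_metric {X Y Z : Π x : M, TangentSpace 𝓘(ℝ, E) x} {x : M}
    (hX : MDiffAt (T% X) x) (hY : MDiffAt (T% Y) x) (hZ : MDiffAt (T% Z) x) :
    mvfderiv 𝓘(ℝ, E) (g.pair Y Z) x (X x) =
      g.val x (g.leviCivita Y x (X x)) (Z x) + g.val x (Y x) (g.leviCivita Z x (X x)) := by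
  have h1 := two_mul_nabla (g := g) hX hY hZ
  have h2 := two_mul_nabla (g := g) hX hZ hY
  have hc : ∀ A B, g.pair A B = g.pair B A := fun A B => funext fun y => g.symm y _ _
  change _ = g.val x (g.nabla Y x (X x)) (Z x) + g.val x (Y x) (g.nabla Z x (X x))
  rw [g.symm x (Y x)]
  simp only [koszul, hc Z Y, VectorField.mlieBracket_swap_apply (V := Z) (W := Y),
    map_neg, neg_apply] at h1 h2
  linarith

/-- The Levi-Civita connection is torsion free. -/
theorem leviCivita_torsion : (g.leviCivita).torsion = 0 := by
  rw [CovariantDerivative.torsion_eq_zero_iff]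
  intro X Y x hX hY
  refine eq_of_forall_val (g := g) fun z => ?_
  have hz := FiberBundle.mdifferentiableAt_extend 𝓘(ℝ, E) E z
  have h1 := two_mul_nabla (g := g) hX hY hz
  have h2 := two_mul_nabla (g := g) hY hX hz
  have hc : ∀ A B, g.pair A B = g.pair B A := fun A B => funext fun y => g.symm y _ _
  change g.val x (g.nabla Y x (X x) - g.nabla X x (Y x)) z = _
  simp only [koszul, hc Y X, VectorField.mlieBracket_swap_apply (V := Y) (W := X),
    map_neg, neg_apply] at h1 h2
  simp at h1 h2 ⊢
  linarith

variable (g)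

/-- The Riemann tensor `R(u, v) w = ∇_u ∇_v w - ∇_v ∇_u w - ∇_{[u, v]} w` at `x`, the tangent vectors
being extended to vector fields that are smooth near `x` (the choice is irrelevant). -/
def riemann (x : M) (u v w : TangentSpace 𝓘(ℝ, E) x) : TangentSpace 𝓘(ℝ, E) x :=
  let U : Π y : M, TangentSpace 𝓘(ℝ, E) y := FiberBundle.extend E u
  let V : Π y : M, TangentSpace 𝓘(ℝ, E) y := FiberBundle.extend E v
  let W : Π y : M, TangentSpace 𝓘(ℝ, E) y := FiberBundle.extend E w
  g.leviCivita (fun y => g.leviCivita W y (V y)) x u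
    - g.leviCivita (fun y => g.leviCivita W y (U y)) x v
    - g.leviCivita W x (VectorField.mlieBracket 𝓘(ℝ, E) U V x)

/-- The Ricci tensor: `Ric(v, w)` is the trace of `z ↦ R(z, v) w`, computed in a basis of the
tangent space. -/
def ricci (x : M) (v w : TangentSpace 𝓘(ℝ, E) x) : ℝ :=
  let b : Module.Basis (Fin (Module.finrank ℝ E)) ℝ (TangentSpace 𝓘(ℝ, E) x) :=
    Module.finBasis ℝ E
  ∑ i, b.coord i (g.riemann x (b i) v w)

/-- The covariant derivative of a 1-form `α`:
`(∇α)(u, w) = (∇_u α)(w) = u(α(W)) - α(∇_u W)`, where `W` extends `w`. -/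
def covDerivOneForm (α : Π y : M, TangentSpace 𝓘(ℝ, E) y → ℝ) (x : M)
    (u w : TangentSpace 𝓘(ℝ, E) x) : ℝ :=
  let W : Π y : M, TangentSpace 𝓘(ℝ, E) y := FiberBundle.extend E w
  mvfderiv 𝓘(ℝ, E) (fun y => α y (W y)) x u - α x (g.leviCivita W x u)

/-- Lorentzian signature `(-, +, …, +)`: at each point there is a timelike vector on whose
orthogonal complement the metric is positive definite. -/
def IsLorentzian : Prop :=
  ∀ x, ∃ t : TangentSpace 𝓘(ℝ, E) x, g.val x t t < 0 ∧
    ∀ v, g.val x t v = 0 → v ≠ 0 → 0 < g.val x v v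

end PseudoMetric

/-! ### Pullback of a metric to a manifold mapped into `M` -/

section Pullback

variable {G : Type*} [NormedAddCommGroup G] [NormedSpace ℝ G] [FiniteDimensional ℝ G]
  {S : Type*} [TopologicalSpace S] [ChartedSpace G S] [IsManifold 𝓘(ℝ, G) ∞ S]

/-- The pullback `φ^* g` of the metric `g` along `φ : S → M`, as a field of bilinear forms. -/
def pullbackForm (g : PseudoMetric E M) (φ : S → M) (s : S) :
    TangentSpace 𝓘(ℝ, G) s →L[ℝ] TangentSpace 𝓘(ℝ, G) s →L[ℝ] ℝ :=
  ContinuousLinearMap.precomp ℝ (mfderiv 𝓘(ℝ, G) 𝓘(ℝ, E) φ s) ∘L g.val (φ s) ∘L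
    mfderiv 𝓘(ℝ, G) 𝓘(ℝ, E) φ s

theorem pullbackForm_apply (g : PseudoMetric E M) (φ : S → M) (s : S)
    (v w : TangentSpace 𝓘(ℝ, G) s) :
    pullbackForm g φ s v w = g.val (φ s) (mfderiv 𝓘(ℝ, G) 𝓘(ℝ, E) φ s v)
      (mfderiv 𝓘(ℝ, G) 𝓘(ℝ, E) φ s w) := rfl

theorem contMDiffAt_of_coords {W ι : Type*} [NormedAddCommGroup W] [NormedSpace ℝ W] [Fintype ι]
    (Φ : W →ₗ[ℝ] (ι → ℝ)) (hΦ : ∀ A, Φ A = 0 → A = 0) {L : S → W} {s₀ : S}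
    (h : ∀ p, ContMDiffAt 𝓘(ℝ, G) 𝓘(ℝ) ∞ (fun s => Φ (L s) p) s₀) :
    ContMDiffAt 𝓘(ℝ, G) 𝓘(ℝ, W) ∞ L s₀ := by
  obtain ⟨Ψ, hΨ⟩ := Φ.exists_leftInverse_of_injective (LinearMap.ker_eq_bot'.2 hΦ)
  have hL : L = fun s => (LinearMap.toContinuousLinearMap Ψ) (Φ (L s)) := by
    funext s
    exact (LinearMap.congr_fun hΨ (L s)).symm
  rw [hL]
  refine (LinearMap.toContinuousLinearMap Ψ).contMDiff.contMDiffAt.comp s₀ ?_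
  rw [contMDiffAt_pi_space]
  exact h

theorem contMDiffAt_of_apply {L : S → G →L[ℝ] G →L[ℝ] ℝ} {s₀ : S}
    (h : ∀ a b, ContMDiffAt 𝓘(ℝ, G) 𝓘(ℝ) ∞ (fun s => L s a b) s₀) :
    ContMDiffAt 𝓘(ℝ, G) 𝓘(ℝ, G →L[ℝ] G →L[ℝ] ℝ) ∞ L s₀ := by
  let b := Module.finBasis ℝ G
  refine contMDiffAt_of_coords (ι := Fin (Module.finrank ℝ G) × Fin (Module.finrank ℝ G))
    { toFun := fun A p => A (b p.1) (b p.2)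
      map_add' := fun A B => rfl
      map_smul' := fun c A => rfl } (fun A hA => ?_) (fun p => h _ _)
  have h0 : ∀ i j, A (b i) (b j) = 0 := fun i j => congrFun hA (i, j)
  have h1 : ∀ i, A (b i) = 0 := fun i => ContinuousLinearMap.coe_injective (b.ext (h0 i))
  exact ContinuousLinearMap.coe_injective (b.ext h1)

theorem contMDiff_pullbackForm (g : PseudoMetric E M) {φ : S → M}
    (hφ : ContMDiff 𝓘(ℝ, G) 𝓘(ℝ, E) ∞ φ) :
    ContMDiff 𝓘(ℝ, G) (𝓘(ℝ, G).prod 𝓘(ℝ, G →L[ℝ] G →L[ℝ] ℝ)) ∞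
      (fun s : S => Bundle.TotalSpace.mk' (G →L[ℝ] G →L[ℝ] ℝ)
        (E := fun s : S => TangentSpace 𝓘(ℝ, G) s →L[ℝ] TangentSpace 𝓘(ℝ, G) s →L[ℝ] ℝ)
        s (pullbackForm g φ s)) := by
  intro s₀
  rw [contMDiffAt_hom_bundle]
  refine ⟨contMDiffAt_id, contMDiffAt_of_apply fun a b => ?_⟩
  let t := trivializationAt G (fun s : S => TangentSpace 𝓘(ℝ, G) s) s₀
  have hext : ∀ a : G, ContMDiffAt 𝓘(ℝ, G) (𝓘(ℝ, G).prod 𝓘(ℝ, G)) ∞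
      (fun s : S => Bundle.TotalSpace.mk' G (E := fun s : S => TangentSpace 𝓘(ℝ, G) s)
        s (t.symm s a)) s₀ := by
    intro a
    rw [Bundle.contMDiffAt_section]
    refine (contMDiffAt_const (c := a)).congr_of_eventuallyEq ?_
    filter_upwards [t.open_baseSet.mem_nhds (FiberBundle.mem_baseSet_trivializationAt' s₀)]
      with s hs
    change (t ⟨s, t.symm s a⟩).2 = a
    simp [hs]
  have hd : ∀ a : G, ContMDiffAt 𝓘(ℝ, G) (𝓘(ℝ, E).prod 𝓘(ℝ, E)) ∞
      (fun s : S => Bundle.TotalSpace.mk' E (E := fun x : M => TangentSpace 𝓘(ℝ, E) x)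
        (φ s) (mfderiv 𝓘(ℝ, G) 𝓘(ℝ, E) φ s (t.symm s a))) s₀ := fun a =>
    ((hφ.contMDiff_tangentMap (m := ∞) (by simp)).contMDiffAt).comp s₀ (hext a)
  have key : ContMDiffAt 𝓘(ℝ, G) (𝓘(ℝ, E).prod 𝓘(ℝ)) ∞
      (fun s ↦ Bundle.TotalSpace.mk' ℝ (E := Bundle.Trivial M ℝ) (φ s)
        (pullbackForm g φ s (t.symm s a) (t.symm s b))) s₀ := by
    apply ContMDiffAt.clm_bundle_apply₂ (F₁ := E) (F₂ := E)
    · exact ContMDiffAt.comp s₀ g.contMDiff.contMDiffAt hφ.contMDiffAt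
    · exact hd a
    · exact hd b
  simp only [Bundle.contMDiffAt_totalSpace] at key
  refine key.2.congr_of_eventuallyEq ?_
  filter_upwards [t.open_baseSet.mem_nhds (FiberBundle.mem_baseSet_trivializationAt' s₀)]
    with s hs
  have hs' : s ∈ (trivializationAt (G →L[ℝ] ℝ)
      (fun b : S => TangentSpace 𝓘(ℝ, G) b →L[ℝ] ℝ) s₀).baseSet := by
    rw [hom_trivializationAt_baseSet]
    exact ⟨hs, by simp⟩
  rw [ContinuousLinearMap.inCoordinates]
  simp only [ContinuousLinearMap.coe_comp, Function.comp_apply,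
    Bundle.Trivialization.continuousLinearMapAt_apply]
  rw [Bundle.Trivialization.linearMapAt_apply, if_pos hs', hom_trivializationAt_apply,
    ContinuousLinearMap.inCoordinates]
  simp only [ContinuousLinearMap.coe_comp, Function.comp_apply]
  rw [Bundle.Trivialization.symmL_apply _ hs, Bundle.Trivialization.symmL_apply _ hs]
  simp [t]

/-- The pullback of a metric, as a metric, when it is nondegenerate. -/
def pullbackMetric (g : PseudoMetric E M) (φ : S → M) (hφ : ContMDiff 𝓘(ℝ, G) 𝓘(ℝ, E) ∞ φ)
    (hnd : ∀ (s : S) (v : TangentSpace 𝓘(ℝ, G) s), (∀ w, pullbackForm g φ s v w = 0) → v = 0) : PseudoMetric G S where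
  val := pullbackForm g φ
  symm s _ _ := g.symm (φ s) _ _
  nondeg := hnd
  contMDiff := contMDiff_pullbackForm g hφ

end Pullback

/-! ### Hypersurfaces `ι : N → M` -/

section Hypersurface

variable {F : Type*} [NormedAddCommGroup F] [NormedSpace ℝ F] [FiniteDimensional ℝ F]
  {N : Type*} [TopologicalSpace N] [ChartedSpace F N] [IsManifold 𝓘(ℝ, F) ∞ N]
  (g : PseudoMetric E M) (ι : N → M)

/-- `Z`, a vector field on `M` differentiable at `ι p`, extends the vector field `Y` on `N`
near `p`, that is `Z ∘ ι = dι Y` near `p`. -/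
def IsExtensionAt (Y : Π p : N, TangentSpace 𝓘(ℝ, F) p) (p : N)
    (Z : Π x : M, TangentSpace 𝓘(ℝ, E) x) : Prop :=
  MDiffAt (T% Z) (ι p) ∧ ∀ᶠ p' in 𝓝 p, Z (ι p') = mfderiv 𝓘(ℝ, F) 𝓘(ℝ, E) ι p' (Y p')

/-- The spacetime derivative `∇_v Y` at `p` of a vector field `Y` tangent to the hypersurface in a
direction `v` tangent to it, computed with any extension of `Y` off the hypersurface. -/
def ambientDeriv (Y : Π p : N, TangentSpace 𝓘(ℝ, F) p) (p : N) (v : TangentSpace 𝓘(ℝ, F) p) :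
    TangentSpace 𝓘(ℝ, E) (ι p) :=
  g.leviCivita (Classical.epsilon (IsExtensionAt (E := E) ι Y p)) (ι p)
    (mfderiv 𝓘(ℝ, F) 𝓘(ℝ, E) ι p v)

/-- The induced covariant derivative `D_v Y` on the hypersurface: the vector tangent to `N` whose
image is `∇_v Y`. -/
def inducedDeriv (Y : Π p : N, TangentSpace 𝓘(ℝ, F) p) (p : N) (v : TangentSpace 𝓘(ℝ, F) p) :
    TangentSpace 𝓘(ℝ, F) p :=
  Classical.epsilon fun w => mfderiv 𝓘(ℝ, F) 𝓘(ℝ, E) ι p w = ambientDeriv g ι Y p v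

/-- A null hypersurface: an immersed submanifold of codimension one on which the pulled back metric
is degenerate at every point. -/
structure IsNullHypersurface : Prop where
  immersion : Manifold.IsImmersion 𝓘(ℝ, F) 𝓘(ℝ, E) ∞ ι
  codim_one : Module.finrank ℝ F + 1 = Module.finrank ℝ E
  degenerate : ∀ p, ∃ v : TangentSpace 𝓘(ℝ, F) p, v ≠ 0 ∧ ∀ w, pullbackForm g ι p v w = 0

variable (l : Π p : N, TangentSpace 𝓘(ℝ, F) p)

/-- The expansion of the null field `l` vanishes: the trace of `B(u, w) = g(∇_u l, w)` over
`T_pN / ℝ l` with respect to the metric induced there is zero. The trace is computed in a family of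
vectors that projects to an orthonormal basis of that quotient. -/
def IsNonExpanding : Prop :=
  ∀ (p : N) (e : Fin (Module.finrank ℝ F - 1) → TangentSpace 𝓘(ℝ, F) p),
    (∀ i j, pullbackForm g ι p (e i) (e j) = if i = j then 1 else 0) →
    ∑ i, g.val (ι p) (ambientDeriv g ι l p (e i)) (mfderiv 𝓘(ℝ, F) 𝓘(ℝ, E) ι p (e i)) = 0

/-- `(N, [l])` is an isolated null surface: `N` is a non-expanding null hypersurface, and `l` is a
smooth nowhere vanishing null vector field tangent to it whose flow preserves the induced degenerate
metric `q` and the induced covariant derivative `D`. -/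
structure IsIsolatedNullSurface : Prop where
  null_hypersurface : IsNullHypersurface (F := F) g ι
  smooth : CMDiff ∞ (T% l)
  ne_zero : ∀ p, l p ≠ 0
  null : ∀ p w, pullbackForm g ι p (l p) w = 0
  nonexpanding : IsNonExpanding g ι l
  /-- `ℒ_l q = 0` -/
  lie_metric : ∀ (U : Set N), IsOpen U → ∀ X Y : Π p : N, TangentSpace 𝓘(ℝ, F) p,
    CMDiff[U] ∞ (T% X) → CMDiff[U] ∞ (T% Y) → ∀ p ∈ U,
    mvfderiv 𝓘(ℝ, F) (fun p' => pullbackForm g ι p' (X p') (Y p')) p (l p)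
      - pullbackForm g ι p (VectorField.mlieBracket 𝓘(ℝ, F) l X p) (Y p)
      - pullbackForm g ι p (X p) (VectorField.mlieBracket 𝓘(ℝ, F) l Y p) = 0
  /-- `[ℒ_l, D] = 0` -/
  lie_connection : ∀ (U : Set N), IsOpen U → ∀ X Y : Π p : N, TangentSpace 𝓘(ℝ, F) p,
    CMDiff[U] ∞ (T% X) → CMDiff[U] ∞ (T% Y) → ∀ p ∈ U,
    VectorField.mlieBracket 𝓘(ℝ, F) l (fun p' => inducedDeriv g ι Y p' (X p')) p
      - inducedDeriv g ι Y p (VectorField.mlieBracket 𝓘(ℝ, F) l X p)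
      - inducedDeriv g ι (fun p' => VectorField.mlieBracket 𝓘(ℝ, F) l Y p') p (X p) = 0

/-- The rotation 1-form `ω` of `l`, defined by `D_v l = ω(v) l`. -/
def rotationForm (p : N) (v : TangentSpace 𝓘(ℝ, F) p) : ℝ :=
  Classical.epsilon fun c : ℝ => inducedDeriv g ι l p v = c • l p

/-- The surface gravity `κ` of `l`, defined by `∇_l l = κ l`. -/
def surfaceGravity (p : N) : ℝ :=
  Classical.epsilon fun c : ℝ =>
    ambientDeriv g ι l p (l p) = c • mfderiv 𝓘(ℝ, F) 𝓘(ℝ, E) ι p (l p)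

/-- The isolated null surface `(N, [l])` is extremal: its surface gravity vanishes. -/
def IsExtremal : Prop := ∀ p, surfaceGravity g ι l p = 0

variable {G : Type*} [NormedAddCommGroup G] [NormedSpace ℝ G] [FiniteDimensional ℝ G]
  {S : Type*} [TopologicalSpace S] [ChartedSpace G S] [IsManifold 𝓘(ℝ, G) ∞ S]

/-- `j : S → N` is a spacelike submanifold of the null hypersurface, of codimension two in the
spacetime, transversal to the orbits of the flow of `l`. -/
structure IsSpacelikeSection (j : S → N) : Prop where
  immersion : Manifold.IsImmersion 𝓘(ℝ, G) 𝓘(ℝ, F) ∞ j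
  codim_two : Module.finrank ℝ G + 2 = Module.finrank ℝ E
  spacelike : ∀ (s : S) (v : TangentSpace 𝓘(ℝ, G) s), v ≠ 0 → 0 < pullbackForm g (ι ∘ j) s v v
  transversal : ∀ (s : S) (v : TangentSpace 𝓘(ℝ, G) s),
    mfderiv 𝓘(ℝ, G) 𝓘(ℝ, F) j s v ≠ l (j s)

variable {g ι l}

/-- The metric induced on a spacelike section. -/
def IsSpacelikeSection.metric {j : S → N} (h : IsSpacelikeSection (G := G) g ι l j)
    (hN : IsNullHypersurface (F := F) g ι) : PseudoMetric G S :=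
  pullbackMetric g (ι ∘ j) (hN.immersion.contMDiff.comp h.immersion.contMDiff) (by
    intro s v hv
    by_contra hne
    exact (h.spacelike s v hne).ne' (hv v))

variable (g ι l)

/-- The pullback `ω̃` of the rotation 1-form to a section. -/
def rotationFormOn (j : S → N) (s : S) (v : TangentSpace 𝓘(ℝ, G) s) : ℝ :=
  rotationForm g ι l (j s) (mfderiv 𝓘(ℝ, G) 𝓘(ℝ, F) j s v)

end Hypersurface

end NullGeom

end

/-!
Near a point the hypersurface and the section are parametrized by open subsets of their model
spaces, and everything is computed with fields along these parametrizations, the connection of `g`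
entering through its Christoffel symbols `Γ`.

On a null hypersurface whose null field `ℓ` is Killing for the degenerate metric, `∇_u ℓ = ω(u) ℓ`
and `ω(ℓ) = κ`. The condition `[ℒ_ℓ, D] = 0` reads `R(ℓ, u) w = -(∇_u ∇_w - ∇_{D_u w}) ℓ`, and the
right-hand side is `-((Dω)(u, w) + ω(u) ω(w)) ℓ`.

Along a section the tangent space of spacetime is spanned by `ℓ`, by the tangent space of the
section and by one transversal vector. In the trace of `z ↦ R(z, v) w`, the field `ℓ` and, by the
symmetries of `R`, the transversal vector each contribute `-(D̃ω̃ + ω̃ ⊗ ω̃)` up to exchanging `v`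
and `w`; the terms by which the connection of the section differs from `D` carry the factor `κ = 0`.
For `u` tangent to the section `R(u, v) w` is the curvature of the section up to a multiple of `ℓ`,
since the second fundamental form of the section is a multiple of `ℓ` and `∇ℓ = ω ⊗ ℓ`; this part
of the trace is therefore the Ricci tensor of the section.
-/

noncomputable section

namespace NullGeom

/-! ### Connections along maps between normed spaces -/

section Calculus

variable {E : Type*} [NormedAddCommGroup E] [NormedSpace ℝ E]
  {P : Type*} [NormedAddCommGroup P] [NormedSpace ℝ P]
  {Q : Type*} [NormedAddCommGroup Q] [NormedSpace ℝ Q]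
  {W : Type*} [NormedAddCommGroup W] [NormedSpace ℝ W]

-- Shortcuts: without them the synthesis of these instances times out on nested spaces of maps.
instance clmContinuousAdd : ContinuousAdd (P →L[ℝ] W) :=
  inferInstance

instance bilinNormedAddCommGroup : NormedAddCommGroup (Q →L[ℝ] P →L[ℝ] W) :=
  ContinuousLinearMap.toNormedAddCommGroup

instance bilinNormedSpace : NormedSpace ℝ (Q →L[ℝ] P →L[ℝ] W) :=
  ContinuousLinearMap.toNormedSpace

theorem fderiv_clm_apply₂ {A : P → E →L[ℝ] E →L[ℝ] W} {a b : P → E} {p : P}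
    (hA : DifferentiableAt ℝ A p) (ha : DifferentiableAt ℝ a p) (hb : DifferentiableAt ℝ b p)
    (u : P) :
    fderiv ℝ (fun q ↦ A q (a q) (b q)) p u =
      fderiv ℝ A p u (a p) (b p) + A p (fderiv ℝ a p u) (b p) + A p (a p) (fderiv ℝ b p u) := by
  rw [fderiv_clm_apply (hA.clm_apply ha) hb, fderiv_clm_apply hA ha]
  simp only [add_apply, ContinuousLinearMap.coe_comp, Function.comp_apply,
    ContinuousLinearMap.flip_apply]
  abel

theorem fderiv_apply_apply_symm {A : P → E →L[ℝ] E →L[ℝ] W} {p : P}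
    (hA : DifferentiableAt ℝ A p) (hs : ∀ᶠ q in 𝓝 p, ∀ a b, A q a b = A q b a) (u : P) (a b : E) :
    fderiv ℝ A p u a b = fderiv ℝ A p u b a := by
  have hab : (fun q ↦ A q a b) =ᶠ[𝓝 p] fun q ↦ A q b a := hs.mono fun q hq ↦ hq a b
  have hderiv := congrArg (fun L : P →L[ℝ] W ↦ L u) hab.fderiv_eq
  simp only [fderiv_clm_apply₂ hA (differentiableAt_const a) (differentiableAt_const b),
    fderiv_clm_apply₂ hA (differentiableAt_const b) (differentiableAt_const a)] at hderiv
  simpa using hderiv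

theorem fderiv_fun_comp_apply {A : E → W} {φ : P → E} {p : P}
    (hA : DifferentiableAt ℝ A (φ p)) (hφ : DifferentiableAt ℝ φ p) (v : P) :
    fderiv ℝ (fun q ↦ A (φ q)) p v = fderiv ℝ A (φ p) (fderiv ℝ φ p v) :=
  congrArg (fun L : P →L[ℝ] W ↦ L v) (fderiv_comp p hA hφ)

theorem eventually_differentiableAt {f : P → W} {p : P} (h : ContDiffAt ℝ ∞ f p) :
    ∀ᶠ q in 𝓝 p, DifferentiableAt ℝ f q :=
  ((h.of_le (m := 1) (by simp)).eventually (by simp)).mono fun _ hq ↦ hq.differentiableAt (by simp)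

theorem differentiableAt_fderiv {f : P → W} {p : P} (h : ContDiffAt ℝ ∞ f p) :
    DifferentiableAt ℝ (fderiv ℝ f) p :=
  (h.fderiv_right (m := ∞) (by simp)).differentiableAt (by simp)

theorem contDiffAt_fderiv_apply {f : P → W} {v : P → P} {p : P} (h : ContDiffAt ℝ ∞ f p)
    (hv : ContDiffAt ℝ ∞ v p) : ContDiffAt ℝ ∞ (fun q ↦ fderiv ℝ f q (v q)) p :=
  (h.fderiv_right (m := ∞) (by simp)).clm_apply hv

theorem fderiv_fderiv_apply_comm {f : P → W} {p : P} (h : ContDiffAt ℝ ∞ f p) (u v : P) :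
    fderiv ℝ (fun q ↦ fderiv ℝ f q v) p u = fderiv ℝ (fun q ↦ fderiv ℝ f q u) p v := by
  have hd := differentiableAt_fderiv h
  have hle : (2 : WithTop ℕ∞) ≤ ∞ := WithTop.coe_le_coe.2 le_top
  rw [fderiv_clm_apply hd (differentiableAt_const v),
    fderiv_clm_apply hd (differentiableAt_const u)]
  simpa using h.isSymmSndFDerivAt (by simpa using hle) u v

/-- The covariant derivative `v ↦ ∇_v Y` at `p` of a field `Y` along the map `φ`, for the connection
with Christoffel symbols `Γ`. Fields along `φ` need not come from fields on `E`, so submanifolds are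
treated through their parametrizations, without extending anything off them. -/
def covAlong (Γ : E → E →L[ℝ] E →L[ℝ] E) (φ Y : P → E) (p : P) : P →L[ℝ] E :=
  fderiv ℝ Y p + ((Γ (φ p)).flip (Y p)).comp (fderiv ℝ φ p)

/-- The Riemann tensor `R(u, v) w` at `x` of the connection with Christoffel symbols `Γ`. -/
def curvature (Γ : E → E →L[ℝ] E →L[ℝ] E) (x u v w : E) : E :=
  fderiv ℝ Γ x u v w - fderiv ℝ Γ x v u w + Γ x u (Γ x v w) - Γ x v (Γ x u w)

/-- `Γ` is the field of Christoffel symbols of the pseudo-Riemannian metric `B` on the open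
set `Ω`: the connection it defines is torsion free and metric. -/
structure IsChristoffel (Ω : Set E) (B : E → E →L[ℝ] E →L[ℝ] ℝ)
    (Γ : E → E →L[ℝ] E →L[ℝ] E) : Prop where
  isOpen : IsOpen Ω
  contDiffAt_metric : ∀ x ∈ Ω, ContDiffAt ℝ ∞ B x
  metric_symm : ∀ x ∈ Ω, ∀ a b, B x a b = B x b a
  nondeg : ∀ x ∈ Ω, ∀ a, (∀ b, B x a b = 0) → a = 0
  contDiffAt : ∀ x ∈ Ω, ContDiffAt ℝ ∞ Γ x
  symm : ∀ x ∈ Ω, ∀ a b, Γ x a b = Γ x b a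
  compat : ∀ x ∈ Ω, ∀ v a b, fderiv ℝ B x v a b = B x (Γ x v a) b + B x a (Γ x v b)

variable {Γ : E → E →L[ℝ] E →L[ℝ] E} {B : E → E →L[ℝ] E →L[ℝ] ℝ} {Ω : Set E}

theorem IsChristoffel.mono {Ω' : Set E} (h : IsChristoffel Ω B Γ) (hΩ' : IsOpen Ω')
    (hsub : Ω' ⊆ Ω) : IsChristoffel Ω' B Γ where
  isOpen := hΩ'
  contDiffAt_metric x hx := h.contDiffAt_metric x (hsub hx)
  metric_symm x hx := h.metric_symm x (hsub hx)
  nondeg x hx := h.nondeg x (hsub hx)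
  contDiffAt x hx := h.contDiffAt x (hsub hx)
  symm x hx := h.symm x (hsub hx)
  compat x hx := h.compat x (hsub hx)

theorem covAlong_apply (φ Y : P → E) (p v : P) :
    covAlong Γ φ Y p v = fderiv ℝ Y p v + Γ (φ p) (fderiv ℝ φ p v) (Y p) :=
  rfl

theorem covAlong_add {φ Y Z : P → E} {p : P} (hY : DifferentiableAt ℝ Y p)
    (hZ : DifferentiableAt ℝ Z p) :
    covAlong Γ φ (fun q ↦ Y q + Z q) p = covAlong Γ φ Y p + covAlong Γ φ Z p := by
  ext v
  simp only [covAlong_apply, fderiv_fun_add hY hZ, map_add, add_apply]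
  abel

theorem covAlong_sub {φ Y Z : P → E} {p : P} (hY : DifferentiableAt ℝ Y p)
    (hZ : DifferentiableAt ℝ Z p) :
    covAlong Γ φ (fun q ↦ Y q - Z q) p = covAlong Γ φ Y p - covAlong Γ φ Z p := by
  ext v
  simp only [covAlong_apply, fderiv_fun_sub hY hZ, map_sub, sub_apply]
  abel

theorem covAlong_neg {φ Y : P → E} {p : P} :
    covAlong Γ φ (fun q ↦ -Y q) p = -covAlong Γ φ Y p := by
  ext v
  simp only [covAlong_apply, fderiv_fun_neg, map_neg, neg_apply]
  abel

theorem covAlong_smul {φ Y : P → E} {f : P → ℝ} {p v : P} (hf : DifferentiableAt ℝ f p)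
    (hY : DifferentiableAt ℝ Y p) :
    covAlong Γ φ (fun q ↦ f q • Y q) p v = f p • covAlong Γ φ Y p v + fderiv ℝ f p v • Y p := by
  simp only [covAlong_apply, fderiv_fun_smul hf hY, map_smul, add_apply, smul_apply,
    ContinuousLinearMap.smulRight_apply, smul_add]
  abel

theorem covAlong_congr {φ Y Z : P → E} {p : P} (h : Y =ᶠ[𝓝 p] Z) :
    covAlong Γ φ Y p = covAlong Γ φ Z p := by
  simp only [covAlong, h.fderiv_eq, h.eq_of_nhds]

theorem covAlong_comp {φ Y : P → E} {k : Q → P} {q v : Q} (hφ : DifferentiableAt ℝ φ (k q))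
    (hY : DifferentiableAt ℝ Y (k q)) (hk : DifferentiableAt ℝ k q) :
    covAlong Γ (fun r ↦ φ (k r)) (fun r ↦ Y (k r)) q v =
      covAlong Γ φ Y (k q) (fderiv ℝ k q v) := by
  simp only [covAlong_apply, fderiv_fun_comp_apply hφ hk, fderiv_fun_comp_apply hY hk]

theorem covAlong_clm_apply {φ : P → E} {T : P → Q →L[ℝ] E} {y : P → Q} {p : P}
    (hT : DifferentiableAt ℝ T p) (hy : DifferentiableAt ℝ y p) (u : P) :
    covAlong Γ φ (fun q ↦ T q (y q)) p u =
      covAlong Γ φ (fun q ↦ T q (y p)) p u + T p (fderiv ℝ y p u) := by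
  simp only [covAlong_apply, fderiv_clm_apply hT hy, fderiv_clm_apply hT (differentiableAt_const _),
    add_apply, ContinuousLinearMap.coe_comp, Function.comp_apply, ContinuousLinearMap.flip_apply,
    fderiv_fun_const, Pi.zero_apply, zero_apply, map_zero]
  abel

theorem contDiffAt_covAlong {φ Y : P → E} {p : P} (hΓ : ContDiffAt ℝ ∞ Γ (φ p))
    (hφ : ContDiffAt ℝ ∞ φ p) (hY : ContDiffAt ℝ ∞ Y p) :
    ContDiffAt ℝ ∞ (covAlong Γ φ Y) p :=
  have hflip : ContDiffAt ℝ ∞ (fun q ↦ (Γ (φ q)).flip) p :=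
    (ContinuousLinearMap.flipₗᵢ ℝ E E E).contDiff.contDiffAt.comp p (hΓ.comp p hφ)
  (hY.fderiv_right (m := ∞) (by simp)).add
    ((hflip.clm_apply hY).clm_comp (hφ.fderiv_right (m := ∞) (by simp)))

theorem covAlong_fderiv_comm {φ : P → E} {p : P} (hs : ∀ a b, Γ (φ p) a b = Γ (φ p) b a)
    (hφ : ContDiffAt ℝ ∞ φ p) (u v : P) :
    covAlong Γ φ (fun q ↦ fderiv ℝ φ q v) p u = covAlong Γ φ (fun q ↦ fderiv ℝ φ q u) p v := by
  rw [covAlong_apply, covAlong_apply, fderiv_fderiv_apply_comm hφ, hs]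

theorem fderiv_covAlong {φ Y : P → E} {p : P} (hΓ : ContDiffAt ℝ ∞ Γ (φ p))
    (hφ : ContDiffAt ℝ ∞ φ p) (hY : ContDiffAt ℝ ∞ Y p) (u v : P) :
    fderiv ℝ (fun q ↦ covAlong Γ φ Y q v) p u =
      fderiv ℝ (fun q ↦ fderiv ℝ Y q v) p u +
      (fderiv ℝ Γ (φ p) (fderiv ℝ φ p u) (fderiv ℝ φ p v) (Y p) +
        Γ (φ p) (fderiv ℝ (fun q ↦ fderiv ℝ φ q v) p u) (Y p) +
        Γ (φ p) (fderiv ℝ φ p v) (fderiv ℝ Y p u)) := by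
  have hΓd : DifferentiableAt ℝ Γ (φ p) := hΓ.differentiableAt (by simp)
  have hφd : DifferentiableAt ℝ φ p := hφ.differentiableAt (by simp)
  have hYd : DifferentiableAt ℝ Y p := hY.differentiableAt (by simp)
  have hY' : DifferentiableAt ℝ (fun q ↦ fderiv ℝ Y q v) p :=
    (contDiffAt_fderiv_apply hY contDiffAt_const).differentiableAt (by simp)
  have hφ' : DifferentiableAt ℝ (fun q ↦ fderiv ℝ φ q v) p :=
    (contDiffAt_fderiv_apply hφ contDiffAt_const).differentiableAt (by simp)
  have hA : DifferentiableAt ℝ (fun q ↦ Γ (φ q)) p := hΓd.comp p hφd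
  simp only [covAlong_apply]
  rw [fderiv_fun_add hY' ((hA.clm_apply hφ').clm_apply hYd), add_apply,
    fderiv_clm_apply₂ hA hφ' hYd, fderiv_fun_comp_apply hΓd hφd]

theorem covAlong_covAlong_sub {φ Y : P → E} {p : P} (hΓ : ContDiffAt ℝ ∞ Γ (φ p))
    (hφ : ContDiffAt ℝ ∞ φ p) (hY : ContDiffAt ℝ ∞ Y p) (u v : P) :
    covAlong Γ φ (fun q ↦ covAlong Γ φ Y q v) p u - covAlong Γ φ (fun q ↦ covAlong Γ φ Y q u) p v
      = curvature Γ (φ p) (fderiv ℝ φ p u) (fderiv ℝ φ p v) (Y p) := by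
  have expand (u v : P) : covAlong Γ φ (fun q ↦ covAlong Γ φ Y q v) p u =
      fderiv ℝ (fun q ↦ covAlong Γ φ Y q v) p u +
        Γ (φ p) (fderiv ℝ φ p u) (covAlong Γ φ Y p v) := rfl
  rw [expand u v, expand v u, fderiv_covAlong hΓ hφ hY, fderiv_covAlong hΓ hφ hY,
    fderiv_fderiv_apply_comm hφ u v, fderiv_fderiv_apply_comm hY u v, curvature]
  simp only [covAlong_apply, map_add]
  abel

theorem curvature_antisymm (x u v w : E) : curvature Γ x u v w = -curvature Γ x v u w := by
  simp only [curvature]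
  abel

theorem pair_symm_of_bianchi {V : Type*} {R : V → V → V → V → ℝ}
    (antisymm : ∀ u v w z, R u v w z = -R v u w z) (skew : ∀ u v w z, R u v w z = -R u v z w)
    (bianchi : ∀ u v w z, R u v w z + R v w u z + R w u v z = 0) (u v w z : V) :
    R u v w z = R w z u v := by
  have bianchi_u := bianchi u v w z
  have bianchi_v := bianchi v w z u
  have bianchi_w := bianchi w z u v
  have bianchi_z := bianchi z u v w
  grind

namespace IsChristoffel

theorem fderiv_metric_apply (h : IsChristoffel Ω B Γ) {φ Y Z : P → E} {p : P} (hp : φ p ∈ Ω)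
    (hφ : DifferentiableAt ℝ φ p) (hY : DifferentiableAt ℝ Y p) (hZ : DifferentiableAt ℝ Z p)
    (v : P) :
    fderiv ℝ (fun q ↦ B (φ q) (Y q) (Z q)) p v =
      B (φ p) (covAlong Γ φ Y p v) (Z p) + B (φ p) (Y p) (covAlong Γ φ Z p v) := by
  have hB : DifferentiableAt ℝ B (φ p) := (h.contDiffAt_metric _ hp).differentiableAt (by simp)
  rw [fderiv_clm_apply₂ (A := fun q ↦ B (φ q)) (hB.comp p hφ) hY hZ v,
    fderiv_fun_comp_apply hB hφ, h.compat _ hp]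
  simp only [covAlong_apply, map_add, add_apply]
  ring

theorem fderiv_fderiv_metric_apply (h : IsChristoffel Ω B Γ) {φ Y Z : P → E} {p : P}
    (hp : φ p ∈ Ω) (hφ : ContDiffAt ℝ ∞ φ p) (hY : ContDiffAt ℝ ∞ Y p) (hZ : ContDiffAt ℝ ∞ Z p)
    (u v : P) :
    fderiv ℝ (fun q ↦ fderiv ℝ (fun q ↦ B (φ q) (Y q) (Z q)) q v) p u =
      B (φ p) (covAlong Γ φ (fun q ↦ covAlong Γ φ Y q v) p u) (Z p) +
        B (φ p) (covAlong Γ φ Y p v) (covAlong Γ φ Z p u) +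
      (B (φ p) (covAlong Γ φ Y p u) (covAlong Γ φ Z p v) +
        B (φ p) (Y p) (covAlong Γ φ (fun q ↦ covAlong Γ φ Z q v) p u)) := by
  have hφd : DifferentiableAt ℝ φ p := hφ.differentiableAt (by simp)
  have hYd : DifferentiableAt ℝ Y p := hY.differentiableAt (by simp)
  have hZd : DifferentiableAt ℝ Z p := hZ.differentiableAt (by simp)
  have hY' : DifferentiableAt ℝ (fun q ↦ covAlong Γ φ Y q v) p :=
    ((contDiffAt_covAlong (h.contDiffAt _ hp) hφ hY).differentiableAt (by simp)).clm_apply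
      (differentiableAt_const v)
  have hZ' : DifferentiableAt ℝ (fun q ↦ covAlong Γ φ Z q v) p :=
    ((contDiffAt_covAlong (h.contDiffAt _ hp) hφ hZ).differentiableAt (by simp)).clm_apply
      (differentiableAt_const v)
  have hB : DifferentiableAt ℝ (fun q ↦ B (φ q)) p :=
    ((h.contDiffAt_metric _ hp).differentiableAt (by simp)).comp p hφd
  have first_deriv : (fun q ↦ fderiv ℝ (fun q ↦ B (φ q) (Y q) (Z q)) q v) =ᶠ[𝓝 p] fun q ↦
      B (φ q) (covAlong Γ φ Y q v) (Z q) + B (φ q) (Y q) (covAlong Γ φ Z q v) := by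
    filter_upwards [hφ.continuousAt.eventually (h.isOpen.mem_nhds hp),
      eventually_differentiableAt hφ, eventually_differentiableAt hY,
      eventually_differentiableAt hZ] with q hq hφq hYq hZq
    exact h.fderiv_metric_apply hq hφq hYq hZq v
  rw [first_deriv.fderiv_eq, fderiv_fun_add ((hB.clm_apply hY').clm_apply hZd)
    ((hB.clm_apply hYd).clm_apply hZ'), add_apply, h.fderiv_metric_apply hp hφd hY' hZd,
    h.fderiv_metric_apply hp hφd hYd hZ']

theorem fderiv_symm (h : IsChristoffel Ω B Γ) {x : E} (hx : x ∈ Ω) (a b c : E) :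
    fderiv ℝ Γ x a b c = fderiv ℝ Γ x a c b :=
  fderiv_apply_apply_symm ((h.contDiffAt x hx).differentiableAt (by simp))
    (by filter_upwards [h.isOpen.mem_nhds hx] using h.symm) a b c

theorem curvature_bianchi (h : IsChristoffel Ω B Γ) {x : E} (hx : x ∈ Ω) (u v w : E) :
    curvature Γ x u v w + curvature Γ x v w u + curvature Γ x w u v = 0 := by
  simp only [curvature]
  rw [h.fderiv_symm hx u v w, h.fderiv_symm hx v w u, h.fderiv_symm hx w u v,
    h.symm x hx u v, h.symm x hx v w, h.symm x hx w u]
  abel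

theorem curvature_skew (h : IsChristoffel Ω B Γ) {x : E} (hx : x ∈ Ω) (u v w z : E) :
    B x (curvature Γ x u v w) z = -B x w (curvature Γ x u v z) := by
  have hid : ContDiffAt ℝ ∞ (fun y : E ↦ y) x := contDiffAt_id
  have hw : ContDiffAt ℝ ∞ (fun _ : E ↦ w) x := contDiffAt_const
  have hz : ContDiffAt ℝ ∞ (fun _ : E ↦ z) x := contDiffAt_const
  have second_deriv_symm := fderiv_fderiv_apply_comm
    (((h.contDiffAt_metric x hx).clm_apply hw).clm_apply hz) u v
  rw [h.fderiv_fderiv_metric_apply hx hid hw hz, h.fderiv_fderiv_metric_apply hx hid hw hz]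
    at second_deriv_symm
  have curvature_w := covAlong_covAlong_sub (φ := fun y : E ↦ y) (h.contDiffAt x hx) hid hw u v
  have curvature_z := covAlong_covAlong_sub (φ := fun y : E ↦ y) (h.contDiffAt x hx) hid hz u v
  simp only [fderiv_fun_id, ContinuousLinearMap.id_apply] at curvature_w curvature_z
  rw [← curvature_w, ← curvature_z]
  simp only [map_sub, sub_apply]
  linarith

theorem curvature_pair_symm (h : IsChristoffel Ω B Γ) {x : E} (hx : x ∈ Ω) (u v w z : E) :
    B x (curvature Γ x u v w) z = B x (curvature Γ x w z u) v := by
  refine pair_symm_of_bianchi (R := fun u v w z ↦ B x (curvature Γ x u v w) z)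
    (fun u v w z ↦ ?_) (fun u v w z ↦ ?_) (fun u v w z ↦ ?_) u v w z
  · rw [curvature_antisymm, map_neg, neg_apply]
  · rw [h.curvature_skew hx, h.metric_symm x hx]
  · simp only [← add_apply, ← map_add, h.curvature_bianchi hx, map_zero, zero_apply]

end IsChristoffel

end Calculus

/-! ### Christoffel symbols of a nondegenerate metric -/

section Christoffel

variable {E : Type*} [NormedAddCommGroup E] [NormedSpace ℝ E]

instance trilinNormedAddCommGroup : NormedAddCommGroup (E →L[ℝ] E →L[ℝ] E →L[ℝ] ℝ) :=
  ContinuousLinearMap.toNormedAddCommGroup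

instance trilinNormedSpace : NormedSpace ℝ (E →L[ℝ] E →L[ℝ] E →L[ℝ] ℝ) :=
  ContinuousLinearMap.toNormedSpace

instance dualHomNormedAddCommGroup : NormedAddCommGroup ((E →L[ℝ] ℝ) →L[ℝ] E) :=
  ContinuousLinearMap.toNormedAddCommGroup

instance homBilinNormedAddCommGroup :
    NormedAddCommGroup ((E →L[ℝ] E →L[ℝ] ℝ) →L[ℝ] E →L[ℝ] E) :=
  ContinuousLinearMap.toNormedAddCommGroup

instance homBilinNormedSpace : NormedSpace ℝ ((E →L[ℝ] E →L[ℝ] ℝ) →L[ℝ] E →L[ℝ] E) :=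
  ContinuousLinearMap.toNormedSpace

/-- The Christoffel symbols of the first kind of a metric with derivative `D`, that is, half of the
right-hand side of Koszul's formula for constant vector fields. -/
def koszulForm (D : E →L[ℝ] E →L[ℝ] E →L[ℝ] ℝ) : E →L[ℝ] E →L[ℝ] E →L[ℝ] ℝ :=
  (1 / 2 : ℝ) • (D + D.flip -
    (ContinuousLinearMap.flipₗᵢ ℝ E E ℝ).toContinuousLinearEquiv.toContinuousLinearMap.comp D.flip)

theorem koszulForm_apply (D : E →L[ℝ] E →L[ℝ] E →L[ℝ] ℝ) (a b c : E) :
    koszulForm D a b c = (1 / 2 : ℝ) * (D a b c + D b a c - D c a b) :=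
  rfl

theorem contDiff_koszulForm : ContDiff ℝ ∞ (koszulForm (E := E)) := by
  have hflip : ContDiff ℝ ∞ fun D : E →L[ℝ] E →L[ℝ] E →L[ℝ] ℝ ↦ D.flip :=
    (ContinuousLinearMap.flipₗᵢ ℝ E E (E →L[ℝ] ℝ)).contDiff
  exact ((contDiff_id.add hflip).sub (contDiff_const.clm_comp hflip)).const_smul (1 / 2 : ℝ)

/-- The Christoffel symbols of the metric `B`, obtained by raising an index of `koszulForm`; a junk
value at the points where `B` is degenerate. -/
def christoffel (B : E → E →L[ℝ] E →L[ℝ] ℝ) (x : E) : E →L[ℝ] E →L[ℝ] E :=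
  (ContinuousLinearMap.compL ℝ E (E →L[ℝ] ℝ) E (B x).inverse).comp (koszulForm (fderiv ℝ B x))

variable [FiniteDimensional ℝ E]

theorem isInvertible_of_nondeg {A : E →L[ℝ] E →L[ℝ] ℝ} (hA : ∀ a, (∀ b, A a b = 0) → a = 0) :
    A.IsInvertible := by
  have hinj : Function.Injective A.toLinearMap :=
    (injective_iff_map_eq_zero _).2 fun a ha ↦ hA a fun b ↦ congrArg (fun L : E →L[ℝ] ℝ ↦ L b) ha
  have hdim : Module.finrank ℝ E = Module.finrank ℝ (E →L[ℝ] ℝ) :=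
    (Subspace.dual_finrank_eq (K := ℝ) (V := E)).symm.trans
      (LinearMap.toContinuousLinearMap (𝕜 := ℝ) (E := E) (F' := ℝ)).finrank_eq
  exact ⟨(LinearEquiv.ofInjectiveOfFinrankEq A.toLinearMap hinj hdim).toContinuousLinearEquiv, rfl⟩

theorem apply_christoffel {B : E → E →L[ℝ] E →L[ℝ] ℝ} {x : E}
    (hnd : ∀ a, (∀ b, B x a b = 0) → a = 0) (a b c : E) :
    B x (christoffel B x a b) c = koszulForm (fderiv ℝ B x) a b c := by
  simp only [christoffel, ContinuousLinearMap.comp_apply, ContinuousLinearMap.compL_apply,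
    (isInvertible_of_nondeg hnd).self_apply_inverse]

theorem contDiffAt_christoffel {B : E → E →L[ℝ] E →L[ℝ] ℝ} {x : E} (hB : ContDiffAt ℝ ∞ B x)
    (hnd : ∀ a, (∀ b, B x a b = 0) → a = 0) : ContDiffAt ℝ ∞ (christoffel B) x := by
  have hinverse : ContDiffAt ℝ ∞ (fun y ↦ (B y).inverse) x :=
    ContDiffAt.comp (g := ContinuousLinearMap.inverse) x
      (isInvertible_of_nondeg hnd).contDiffAt_map_inverse hB
  have hkoszul : ContDiffAt ℝ ∞ (fun y ↦ koszulForm (fderiv ℝ B y)) x :=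
    contDiff_koszulForm.contDiffAt.comp x (hB.fderiv_right (m := ∞) (by simp))
  exact ((ContinuousLinearMap.compL ℝ E (E →L[ℝ] ℝ) E).contDiff.contDiffAt.comp x
    hinverse).clm_comp hkoszul

theorem isChristoffel_christoffel {Ω : Set E} {B : E → E →L[ℝ] E →L[ℝ] ℝ} (hΩ : IsOpen Ω)
    (hB : ∀ x ∈ Ω, ContDiffAt ℝ ∞ B x) (hs : ∀ x ∈ Ω, ∀ a b, B x a b = B x b a)
    (hnd : ∀ x ∈ Ω, ∀ a, (∀ b, B x a b = 0) → a = 0) : IsChristoffel Ω B (christoffel B) := by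
  have hD {x : E} (hx : x ∈ Ω) : ∀ v a b, fderiv ℝ B x v a b = fderiv ℝ B x v b a :=
    fderiv_apply_apply_symm ((hB x hx).differentiableAt (by simp))
      (by filter_upwards [hΩ.mem_nhds hx] using hs)
  refine ⟨hΩ, hB, hs, hnd, fun x hx ↦ contDiffAt_christoffel (hB x hx) (hnd x hx),
    fun x hx a b ↦ ?_, fun x hx v a b ↦ ?_⟩
  · refine sub_eq_zero.1 (hnd x hx _ fun c ↦ ?_)
    rw [map_sub, sub_apply, apply_christoffel (hnd x hx), apply_christoffel (hnd x hx),
      koszulForm_apply, koszulForm_apply, hD hx c a b]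
    ring
  · rw [hs x hx a, apply_christoffel (hnd x hx), apply_christoffel (hnd x hx), koszulForm_apply,
      koszulForm_apply, hD hx v b a, hD hx b v a, hD hx a v b]
    ring

end Christoffel

section NullHyperplane

variable {K V : Type*} [Field K] [AddCommGroup V] [Module K V] [FiniteDimensional K V]

theorem orthogonal_eq_span_singleton {B : LinearMap.BilinForm K V} (hB : B.Nondegenerate)
    {H : Submodule K V} (hH : Module.finrank K H + 1 = Module.finrank K V) {n : V}
    (hn : n ∈ B.orthogonal H) (h0 : n ≠ 0) : B.orthogonal H = K ∙ n := by
  refine (Submodule.eq_of_le_of_finrank_eq ((Submodule.span_singleton_le_iff_mem _ _).2 hn) ?_).symm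
  rw [finrank_span_singleton h0, LinearMap.BilinForm.finrank_orthogonal hB]
  lia

variable {E : Type*} [NormedAddCommGroup E] [NormedSpace ℝ E]

theorem nondegenerate_toBilinForm {B : E →L[ℝ] E →L[ℝ] ℝ} (hs : ∀ a b, B a b = B b a)
    (hnd : ∀ a, (∀ b, B a b = 0) → a = 0) : B.toBilinForm.Nondegenerate :=
  ⟨hnd, fun a ha ↦ hnd a fun b ↦ (hs a b).trans (ha b)⟩

variable [FiniteDimensional ℝ E] {F : Type*} [NormedAddCommGroup F] [NormedSpace ℝ F]

theorem orthogonal_range_eq_span_singleton {A : F →L[ℝ] E} (hA : Function.Injective A)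
    (hdim : Module.finrank ℝ F + 1 = Module.finrank ℝ E) {B : E →L[ℝ] E →L[ℝ] ℝ}
    (hs : ∀ a b, B a b = B b a) (hnd : ∀ a, (∀ b, B a b = 0) → a = 0) {l : F} (hl : l ≠ 0)
    (hnull : ∀ w, B (A l) (A w) = 0) :
    B.toBilinForm.orthogonal (LinearMap.range A.toLinearMap) = ℝ ∙ A l := by
  refine orthogonal_eq_span_singleton (nondegenerate_toBilinForm hs hnd) ?_ ?_
    ((map_ne_zero_iff A hA).2 hl)
  · rw [LinearMap.finrank_range_of_inj hA, hdim]
  · rintro _ ⟨w, rfl⟩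
    exact (hs _ _).trans (hnull w)

theorem exists_eq_smul_of_forall_apply_eq_zero {A : F →L[ℝ] E} (hA : Function.Injective A)
    (hdim : Module.finrank ℝ F + 1 = Module.finrank ℝ E) {B : E →L[ℝ] E →L[ℝ] ℝ}
    (hs : ∀ a b, B a b = B b a) (hnd : ∀ a, (∀ b, B a b = 0) → a = 0) {l : F} (hl : l ≠ 0)
    (hnull : ∀ w, B (A l) (A w) = 0) {x : E} (hx : ∀ w, B x (A w) = 0) : ∃ c : ℝ, x = c • A l := by
  have hmem : x ∈ B.toBilinForm.orthogonal (LinearMap.range A.toLinearMap) := by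
    rintro _ ⟨w, rfl⟩
    exact (hs _ _).trans (hx w)
  rw [orthogonal_range_eq_span_singleton hA hdim hs hnd hl hnull] at hmem
  obtain ⟨c, hc⟩ := Submodule.mem_span_singleton.1 hmem
  exact ⟨c, hc.symm⟩

theorem exists_apply_eq_of_apply_eq_zero {A : F →L[ℝ] E} (hA : Function.Injective A)
    (hdim : Module.finrank ℝ F + 1 = Module.finrank ℝ E) {B : E →L[ℝ] E →L[ℝ] ℝ}
    (hs : ∀ a b, B a b = B b a) (hnd : ∀ a, (∀ b, B a b = 0) → a = 0) {l : F} (hl : l ≠ 0)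
    (hnull : ∀ w, B (A l) (A w) = 0) {x : E} (hx : B x (A l) = 0) : ∃ w, A w = x := by
  have hrefl : B.toBilinForm.IsRefl := fun a b hab ↦ (hs b a).trans hab
  have hmem : x ∈ B.toBilinForm.orthogonal (ℝ ∙ A l) := by
    intro _ hy
    obtain ⟨c, rfl⟩ := Submodule.mem_span_singleton.1 hy
    simp [hs _ x, hx]
  rwa [← orthogonal_range_eq_span_singleton hA hdim hs hnd hl hnull,
    LinearMap.BilinForm.orthogonal_orthogonal (nondegenerate_toBilinForm hs hnd) hrefl] at hmem

end NullHyperplane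

section Smoothness

variable {E : Type*} [NormedAddCommGroup E] [NormedSpace ℝ E] [FiniteDimensional ℝ E]
  {F : Type*} [NormedAddCommGroup F] [NormedSpace ℝ F] [FiniteDimensional ℝ F]
  {P : Type*} [NormedAddCommGroup P] [NormedSpace ℝ P]

theorem contDiffAt_of_clm_apply_eq {A : P → F →L[ℝ] E} {X : P → E} {δ : P → F} {p : P}
    (hA : ContDiffAt ℝ ∞ A p) (hX : ContDiffAt ℝ ∞ X p) (hinj : Function.Injective (A p))
    (h : ∀ᶠ q in 𝓝 p, A q (δ q) = X q) : ContDiffAt ℝ ∞ δ p := by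
  have hcomplete : CompleteSpace F := FiniteDimensional.complete ℝ F
  obtain ⟨R, hR⟩ := ContinuousLinearMap.HasLeftInverse.of_injective_of_finiteDimensional hinj
  have hRA : ContDiffAt ℝ ∞ (fun q ↦ R.comp (A q)) p := contDiffAt_const.clm_comp hA
  have hid : R.comp (A p) = ContinuousLinearEquiv.refl ℝ F := ContinuousLinearMap.ext hR
  have hinverse : ContDiffAt ℝ ∞ (fun q ↦ (R.comp (A q)).inverse) p := by
    refine ContDiffAt.comp (g := ContinuousLinearMap.inverse) p ?_ hRA
    exact ContinuousLinearMap.IsInvertible.contDiffAt_map_inverse ⟨_, hid.symm⟩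
  have hinvertible : ∀ᶠ q in 𝓝 p, (R.comp (A q)).IsInvertible :=
    hRA.continuousAt (by rw [hid]; exact ContinuousLinearEquiv.nhds _)
  refine (hinverse.clm_apply (R.contDiff.contDiffAt.comp p hX)).congr_of_eventuallyEq ?_
  filter_upwards [h, hinvertible] with q hq hi
  rw [Function.comp_apply, ← hq]
  exact (hi.inverse_apply_self (δ q)).symm

end Smoothness

/-! ### Isolated null hypersurfaces in coordinates -/

section NullMap

variable {E : Type*} [NormedAddCommGroup E] [NormedSpace ℝ E]
  {F : Type*} [NormedAddCommGroup F] [NormedSpace ℝ F]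

/-- A codimension-one immersion `φ` of the open set `V`, null for the metric `B` on `Ω`, with a
nowhere vanishing null field `L` whose flow preserves the pulled back metric. -/
structure IsNullMap (Ω : Set E) (B : E → E →L[ℝ] E →L[ℝ] ℝ) (V : Set F) (φ : F → E)
    (L : F → F) : Prop where
  isOpen : IsOpen V
  contDiffAt : ∀ z ∈ V, ContDiffAt ℝ ∞ φ z
  mem : ∀ z ∈ V, φ z ∈ Ω
  injective : ∀ z ∈ V, Function.Injective (fderiv ℝ φ z)
  finrank_add_one : Module.finrank ℝ F + 1 = Module.finrank ℝ E
  contDiffAt_field : ∀ z ∈ V, ContDiffAt ℝ ∞ L z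
  field_ne_zero : ∀ z ∈ V, L z ≠ 0
  null : ∀ z ∈ V, ∀ w, B (φ z) (fderiv ℝ φ z (L z)) (fderiv ℝ φ z w) = 0
  lie_metric : ∀ z ∈ V, ∀ u w,
    fderiv ℝ (fun y ↦ B (φ y) (fderiv ℝ φ y u) (fderiv ℝ φ y w)) z (L z) +
      B (φ z) (fderiv ℝ φ z (fderiv ℝ L z u)) (fderiv ℝ φ z w) +
      B (φ z) (fderiv ℝ φ z u) (fderiv ℝ φ z (fderiv ℝ L z w)) = 0

/-- The field `L` seen as a field along `φ`; on a null hypersurface it is both tangent and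
normal. -/
def normalField (φ : F → E) (L : F → F) (z : F) : E :=
  fderiv ℝ φ z (L z)

/-- The rotation form `ω` of the null field `L`, defined by `∇_u ℓ = ω(u) ℓ` for the field
`ℓ = normalField φ L` along `φ`. -/
def rotationAlong (Γ : E → E →L[ℝ] E →L[ℝ] E) (φ : F → E) (L : F → F) (z : F) : F →L[ℝ] ℝ :=
  Classical.epsilon fun ρ : F →L[ℝ] ℝ ↦
    ∀ u, covAlong Γ φ (normalField φ L) z u = ρ u • normalField φ L z

/-- The flow of `L` preserves the connection induced on `V`: for constant fields `u` and `w`, with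
`δ = D_u w` the induced derivative, `[L, δ] - D_{[L, u]} w - D_u [L, w]` vanishes. -/
def PreservesConnection (Γ : E → E →L[ℝ] E →L[ℝ] E) (V : Set F) (φ : F → E) (L : F → F) :
    Prop :=
  ∀ (u w : F) (δ : F → F),
    (∀ z ∈ V, fderiv ℝ φ z (δ z) = covAlong Γ φ (fun y ↦ fderiv ℝ φ y w) z u) → ∀ z ∈ V,
      fderiv ℝ φ z (fderiv ℝ δ z (L z) - fderiv ℝ L z (δ z)) +
        covAlong Γ φ (fun y ↦ fderiv ℝ φ y w) z (fderiv ℝ L z u) +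
        covAlong Γ φ (fun y ↦ fderiv ℝ φ y (fderiv ℝ L y w)) z u = 0

namespace IsNullMap

variable {Γ : E → E →L[ℝ] E →L[ℝ] E} {B : E → E →L[ℝ] E →L[ℝ] ℝ} {Ω : Set E}
  {V : Set F} {φ : F → E} {L : F → F}

theorem contDiffAt_normalField (h : IsNullMap Ω B V φ L) {z : F} (hz : z ∈ V) :
    ContDiffAt ℝ ∞ (normalField φ L) z :=
  contDiffAt_fderiv_apply (h.contDiffAt z hz) (h.contDiffAt_field z hz)

theorem differentiableAt_normalField (h : IsNullMap Ω B V φ L) {z : F} (hz : z ∈ V) :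
    DifferentiableAt ℝ (normalField φ L) z :=
  (h.contDiffAt_normalField hz).differentiableAt (by simp)

theorem normalField_ne_zero (h : IsNullMap Ω B V φ L) {z : F} (hz : z ∈ V) :
    normalField φ L z ≠ 0 :=
  (map_ne_zero_iff _ (h.injective z hz)).2 (h.field_ne_zero z hz)

theorem contDiffAt_fderiv_const (h : IsNullMap Ω B V φ L) {z : F} (hz : z ∈ V) (v : F) :
    ContDiffAt ℝ ∞ (fun y ↦ fderiv ℝ φ y v) z :=
  contDiffAt_fderiv_apply (h.contDiffAt z hz) contDiffAt_const

theorem covAlong_normalField_swap (h : IsNullMap Ω B V φ L) (hΓ : IsChristoffel Ω B Γ) {z : F}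
    (hz : z ∈ V) (u : F) :
    covAlong Γ φ (normalField φ L) z u =
      covAlong Γ φ (fun y ↦ fderiv ℝ φ y u) z (L z) + fderiv ℝ φ z (fderiv ℝ L z u) :=
  (covAlong_clm_apply (differentiableAt_fderiv (h.contDiffAt z hz))
    ((h.contDiffAt_field z hz).differentiableAt (by simp)) u).trans <| by
      rw [covAlong_fderiv_comm (hΓ.symm _ (h.mem z hz)) (h.contDiffAt z hz)]

theorem metric_covAlong_normalField_antisymm (h : IsNullMap Ω B V φ L) (hΓ : IsChristoffel Ω B Γ)
    {z : F} (hz : z ∈ V) (u w : F) :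
    B (φ z) (covAlong Γ φ (normalField φ L) z u) (fderiv ℝ φ z w) +
      B (φ z) (covAlong Γ φ (normalField φ L) z w) (fderiv ℝ φ z u) = 0 := by
  have hlie := h.lie_metric z hz u w
  rw [hΓ.fderiv_metric_apply (h.mem z hz) ((h.contDiffAt z hz).differentiableAt (by simp))
    ((h.contDiffAt_fderiv_const hz u).differentiableAt (by simp))
    ((h.contDiffAt_fderiv_const hz w).differentiableAt (by simp))] at hlie
  rw [h.covAlong_normalField_swap hΓ hz, h.covAlong_normalField_swap hΓ hz,
    hΓ.metric_symm _ (h.mem z hz) _ (fderiv ℝ φ z u)]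
  simp only [map_add, add_apply]
  linarith

theorem metric_covAlong_normalField_add (h : IsNullMap Ω B V φ L) (hΓ : IsChristoffel Ω B Γ)
    {z : F} (hz : z ∈ V) {y : F → F} (hy : DifferentiableAt ℝ y z) (u : F) :
    B (φ z) (covAlong Γ φ (normalField φ L) z u) (fderiv ℝ φ z (y z)) +
      B (φ z) (normalField φ L z) (covAlong Γ φ (fun q ↦ fderiv ℝ φ q (y q)) z u) = 0 := by
  have hnull : (fun q ↦ B (φ q) (normalField φ L q) (fderiv ℝ φ q (y q))) =ᶠ[𝓝 z] fun _ ↦ 0 := by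
    filter_upwards [h.isOpen.mem_nhds hz] with q hq using h.null q hq (y q)
  rw [← hΓ.fderiv_metric_apply (h.mem z hz) ((h.contDiffAt z hz).differentiableAt (by simp))
    (h.differentiableAt_normalField hz)
    ((differentiableAt_fderiv (h.contDiffAt z hz)).clm_apply hy), hnull.fderiv_eq]
  simp

-- `B (∇_u ℓ) w` is antisymmetric in `u, w` because `ℓ` is Killing and symmetric because `ℓ` is
-- normal and the connection is torsion free.
theorem metric_covAlong_normalField (h : IsNullMap Ω B V φ L) (hΓ : IsChristoffel Ω B Γ) {z : F}
    (hz : z ∈ V) (u w : F) :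
    B (φ z) (covAlong Γ φ (normalField φ L) z u) (fderiv ℝ φ z w) = 0 := by
  have antisymm := h.metric_covAlong_normalField_antisymm hΓ hz u w
  have normal_uw := h.metric_covAlong_normalField_add hΓ hz (differentiableAt_const w) u
  have normal_wu := h.metric_covAlong_normalField_add hΓ hz (differentiableAt_const u) w
  rw [covAlong_fderiv_comm (hΓ.symm _ (h.mem z hz)) (h.contDiffAt z hz)] at normal_uw
  linarith

variable [FiniteDimensional ℝ E]

theorem exists_covAlong_normalField_eq_smul (h : IsNullMap Ω B V φ L) (hΓ : IsChristoffel Ω B Γ)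
    {z : F} (hz : z ∈ V) (u : F) :
    ∃ c : ℝ, covAlong Γ φ (normalField φ L) z u = c • normalField φ L z :=
  exists_eq_smul_of_forall_apply_eq_zero (h.injective z hz) h.finrank_add_one
    (hΓ.metric_symm _ (h.mem z hz)) (hΓ.nondeg _ (h.mem z hz)) (h.field_ne_zero z hz) (h.null z hz)
    (h.metric_covAlong_normalField hΓ hz u)

theorem covAlong_normalField_eq_of_dual (h : IsNullMap Ω B V φ L) (hΓ : IsChristoffel Ω B Γ)
    {z : F} (hz : z ∈ V) {ψ : E →L[ℝ] ℝ} (hψ : ψ (normalField φ L z) ≠ 0) (u : F) :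
    covAlong Γ φ (normalField φ L) z u =
      ((ψ (normalField φ L z))⁻¹ • ψ.comp (covAlong Γ φ (normalField φ L) z)) u •
        normalField φ L z := by
  obtain ⟨c, hc⟩ := h.exists_covAlong_normalField_eq_smul hΓ hz u
  have hcoeff : c = (ψ (normalField φ L z))⁻¹ * ψ (c • normalField φ L z) := by
    rw [map_smul, smul_eq_mul]
    field_simp
  rw [smul_apply, ContinuousLinearMap.comp_apply, hc, smul_eq_mul, ← hcoeff]

theorem covAlong_normalField (h : IsNullMap Ω B V φ L) (hΓ : IsChristoffel Ω B Γ) {z : F}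
    (hz : z ∈ V) (u : F) :
    covAlong Γ φ (normalField φ L) z u = rotationAlong Γ φ L z u • normalField φ L z := by
  obtain ⟨ψ, hψ⟩ := SeparatingDual.exists_ne_zero (R := ℝ) (h.normalField_ne_zero hz)
  exact Classical.epsilon_spec (p := fun ρ : F →L[ℝ] ℝ ↦
    ∀ u, covAlong Γ φ (normalField φ L) z u = ρ u • normalField φ L z)
    ⟨_, h.covAlong_normalField_eq_of_dual hΓ hz hψ⟩ u

theorem rotationAlong_apply_eq (h : IsNullMap Ω B V φ L) (hΓ : IsChristoffel Ω B Γ) {z : F}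
    (hz : z ∈ V) {u : F} {c : ℝ}
    (hc : covAlong Γ φ (normalField φ L) z u = c • normalField φ L z) :
    rotationAlong Γ φ L z u = c :=
  smul_left_injective ℝ (h.normalField_ne_zero hz) ((h.covAlong_normalField hΓ hz u).symm.trans hc)

theorem contDiffAt_rotationAlong (h : IsNullMap Ω B V φ L) (hΓ : IsChristoffel Ω B Γ) {z : F}
    (hz : z ∈ V) : ContDiffAt ℝ ∞ (rotationAlong Γ φ L) z := by
  obtain ⟨ψ, hψ⟩ := SeparatingDual.exists_ne_zero (R := ℝ) (h.normalField_ne_zero hz)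
  have hnormal := h.contDiffAt_normalField hz
  have hψn : ContDiffAt ℝ ∞ (fun q ↦ ψ (normalField φ L q)) z :=
    ψ.contDiff.contDiffAt.comp z hnormal
  have hcov := contDiffAt_covAlong (hΓ.contDiffAt _ (h.mem z hz)) (h.contDiffAt z hz) hnormal
  refine ((hψn.inv hψ).smul (contDiffAt_const (c := ψ) |>.clm_comp hcov)).congr_of_eventuallyEq ?_
  filter_upwards [h.isOpen.mem_nhds hz, hψn.continuousAt.eventually_ne hψ] with q hq hψq
  exact ContinuousLinearMap.ext fun u ↦
    h.rotationAlong_apply_eq hΓ hq (h.covAlong_normalField_eq_of_dual hΓ hq hψq u)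

theorem differentiableAt_rotationAlong (h : IsNullMap Ω B V φ L) (hΓ : IsChristoffel Ω B Γ) {z : F}
    (hz : z ∈ V) : DifferentiableAt ℝ (rotationAlong Γ φ L) z :=
  (h.contDiffAt_rotationAlong hΓ hz).differentiableAt (by simp)

theorem exists_fderiv_apply_eq_covAlong (h : IsNullMap Ω B V φ L) (hΓ : IsChristoffel Ω B Γ)
    {z : F} (hz : z ∈ V) {y : F → F} (hy : DifferentiableAt ℝ y z) (u : F) :
    ∃ w, fderiv ℝ φ z w = covAlong Γ φ (fun q ↦ fderiv ℝ φ q (y q)) z u := by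
  refine exists_apply_eq_of_apply_eq_zero (h.injective z hz) h.finrank_add_one
    (hΓ.metric_symm _ (h.mem z hz)) (hΓ.nondeg _ (h.mem z hz)) (h.field_ne_zero z hz)
    (h.null z hz) ?_
  have htangent := h.metric_covAlong_normalField_add hΓ hz hy u
  rwa [h.metric_covAlong_normalField hΓ hz, zero_add, hΓ.metric_symm _ (h.mem z hz)] at htangent

theorem fderiv_apply_fderiv_field (h : IsNullMap Ω B V φ L) (hΓ : IsChristoffel Ω B Γ) {z : F}
    (hz : z ∈ V) (w : F) :
    fderiv ℝ φ z (fderiv ℝ L z w) = rotationAlong Γ φ L z w • normalField φ L z -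
      covAlong Γ φ (fun y ↦ fderiv ℝ φ y w) z (L z) := by
  rw [← h.covAlong_normalField hΓ hz, h.covAlong_normalField_swap hΓ hz, add_sub_cancel_left]

theorem fderiv_apply_lieBracket (h : IsNullMap Ω B V φ L) (hΓ : IsChristoffel Ω B Γ) {z : F}
    (hz : z ∈ V) {δ : F → F} (hδ : DifferentiableAt ℝ δ z) :
    fderiv ℝ φ z (fderiv ℝ δ z (L z) - fderiv ℝ L z (δ z)) =
      covAlong Γ φ (fun y ↦ fderiv ℝ φ y (δ y)) z (L z) -
        rotationAlong Γ φ L z (δ z) • normalField φ L z := by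
  rw [map_sub, h.fderiv_apply_fderiv_field hΓ hz,
    covAlong_clm_apply (differentiableAt_fderiv (h.contDiffAt z hz)) hδ]
  abel

theorem covAlong_fderiv_apply_fderiv_field (h : IsNullMap Ω B V φ L) (hΓ : IsChristoffel Ω B Γ)
    {z : F} (hz : z ∈ V) (u w : F) :
    covAlong Γ φ (fun y ↦ fderiv ℝ φ y (fderiv ℝ L y w)) z u =
      (fderiv ℝ (rotationAlong Γ φ L) z u w + rotationAlong Γ φ L z u * rotationAlong Γ φ L z w) •
          normalField φ L z -
        (covAlong Γ φ (fun q ↦ covAlong Γ φ (fun y ↦ fderiv ℝ φ y w) q (L z)) z u +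
          covAlong Γ φ (fun y ↦ fderiv ℝ φ y w) z (fderiv ℝ L z u)) := by
  have hnear : (fun y ↦ fderiv ℝ φ y (fderiv ℝ L y w)) =ᶠ[𝓝 z] fun y ↦
      rotationAlong Γ φ L y w • normalField φ L y -
        covAlong Γ φ (fun q ↦ fderiv ℝ φ q w) y (L y) := by
    filter_upwards [h.isOpen.mem_nhds hz] with y hy using h.fderiv_apply_fderiv_field hΓ hy w
  have hL : DifferentiableAt ℝ L z := (h.contDiffAt_field z hz).differentiableAt (by simp)
  have hcov : DifferentiableAt ℝ (covAlong Γ φ fun y ↦ fderiv ℝ φ y w) z :=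
    (contDiffAt_covAlong (hΓ.contDiffAt _ (h.mem z hz)) (h.contDiffAt z hz)
      (h.contDiffAt_fderiv_const hz w)).differentiableAt (by simp)
  have hω := h.differentiableAt_rotationAlong hΓ hz
  have hωw : DifferentiableAt ℝ (fun y ↦ rotationAlong Γ φ L y w) z :=
    hω.clm_apply (differentiableAt_const w)
  have hωw' : fderiv ℝ (fun y ↦ rotationAlong Γ φ L y w) z u =
      fderiv ℝ (rotationAlong Γ φ L) z u w := by
    simp [fderiv_clm_apply hω (differentiableAt_const w)]
  have hn := h.differentiableAt_normalField hz
  rw [covAlong_congr hnear, covAlong_sub (hωw.fun_smul hn) (hcov.clm_apply hL), sub_apply,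
    covAlong_smul hωw hn, covAlong_clm_apply hcov hL, h.covAlong_normalField hΓ hz, hωw']
  module

variable [FiniteDimensional ℝ F]

theorem contDiffAt_of_fderiv_eq_covAlong (h : IsNullMap Ω B V φ L) (hΓ : IsChristoffel Ω B Γ)
    {u w : F} {δ : F → F}
    (hδ : ∀ z ∈ V, fderiv ℝ φ z (δ z) = covAlong Γ φ (fun y ↦ fderiv ℝ φ y w) z u) {z : F}
    (hz : z ∈ V) : ContDiffAt ℝ ∞ δ z := by
  have hcov := (contDiffAt_covAlong (hΓ.contDiffAt _ (h.mem z hz)) (h.contDiffAt z hz)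
    (h.contDiffAt_fderiv_const hz w)).clm_apply (contDiffAt_const (c := u))
  refine contDiffAt_of_clm_apply_eq ((h.contDiffAt z hz).fderiv_right (m := ∞) (by simp)) hcov
    (h.injective z hz) ?_
  filter_upwards [h.isOpen.mem_nhds hz] with q hq using hδ q hq

theorem exists_inducedDeriv (h : IsNullMap Ω B V φ L) (hΓ : IsChristoffel Ω B Γ) (u w : F) :
    ∃ δ : F → F, ∀ z ∈ V, ContDiffAt ℝ ∞ δ z ∧
      fderiv ℝ φ z (δ z) = covAlong Γ φ (fun y ↦ fderiv ℝ φ y w) z u := by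
  have hex (q : F) : ∃ δ, q ∈ V →
      fderiv ℝ φ q δ = covAlong Γ φ (fun y ↦ fderiv ℝ φ y w) q u := by
    by_cases hq : q ∈ V
    · obtain ⟨δ, hδ⟩ := h.exists_fderiv_apply_eq_covAlong hΓ hq (differentiableAt_const w) u
      exact ⟨δ, fun _ ↦ hδ⟩
    · exact ⟨0, fun hq' ↦ absurd hq' hq⟩
  choose δ hδ using hex
  exact ⟨δ, fun z hz ↦ ⟨h.contDiffAt_of_fderiv_eq_covAlong hΓ hδ hz, hδ z hz⟩⟩

theorem curvature_normalField (h : IsNullMap Ω B V φ L) (hΓ : IsChristoffel Ω B Γ)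
    (hconn : PreservesConnection Γ V φ L) {z : F} (hz : z ∈ V) {u w d : F}
    (hd : fderiv ℝ φ z d = covAlong Γ φ (fun y ↦ fderiv ℝ φ y w) z u) :
    curvature Γ (φ z) (normalField φ L z) (fderiv ℝ φ z u) (fderiv ℝ φ z w) =
      -((fderiv ℝ (rotationAlong Γ φ L) z u w - rotationAlong Γ φ L z d +
        rotationAlong Γ φ L z u * rotationAlong Γ φ L z w) • normalField φ L z) := by
  obtain ⟨δ, hδ⟩ := h.exists_inducedDeriv hΓ u w
  have hdδ : d = δ z := h.injective z hz (hd.trans (hδ z hz).2.symm)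
  have hnear : (fun y ↦ fderiv ℝ φ y (δ y)) =ᶠ[𝓝 z] fun q ↦
      covAlong Γ φ (fun y ↦ fderiv ℝ φ y w) q u := by
    filter_upwards [h.isOpen.mem_nhds hz] with q hq using (hδ q hq).2
  have hlie := hconn u w δ (fun q hq ↦ (hδ q hq).2) z hz
  rw [h.fderiv_apply_lieBracket hΓ hz ((hδ z hz).1.differentiableAt (by simp)),
    covAlong_congr hnear, h.covAlong_fderiv_apply_fderiv_field hΓ hz, ← hdδ] at hlie
  rw [normalField, ← covAlong_covAlong_sub (hΓ.contDiffAt _ (h.mem z hz)) (h.contDiffAt z hz)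
    (h.contDiffAt_fderiv_const hz w), ← sub_eq_zero, ← hlie, normalField]
  module

end IsNullMap

end NullMap

/-! ### The Gauss equation on a spacelike section -/

section Trace

variable {K V H : Type*} [Field K] [AddCommGroup V] [Module K V] [FiniteDimensional K V]
  [AddCommGroup H] [Module K H] [FiniteDimensional K H]

theorem trace_eq_of_decomposition (A : V →ₗ[K] V) (J : H →ₗ[K] V) (R : V →ₗ[K] H) (n k : V)
    (α β : V →ₗ[K] K) (hdecomp : ∀ x, J (R x) + α x • n + β x • k = x) :
    LinearMap.trace K V A = LinearMap.trace K H (R ∘ₗ A ∘ₗ J) + α (A n) + β (A k) := by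
  have hA : A = (A ∘ₗ J) ∘ₗ R + α.smulRight (A n) + β.smulRight (A k) := by
    ext x
    conv_lhs => rw [← hdecomp x]
    simp
  conv_lhs => rw [hA]
  rw [map_add, map_add, LinearMap.trace_comp_comm', LinearMap.trace_smulRight,
    LinearMap.trace_smulRight]

theorem trace_of_flag (A : V →ₗ[K] V) (A' : H →ₗ[K] H) (J : H →ₗ[K] V) (n k : V) (α β : K)
    (hdim : Module.finrank K H + 2 = Module.finrank K V)
    (hind : ∀ (v : H) (c d : K), J v + c • n + d • k = 0 → v = 0 ∧ c = 0 ∧ d = 0)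
    (hJ : ∀ v, ∃ μ : K, A (J v) = J (A' v) + μ • n) (hn : A n = α • n)
    (hk : ∃ (v : H) (c : K), A k = J v + c • n + β • k) :
    LinearMap.trace K V A = LinearMap.trace K H A' + α + β := by
  let Φ₀ : (H × K) × K →ₗ[K] V :=
    (J.coprod (LinearMap.toSpanSingleton K V n)).coprod (LinearMap.toSpanSingleton K V k)
  have hΦ₀ (v : H) (c d : K) : Φ₀ ((v, c), d) = J v + c • n + d • k := by simp [Φ₀]
  have hinj : Function.Injective Φ₀ := by
    rw [injective_iff_map_eq_zero]
    rintro ⟨⟨v, c⟩, d⟩ h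
    obtain ⟨rfl, rfl, rfl⟩ := hind v c d ((hΦ₀ v c d).symm.trans h)
    rfl
  let Φ := LinearEquiv.ofInjectiveOfFinrankEq Φ₀ hinj (by simp [← hdim])
  have hsymm (v : H) (c d : K) : Φ.symm (J v + c • n + d • k) = ((v, c), d) :=
    (LinearEquiv.symm_apply_eq Φ).2 (hΦ₀ v c d).symm
  let pr : V →ₗ[K] H × K := LinearMap.fst K (H × K) K ∘ₗ Φ.symm
  have hcomponents (x : V) :
      J (pr x).1 + (pr x).2 • n + (Φ.symm x).2 • k = x :=
    (hΦ₀ _ _ _).symm.trans (Φ.apply_symm_apply x)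
  rw [trace_eq_of_decomposition A J (LinearMap.fst K H K ∘ₗ pr) n k (LinearMap.snd K H K ∘ₗ pr)
    (LinearMap.snd K (H × K) K ∘ₗ Φ.symm) hcomponents]
  congr 1
  · congr 1
    · congr 1
      ext v
      obtain ⟨μ, hμ⟩ := hJ v
      have hcoord := hsymm (A' v) μ 0
      rw [zero_smul, add_zero, ← hμ] at hcoord
      simp [pr, hcoord]
    · have hcoord := hsymm 0 α 0
      rw [map_zero, zero_add, zero_smul, add_zero, ← hn] at hcoord
      simp [pr, hcoord]
  · obtain ⟨v, c, hvc⟩ := hk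
    have hcoord := hsymm v c β
    rw [← hvc] at hcoord
    simp [hcoord]

end Trace

section Gauss

variable {E : Type*} [NormedAddCommGroup E] [NormedSpace ℝ E]
  {H : Type*} [NormedAddCommGroup H] [NormedSpace ℝ H]
  {Γ : E → E →L[ℝ] E →L[ℝ] E} {B : E → E →L[ℝ] E →L[ℝ] ℝ} {Ω : Set E}
  {Γ' : H → H →L[ℝ] H →L[ℝ] H} {B' : H → H →L[ℝ] H →L[ℝ] ℝ} {W : Set H}

/-- The curvature endomorphism `z ↦ R(z, v) w`, whose trace is the Ricci tensor. -/
def curvatureEnd (Γ : E → E →L[ℝ] E →L[ℝ] E) (x v w : E) : E →ₗ[ℝ] E where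
  toFun z := curvature Γ x z v w
  map_add' a b := by
    simp only [curvature, map_add, add_apply]
    abel
  map_smul' c a := by
    simp only [curvature, map_smul, smul_apply, RingHom.id_apply, smul_sub, smul_add]

theorem curvatureEnd_apply (x v w z : E) : curvatureEnd Γ x v w z = curvature Γ x z v w :=
  rfl

/-- The second fundamental form `(∇dχ)(a, b)` of the map `χ`, for the connections `Γ` on the target
and `Γ'` on the source. -/
def secondForm (Γ : E → E →L[ℝ] E →L[ℝ] E) (Γ' : H → H →L[ℝ] H →L[ℝ] H) (χ : H → E)
    (h a b : H) : E :=
  covAlong Γ χ (fun r ↦ fderiv ℝ χ r b) h a - fderiv ℝ χ h (Γ' h a b)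

theorem covAlong_fderiv_eq_add_secondForm (χ : H → E) (h a b : H) :
    covAlong Γ χ (fun r ↦ fderiv ℝ χ r b) h a =
      fderiv ℝ χ h (Γ' h a b) + secondForm Γ Γ' χ h a b :=
  (add_sub_cancel _ _).symm

theorem contDiffAt_secondForm {χ : H → E} {h : H} (hΓ : ContDiffAt ℝ ∞ Γ (χ h))
    (hΓ' : ContDiffAt ℝ ∞ Γ' h) (hχ : ContDiffAt ℝ ∞ χ h) (a b : H) :
    ContDiffAt ℝ ∞ (fun r ↦ secondForm Γ Γ' χ r a b) h :=
  ((contDiffAt_covAlong hΓ hχ (contDiffAt_fderiv_apply hχ contDiffAt_const)).clm_apply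
    contDiffAt_const).sub (contDiffAt_fderiv_apply hχ
      ((hΓ'.clm_apply contDiffAt_const).clm_apply contDiffAt_const))

theorem eq_zero_of_symm_of_skew {V : Type*} {D : V → V → V → ℝ}
    (symm : ∀ a b c, D a b c = D b a c) (skew : ∀ a b c, D a b c = -D a c b) (a b c : V) :
    D a b c = 0 := by
  linarith [skew a b c, symm a c b, skew c a b, symm c b a, skew b c a, symm b a c]

theorem IsChristoffel.metric_secondForm_fderiv (hΓ : IsChristoffel Ω B Γ)
    (hΓ' : IsChristoffel W B' Γ') {χ : H → E} {h : H} (hχ : ContDiffAt ℝ ∞ χ h) (hh : h ∈ W)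
    (hmem : χ h ∈ Ω)
    (hiso : ∀ r ∈ W, ∀ a b, B' r a b = B (χ r) (fderiv ℝ χ r a) (fderiv ℝ χ r b)) (a b c : H) :
    B (χ h) (secondForm Γ Γ' χ h a b) (fderiv ℝ χ h c) = 0 := by
  refine eq_zero_of_symm_of_skew
    (D := fun a b c ↦ B (χ h) (secondForm Γ Γ' χ h a b) (fderiv ℝ χ h c))
    (fun a b c ↦ ?_) (fun a b c ↦ ?_) a b c
  · simp only [secondForm, covAlong_fderiv_comm (hΓ.symm _ hmem) hχ a b, hΓ'.symm h hh a b]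
  · have hderiv (b : H) : DifferentiableAt ℝ (fun r ↦ fderiv ℝ χ r b) h :=
      (contDiffAt_fderiv_apply hχ contDiffAt_const).differentiableAt (by simp)
    have hnear : (fun r ↦ B (χ r) (fderiv ℝ χ r b) (fderiv ℝ χ r c)) =ᶠ[𝓝 h]
        fun r ↦ B' r b c := by
      filter_upwards [hΓ'.isOpen.mem_nhds hh] with r hr using (hiso r hr b c).symm
    have hcompat := hΓ.fderiv_metric_apply hmem (hχ.differentiableAt (by simp)) (hderiv b)
      (hderiv c) a
    have hcompat' := hΓ'.compat h hh a b c
    rw [hnear.fderiv_eq, fderiv_clm_apply₂ ((hΓ'.contDiffAt_metric h hh).differentiableAt (by simp))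
      (differentiableAt_const b) (differentiableAt_const c)] at hcompat
    simp only [fderiv_fun_const, Pi.zero_apply, zero_apply, map_zero, add_zero] at hcompat
    rw [hcompat, hiso h hh, hiso h hh] at hcompat'
    simp only [secondForm, map_sub, sub_apply]
    rw [hΓ.metric_symm _ hmem _ (fderiv ℝ χ h b), hΓ.metric_symm _ hmem _ (fderiv ℝ χ h b)]
    linarith

theorem covAlong_fderiv_comp {F : Type*} [NormedAddCommGroup F] [NormedSpace ℝ F] {φ : F → E}
    {k : H → F} {h : H} (hφ : ContDiffAt ℝ ∞ φ (k h)) (hk : ContDiffAt ℝ ∞ k h) (a b : H) :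
    covAlong Γ (φ ∘ k) (fun r ↦ fderiv ℝ (φ ∘ k) r b) h a =
      covAlong Γ φ (fun q ↦ fderiv ℝ φ q (fderiv ℝ k h b)) (k h) (fderiv ℝ k h a) +
        fderiv ℝ φ (k h) (fderiv ℝ (fderiv ℝ k) h a b) := by
  have hchain : (fun r ↦ fderiv ℝ (φ ∘ k) r b) =ᶠ[𝓝 h]
      fun r ↦ fderiv ℝ φ (k r) (fderiv ℝ k r b) := by
    filter_upwards [hk.continuousAt.eventually (eventually_differentiableAt hφ),
      eventually_differentiableAt hk] with r hφr hkr using fderiv_fun_comp_apply hφr hkr b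
  have hkd : DifferentiableAt ℝ k h := hk.differentiableAt (by simp)
  have hk' : DifferentiableAt ℝ (fderiv ℝ k) h := differentiableAt_fderiv hk
  have hφ' : DifferentiableAt ℝ (fderiv ℝ φ) (k h) := differentiableAt_fderiv hφ
  have hsecond : fderiv ℝ (fun r ↦ fderiv ℝ k r b) h a = fderiv ℝ (fderiv ℝ k) h a b := by
    simp [fderiv_clm_apply hk' (differentiableAt_const b)]
  rw [covAlong_congr hchain, covAlong_clm_apply (T := fun r ↦ fderiv ℝ φ (k r)) (hφ'.comp h hkd)
    (hk'.clm_apply (differentiableAt_const b)), hsecond]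
  congr 1
  exact covAlong_comp (Y := fun q ↦ fderiv ℝ φ q (fderiv ℝ k h b))
    (hφ.differentiableAt (by simp)) (hφ'.clm_apply (differentiableAt_const _)) hkd

end Gauss

section SpacelikeMap

variable {E : Type*} [NormedAddCommGroup E] [NormedSpace ℝ E]
  {F : Type*} [NormedAddCommGroup F] [NormedSpace ℝ F]
  {H : Type*} [NormedAddCommGroup H] [NormedSpace ℝ H]

/-- A spacelike codimension-one immersion `k` into the domain of the null map `φ`. -/
structure IsSpacelikeMap (B : E → E →L[ℝ] E →L[ℝ] ℝ) (V : Set F) (φ : F → E)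
    (B' : H → H →L[ℝ] H →L[ℝ] ℝ) (W : Set H) (k : H → F) : Prop where
  contDiffAt : ∀ h ∈ W, ContDiffAt ℝ ∞ k h
  mem : ∀ h ∈ W, k h ∈ V
  finrank_add_one : Module.finrank ℝ H + 1 = Module.finrank ℝ F
  metric_eq : ∀ h ∈ W, ∀ a b, B' h a b =
    B (φ (k h)) (fderiv ℝ φ (k h) (fderiv ℝ k h a)) (fderiv ℝ φ (k h) (fderiv ℝ k h b))
  metric_pos : ∀ h ∈ W, ∀ a, a ≠ 0 → 0 < B' h a a

/-- The pullback `ω̃` of the rotation form to the section `k`. -/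
def sectionRotation (Γ : E → E →L[ℝ] E →L[ℝ] E) (φ : F → E) (L : F → F) (k : H → F) (h : H) :
    H →L[ℝ] ℝ :=
  (rotationAlong Γ φ L (k h)).comp (fderiv ℝ k h)

/-- The bilinear form `D̃ω̃ + ω̃ ⊗ ω̃` on the section `k` with connection `Γ'`. -/
def rotationHessian (Γ : E → E →L[ℝ] E →L[ℝ] E) (Γ' : H → H →L[ℝ] H →L[ℝ] H) (φ : F → E)
    (L : F → F) (k : H → F) (h a b : H) : ℝ :=
  fderiv ℝ (sectionRotation Γ φ L k) h a b - sectionRotation Γ φ L k h (Γ' h a b) +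
    sectionRotation Γ φ L k h a * sectionRotation Γ φ L k h b

namespace IsSpacelikeMap

variable {Γ : E → E →L[ℝ] E →L[ℝ] E} {B : E → E →L[ℝ] E →L[ℝ] ℝ} {Ω : Set E}
  {Γ' : H → H →L[ℝ] H →L[ℝ] H} {B' : H → H →L[ℝ] H →L[ℝ] ℝ} {W : Set H}
  {V : Set F} {φ : F → E} {L : F → F} {k : H → F}

theorem differentiableAt (hS : IsSpacelikeMap B V φ B' W k) {h : H} (hh : h ∈ W) :
    DifferentiableAt ℝ k h :=
  (hS.contDiffAt h hh).differentiableAt (by simp)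

theorem fderiv_comp_apply (hS : IsSpacelikeMap B V φ B' W k) (hN : IsNullMap Ω B V φ L) {h : H}
    (hh : h ∈ W) (a : H) : fderiv ℝ (φ ∘ k) h a = fderiv ℝ φ (k h) (fderiv ℝ k h a) :=
  fderiv_fun_comp_apply ((hN.contDiffAt _ (hS.mem h hh)).differentiableAt (by simp))
    (hS.differentiableAt hh) a

theorem metric_eq_comp (hS : IsSpacelikeMap B V φ B' W k) (hN : IsNullMap Ω B V φ L) {h : H}
    (hh : h ∈ W) (a b : H) :
    B' h a b = B ((φ ∘ k) h) (fderiv ℝ (φ ∘ k) h a) (fderiv ℝ (φ ∘ k) h b) := by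
  rw [hS.metric_eq h hh, hS.fderiv_comp_apply hN hh, hS.fderiv_comp_apply hN hh,
    Function.comp_apply]

theorem metric_fderiv_normalField (hS : IsSpacelikeMap B V φ B' W k) (hN : IsNullMap Ω B V φ L)
    (hΓ : IsChristoffel Ω B Γ) {h : H} (hh : h ∈ W) (a : H) :
    B (φ (k h)) (fderiv ℝ (φ ∘ k) h a) (normalField φ L (k h)) = 0 := by
  rw [hΓ.metric_symm _ (hN.mem _ (hS.mem h hh)), hS.fderiv_comp_apply hN hh]
  exact hN.null _ (hS.mem h hh) _

theorem contDiffAt_comp (hS : IsSpacelikeMap B V φ B' W k) (hN : IsNullMap Ω B V φ L) {h : H}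
    (hh : h ∈ W) : ContDiffAt ℝ ∞ (φ ∘ k) h :=
  (hN.contDiffAt _ (hS.mem h hh)).comp h (hS.contDiffAt h hh)

theorem contDiffAt_normalField_comp (hS : IsSpacelikeMap B V φ B' W k)
    (hN : IsNullMap Ω B V φ L) {h : H} (hh : h ∈ W) :
    ContDiffAt ℝ ∞ (fun r ↦ normalField φ L (k r)) h :=
  (hN.contDiffAt_normalField (hS.mem h hh)).comp h (hS.contDiffAt h hh)

theorem eq_zero_of_fderiv_add_smul_eq_zero (hS : IsSpacelikeMap B V φ B' W k)
    (hN : IsNullMap Ω B V φ L) {h : H} (hh : h ∈ W) {v : H} {c : ℝ}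
    (hsum : fderiv ℝ k h v + c • L (k h) = 0) : v = 0 ∧ c = 0 := by
  have hz := hS.mem h hh
  have hv : v = 0 := by
    by_contra hv
    have hpos := hS.metric_pos h hh v hv
    rw [hS.metric_eq h hh, eq_neg_of_add_eq_zero_left hsum, map_neg, map_smul] at hpos
    simp [hN.null _ hz (L (k h))] at hpos
  rw [hv, map_zero, zero_add, smul_eq_zero] at hsum
  exact ⟨hv, hsum.resolve_right (hN.field_ne_zero _ hz)⟩

theorem eq_zero_of_add_normalField_add_transversal (hS : IsSpacelikeMap B V φ B' W k)
    (hN : IsNullMap Ω B V φ L) {h : H} (hh : h ∈ W) {m : E}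
    (hm : B (φ (k h)) (normalField φ L (k h)) m = 1) {v : H} {c d : ℝ}
    (hsum : fderiv ℝ (φ ∘ k) h v + c • normalField φ L (k h) + d • m = 0) :
    v = 0 ∧ c = 0 ∧ d = 0 := by
  have hz := hS.mem h hh
  have htangent : fderiv ℝ (φ ∘ k) h v + c • normalField φ L (k h) =
      fderiv ℝ φ (k h) (fderiv ℝ k h v + c • L (k h)) := by
    rw [hS.fderiv_comp_apply hN hh, map_add, map_smul, normalField]
  rw [htangent] at hsum
  have hd : d = 0 := by
    have hpair := congrArg (B (φ (k h)) (normalField φ L (k h))) hsum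
    rwa [map_add, map_smul, hm, normalField, hN.null _ hz, map_zero, zero_add, smul_eq_mul,
      mul_one] at hpair
  rw [hd, zero_smul, add_zero] at hsum
  obtain ⟨hv, hc⟩ := hS.eq_zero_of_fderiv_add_smul_eq_zero hN hh
    (hN.injective _ hz (hsum.trans (map_zero _).symm))
  exact ⟨hv, hc, hd⟩

theorem exists_fderiv_add_smul_eq [FiniteDimensional ℝ F] [FiniteDimensional ℝ H]
    (hS : IsSpacelikeMap B V φ B' W k) (hN : IsNullMap Ω B V φ L) {h : H} (hh : h ∈ W) (w : F) :
    ∃ (v : H) (c : ℝ), fderiv ℝ k h v + c • L (k h) = w := by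
  let T : H × ℝ →ₗ[ℝ] F :=
    (fderiv ℝ k h).toLinearMap.coprod (LinearMap.toSpanSingleton ℝ F (L (k h)))
  have hT (v : H) (c : ℝ) : T (v, c) = fderiv ℝ k h v + c • L (k h) := by simp [T]
  have hinj : Function.Injective T := by
    rw [injective_iff_map_eq_zero]
    rintro ⟨v, c⟩ hvc
    obtain ⟨rfl, rfl⟩ := hS.eq_zero_of_fderiv_add_smul_eq_zero hN hh ((hT v c).symm.trans hvc)
    rfl
  have hsurj := (LinearMap.injective_iff_surjective_of_finrank_eq_finrank
    (by simp [← hS.finrank_add_one])).1 hinj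
  obtain ⟨⟨v, c⟩, hvc⟩ := hsurj w
  exact ⟨v, c, (hT v c).symm.trans hvc⟩

variable [FiniteDimensional ℝ E]

theorem covAlong_normalField_comp (hS : IsSpacelikeMap B V φ B' W k) (hN : IsNullMap Ω B V φ L)
    (hΓ : IsChristoffel Ω B Γ) {h : H} (hh : h ∈ W) (a : H) :
    covAlong Γ (φ ∘ k) (fun r ↦ normalField φ L (k r)) h a =
      sectionRotation Γ φ L k h a • normalField φ L (k h) :=
  (covAlong_comp ((hN.contDiffAt _ (hS.mem h hh)).differentiableAt (by simp))
    (hN.differentiableAt_normalField (hS.mem h hh)) (hS.differentiableAt hh)).trans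
    (hN.covAlong_normalField hΓ (hS.mem h hh) _)

theorem metric_secondForm_normalField (hS : IsSpacelikeMap B V φ B' W k)
    (hN : IsNullMap Ω B V φ L) (hΓ : IsChristoffel Ω B Γ) (hΓ' : IsChristoffel W B' Γ') {h : H}
    (hh : h ∈ W) (a b : H) :
    B (φ (k h)) (secondForm Γ Γ' (φ ∘ k) h a b) (normalField φ L (k h)) = 0 := by
  have hχ := hS.contDiffAt_comp hN hh
  have hnear : (fun r ↦ B ((φ ∘ k) r) (fderiv ℝ (φ ∘ k) r b) (normalField φ L (k r))) =ᶠ[𝓝 h]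
      fun _ ↦ 0 := by
    filter_upwards [hΓ'.isOpen.mem_nhds hh] with r hr
      using hS.metric_fderiv_normalField hN hΓ hr b
  have hcompat := hΓ.fderiv_metric_apply (φ := φ ∘ k) (hN.mem _ (hS.mem h hh))
    (hχ.differentiableAt (by simp))
    ((contDiffAt_fderiv_apply hχ (contDiffAt_const (c := b))).differentiableAt (by simp))
    ((hS.contDiffAt_normalField_comp hN hh).differentiableAt (by simp)) a
  rw [hnear.fderiv_eq, hS.covAlong_normalField_comp hN hΓ hh, map_smul, Function.comp_apply,
    hS.metric_fderiv_normalField hN hΓ hh, smul_zero, add_zero] at hcompat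
  rw [secondForm, map_sub, sub_apply, hS.metric_fderiv_normalField hN hΓ hh, ← hcompat]
  simp

theorem differentiableAt_sectionRotation (hS : IsSpacelikeMap B V φ B' W k)
    (hN : IsNullMap Ω B V φ L) (hΓ : IsChristoffel Ω B Γ) {h : H} (hh : h ∈ W) :
    DifferentiableAt ℝ (sectionRotation Γ φ L k) h :=
  ((hN.differentiableAt_rotationAlong hΓ (hS.mem h hh)).comp h (hS.differentiableAt hh)).clm_comp
    (differentiableAt_fderiv (hS.contDiffAt h hh))

theorem fderiv_sectionRotation (hS : IsSpacelikeMap B V φ B' W k) (hN : IsNullMap Ω B V φ L)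
    (hΓ : IsChristoffel Ω B Γ) {h : H} (hh : h ∈ W) (a b : H) :
    fderiv ℝ (sectionRotation Γ φ L k) h a b =
      fderiv ℝ (rotationAlong Γ φ L) (k h) (fderiv ℝ k h a) (fderiv ℝ k h b) +
        rotationAlong Γ φ L (k h) (fderiv ℝ (fderiv ℝ k) h a b) := by
  have hρ := hN.differentiableAt_rotationAlong hΓ (hS.mem h hh)
  have hk := hS.differentiableAt hh
  have hρk : DifferentiableAt ℝ (fun r ↦ rotationAlong Γ φ L (k r)) h := hρ.comp h hk
  change fderiv ℝ (fun r ↦ (rotationAlong Γ φ L (k r)).comp (fderiv ℝ k r)) h a b = _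
  rw [fderiv_clm_comp hρk (differentiableAt_fderiv (hS.contDiffAt h hh))]
  simp [fderiv_fun_comp_apply hρ hk, add_comm]

variable [FiniteDimensional ℝ F] [FiniteDimensional ℝ H]

theorem exists_secondForm_eq_smul (hS : IsSpacelikeMap B V φ B' W k) (hN : IsNullMap Ω B V φ L)
    (hΓ : IsChristoffel Ω B Γ) (hΓ' : IsChristoffel W B' Γ') {h : H} (hh : h ∈ W) (a b : H) :
    ∃ η : ℝ, secondForm Γ Γ' (φ ∘ k) h a b = η • normalField φ L (k h) := by
  have hz := hS.mem h hh
  have hΩ := hN.mem _ hz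
  refine exists_eq_smul_of_forall_apply_eq_zero (hN.injective _ hz) hN.finrank_add_one
    (hΓ.metric_symm _ hΩ) (hΓ.nondeg _ hΩ) (hN.field_ne_zero _ hz) (hN.null _ hz) fun w ↦ ?_
  obtain ⟨v, c, rfl⟩ := hS.exists_fderiv_add_smul_eq hN hh w
  have htangent := hΓ.metric_secondForm_fderiv hΓ' (hS.contDiffAt_comp hN hh) hh hΩ
    (fun r hr ↦ hS.metric_eq_comp hN hr) a b v
  have hnormal := hS.metric_secondForm_normalField hN hΓ hΓ' hh a b
  rw [Function.comp_apply, hS.fderiv_comp_apply hN hh] at htangent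
  rw [map_add, map_add, map_smul, map_smul, htangent, ← normalField, hnormal, smul_zero, add_zero]

theorem exists_contDiffAt_secondForm_eq_smul (hS : IsSpacelikeMap B V φ B' W k)
    (hN : IsNullMap Ω B V φ L) (hΓ : IsChristoffel Ω B Γ) (hΓ' : IsChristoffel W B' Γ')
    (a b : H) : ∃ η : H → ℝ, ∀ h ∈ W, ContDiffAt ℝ ∞ η h ∧
      secondForm Γ Γ' (φ ∘ k) h a b = η h • normalField φ L (k h) := by
  have hex (h : H) :
      ∃ η : ℝ, h ∈ W → secondForm Γ Γ' (φ ∘ k) h a b = η • normalField φ L (k h) := by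
    by_cases hh : h ∈ W
    · obtain ⟨η, hη⟩ := hS.exists_secondForm_eq_smul hN hΓ hΓ' hh a b
      exact ⟨η, fun _ ↦ hη⟩
    · exact ⟨0, fun hh' ↦ absurd hh' hh⟩
  choose η hη using hex
  refine ⟨η, fun h hh ↦ ⟨?_, hη h hh⟩⟩
  have hz := hS.mem h hh
  refine contDiffAt_of_clm_apply_eq
    (A := fun r ↦ ContinuousLinearMap.toSpanSingleton ℝ (normalField φ L (k r)))
    ((ContinuousLinearMap.toSpanSingletonCLE (𝕜 := ℝ) (E := E)).contDiff.contDiffAt.comp h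
      (hS.contDiffAt_normalField_comp hN hh))
    (contDiffAt_secondForm (χ := φ ∘ k) (hΓ.contDiffAt _ (hN.mem _ hz)) (hΓ'.contDiffAt h hh)
      (hS.contDiffAt_comp hN hh) a b)
    (smul_left_injective ℝ (hN.normalField_ne_zero hz)) ?_
  filter_upwards [hΓ'.isOpen.mem_nhds hh] with r hr using (hη r hr).symm

theorem exists_covAlong_covAlong_fderiv (hS : IsSpacelikeMap B V φ B' W k)
    (hN : IsNullMap Ω B V φ L) (hΓ : IsChristoffel Ω B Γ) (hΓ' : IsChristoffel W B' Γ') {h : H}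
    (hh : h ∈ W) (c a b : H) : ∃ μ : ℝ,
    covAlong Γ (φ ∘ k) (fun q ↦ covAlong Γ (φ ∘ k) (fun r ↦ fderiv ℝ (φ ∘ k) r b) q a) h c =
      fderiv ℝ (φ ∘ k) h (fderiv ℝ Γ' h c a b + Γ' h c (Γ' h a b)) +
        μ • normalField φ L (k h) := by
  obtain ⟨η, hη⟩ := hS.exists_contDiffAt_secondForm_eq_smul hN hΓ hΓ' a b
  obtain ⟨η', hη'⟩ := hS.exists_secondForm_eq_smul hN hΓ hΓ' hh c (Γ' h a b)
  have hnear : (fun q ↦ covAlong Γ (φ ∘ k) (fun r ↦ fderiv ℝ (φ ∘ k) r b) q a) =ᶠ[𝓝 h] fun q ↦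
      fderiv ℝ (φ ∘ k) q (Γ' q a b) + η q • normalField φ L (k q) := by
    filter_upwards [hΓ'.isOpen.mem_nhds hh] with q hq
    rw [covAlong_fderiv_eq_add_secondForm (Γ' := Γ'), (hη q hq).2]
  have hχ' : DifferentiableAt ℝ (fderiv ℝ (φ ∘ k)) h :=
    differentiableAt_fderiv (hS.contDiffAt_comp hN hh)
  have hΓ'd : DifferentiableAt ℝ Γ' h := (hΓ'.contDiffAt h hh).differentiableAt (by simp)
  have hΓ'ab : DifferentiableAt ℝ (fun q ↦ Γ' q a b) h :=
    (hΓ'd.clm_apply (differentiableAt_const a)).clm_apply (differentiableAt_const b)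
  have hηd : DifferentiableAt ℝ η h := (hη h hh).1.differentiableAt (by simp)
  have hn : DifferentiableAt ℝ (fun q ↦ normalField φ L (k q)) h :=
    (hS.contDiffAt_normalField_comp hN hh).differentiableAt (by simp)
  have hderiv : fderiv ℝ (fun q ↦ Γ' q a b) h c = fderiv ℝ Γ' h c a b := by
    simp [fderiv_clm_apply₂ hΓ'd (differentiableAt_const a) (differentiableAt_const b)]
  refine ⟨η' + η h * sectionRotation Γ φ L k h c + fderiv ℝ η h c, ?_⟩
  rw [covAlong_congr hnear, covAlong_add (hχ'.clm_apply hΓ'ab) (hηd.fun_smul hn), add_apply,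
    covAlong_clm_apply hχ' hΓ'ab, covAlong_fderiv_eq_add_secondForm (Γ' := Γ'), hη',
    covAlong_smul hηd hn, hS.covAlong_normalField_comp hN hΓ hh, hderiv, map_add]
  module

theorem exists_curvature_eq_add_smul (hS : IsSpacelikeMap B V φ B' W k)
    (hN : IsNullMap Ω B V φ L) (hΓ : IsChristoffel Ω B Γ) (hΓ' : IsChristoffel W B' Γ') {h : H}
    (hh : h ∈ W) (c a b : H) : ∃ μ : ℝ,
    curvature Γ (φ (k h)) (fderiv ℝ (φ ∘ k) h c) (fderiv ℝ (φ ∘ k) h a) (fderiv ℝ (φ ∘ k) h b) =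
      fderiv ℝ (φ ∘ k) h (curvature Γ' h c a b) + μ • normalField φ L (k h) := by
  have hχ := hS.contDiffAt_comp hN hh
  obtain ⟨μ₁, hμ₁⟩ := hS.exists_covAlong_covAlong_fderiv hN hΓ hΓ' hh c a b
  obtain ⟨μ₂, hμ₂⟩ := hS.exists_covAlong_covAlong_fderiv hN hΓ hΓ' hh a c b
  refine ⟨μ₁ - μ₂, ?_⟩
  rw [← Function.comp_apply (f := φ), ← covAlong_covAlong_sub (φ := φ ∘ k)
    (hΓ.contDiffAt _ (hN.mem _ (hS.mem h hh))) hχ (contDiffAt_fderiv_apply hχ contDiffAt_const),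
    hμ₁, hμ₂, curvature]
  simp only [map_add, map_sub]
  module

theorem curvature_normalField (hS : IsSpacelikeMap B V φ B' W k) (hN : IsNullMap Ω B V φ L)
    (hΓ : IsChristoffel Ω B Γ) (hΓ' : IsChristoffel W B' Γ')
    (hconn : PreservesConnection Γ V φ L) {h : H} (hh : h ∈ W)
    (hext : covAlong Γ φ (normalField φ L) (k h) (L (k h)) = 0) (a b : H) :
    curvature Γ (φ (k h)) (normalField φ L (k h)) (fderiv ℝ (φ ∘ k) h a)
        (fderiv ℝ (φ ∘ k) h b) =
      -(rotationHessian Γ Γ' φ L k h a b • normalField φ L (k h)) := by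
  have hz := hS.mem h hh
  obtain ⟨η, hη⟩ := hS.exists_secondForm_eq_smul hN hΓ hΓ' hh a b
  have hinduced : fderiv ℝ φ (k h) (fderiv ℝ k h (Γ' h a b) + η • L (k h) -
      fderiv ℝ (fderiv ℝ k) h a b) =
      covAlong Γ φ (fun y ↦ fderiv ℝ φ y (fderiv ℝ k h b)) (k h) (fderiv ℝ k h a) := by
    rw [map_sub, map_add, map_smul, ← normalField, ← hη, ← hS.fderiv_comp_apply hN hh,
      ← covAlong_fderiv_eq_add_secondForm,
      covAlong_fderiv_comp (hN.contDiffAt _ hz) (hS.contDiffAt h hh), add_sub_cancel_right]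
  have hκ : rotationAlong Γ φ L (k h) (L (k h)) = 0 :=
    hN.rotationAlong_apply_eq hΓ hz (by rw [hext, zero_smul])
  rw [hS.fderiv_comp_apply hN hh, hS.fderiv_comp_apply hN hh,
    hN.curvature_normalField hΓ hconn hz hinduced, rotationHessian,
    hS.fderiv_sectionRotation hN hΓ hh]
  simp only [sectionRotation, ContinuousLinearMap.comp_apply, map_sub, map_add, map_smul, hκ]
  congr 2
  ring

theorem exists_curvature_transversal (hS : IsSpacelikeMap B V φ B' W k)
    (hN : IsNullMap Ω B V φ L) (hΓ : IsChristoffel Ω B Γ) (hΓ' : IsChristoffel W B' Γ')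
    (hconn : PreservesConnection Γ V φ L) {h : H} (hh : h ∈ W)
    (hext : covAlong Γ φ (normalField φ L) (k h) (L (k h)) = 0) {m : E}
    (hm : B (φ (k h)) m (normalField φ L (k h)) = 1) (a b : H) : ∃ (v : H) (c : ℝ),
      curvature Γ (φ (k h)) m (fderiv ℝ (φ ∘ k) h a) (fderiv ℝ (φ ∘ k) h b) =
        fderiv ℝ (φ ∘ k) h v + c • normalField φ L (k h) +
          -rotationHessian Γ Γ' φ L k h b a • m := by
  have hz := hS.mem h hh
  have hΩ := hN.mem _ hz
  have hcomponent : B (φ (k h)) (curvature Γ (φ (k h)) m (fderiv ℝ (φ ∘ k) h a)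
      (fderiv ℝ (φ ∘ k) h b)) (normalField φ L (k h)) = -rotationHessian Γ Γ' φ L k h b a := by
    rw [hΓ.curvature_pair_symm hΩ, curvature_antisymm, map_neg, neg_apply, hΓ.curvature_skew hΩ,
      neg_neg, hS.curvature_normalField hN hΓ hΓ' hconn hh hext, map_neg, map_smul, hm,
      smul_eq_mul, mul_one]
  obtain ⟨w, hw⟩ := exists_apply_eq_of_apply_eq_zero (hN.injective _ hz) hN.finrank_add_one
    (hΓ.metric_symm _ hΩ) (hΓ.nondeg _ hΩ) (hN.field_ne_zero _ hz) (hN.null _ hz)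
    (x := curvature Γ (φ (k h)) m (fderiv ℝ (φ ∘ k) h a) (fderiv ℝ (φ ∘ k) h b) -
      -rotationHessian Γ Γ' φ L k h b a • m) (by
        rw [map_sub, map_smul, sub_apply, smul_apply, ← normalField, hcomponent, hm, smul_eq_mul,
          mul_one, sub_self])
  obtain ⟨v, c, rfl⟩ := hS.exists_fderiv_add_smul_eq hN hh w
  refine ⟨v, c, ?_⟩
  rw [← sub_eq_iff_eq_add, ← hw, hS.fderiv_comp_apply hN hh, map_add, map_smul, normalField]

theorem trace_curvatureEnd (hS : IsSpacelikeMap B V φ B' W k) (hN : IsNullMap Ω B V φ L)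
    (hΓ : IsChristoffel Ω B Γ) (hΓ' : IsChristoffel W B' Γ')
    (hconn : PreservesConnection Γ V φ L) {h : H} (hh : h ∈ W)
    (hext : covAlong Γ φ (normalField φ L) (k h) (L (k h)) = 0) (a b : H) :
    LinearMap.trace ℝ E
        (curvatureEnd Γ (φ (k h)) (fderiv ℝ (φ ∘ k) h a) (fderiv ℝ (φ ∘ k) h b)) =
      LinearMap.trace ℝ H (curvatureEnd Γ' h a b) - rotationHessian Γ Γ' φ L k h a b -
        rotationHessian Γ Γ' φ L k h b a := by
  have hz := hS.mem h hh
  have hΩ := hN.mem _ hz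
  obtain ⟨m₀, hm₀⟩ : ∃ m, B (φ (k h)) (normalField φ L (k h)) m ≠ 0 := by
    by_contra! hzero
    exact hN.normalField_ne_zero hz (hΓ.nondeg _ hΩ _ hzero)
  obtain ⟨m, hm⟩ : ∃ m, B (φ (k h)) (normalField φ L (k h)) m = 1 :=
    ⟨_ • m₀, by rw [map_smul, smul_eq_mul, inv_mul_cancel₀ hm₀]⟩
  rw [trace_of_flag _ (curvatureEnd Γ' h a b) (fderiv ℝ (φ ∘ k) h).toLinearMap
    (normalField φ L (k h)) m (-rotationHessian Γ Γ' φ L k h a b)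
    (-rotationHessian Γ Γ' φ L k h b a)
    (by have := hS.finrank_add_one; have := hN.finrank_add_one; lia)
    (fun v c d ↦ hS.eq_zero_of_add_normalField_add_transversal hN hh hm)
    (fun v ↦ hS.exists_curvature_eq_add_smul hN hΓ hΓ' hh v a b)
    (by rw [curvatureEnd_apply, hS.curvature_normalField hN hΓ hΓ' hconn hh hext, neg_smul])
    (hS.exists_curvature_transversal hN hΓ hΓ' hconn hh hext
      ((hΓ.metric_symm _ hΩ _ _).trans hm) a b)]
  ring

end IsSpacelikeMap

end SpacelikeMap

/-! ### Chart coordinates -/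

section Coordinates

variable {E : Type*} [NormedAddCommGroup E] [NormedSpace ℝ E]
  {M : Type*} [TopologicalSpace M] [ChartedSpace E M]

variable (E) in
/-- The image in the model space of the preferred chart at `x₀`. -/
def chartDom (x₀ : M) : Set E := (extChartAt 𝓘(ℝ, E) x₀).target

variable (E) in
/-- The parametrization inverse to the preferred chart at `x₀`. -/
def param (x₀ : M) (z : E) : M := (extChartAt 𝓘(ℝ, E) x₀).symm z

variable (E) in
/-- The coordinates, in the preferred chart at `x₀`, of the tangent vectors at `y`. -/
def dchart (x₀ y : M) : TangentSpace 𝓘(ℝ, E) y →L[ℝ] E :=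
  mfderiv 𝓘(ℝ, E) 𝓘(ℝ, E) (extChartAt 𝓘(ℝ, E) x₀) y

/-- The coordinate expression of a vector field in the preferred chart at `x₀`. -/
def coordField (x₀ : M) (X : Π x : M, TangentSpace 𝓘(ℝ, E) x) : E → E :=
  VectorField.mpullback 𝓘(ℝ, E) 𝓘(ℝ, E) (param E x₀) X

/-- The vector field with a given coordinate expression in the preferred chart at `x₀`. -/
def liftField (x₀ : M) (Y : E → E) : Π x : M, TangentSpace 𝓘(ℝ, E) x :=
  VectorField.mpullback 𝓘(ℝ, E) 𝓘(ℝ, E) (extChartAt 𝓘(ℝ, E) x₀) Y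

theorem isOpen_chartDom (x₀ : M) : IsOpen (chartDom E x₀) := isOpen_extChartAt_target x₀

theorem chart_mem {x₀ y : M} (hy : y ∈ (extChartAt 𝓘(ℝ, E) x₀).source) :
    extChartAt 𝓘(ℝ, E) x₀ y ∈ chartDom E x₀ :=
  (extChartAt 𝓘(ℝ, E) x₀).map_source hy

theorem param_mem_source {x₀ : M} {z : E} (hz : z ∈ chartDom E x₀) :
    param E x₀ z ∈ (extChartAt 𝓘(ℝ, E) x₀).source :=
  (extChartAt 𝓘(ℝ, E) x₀).map_target hz

theorem chart_param {x₀ : M} {z : E} (hz : z ∈ chartDom E x₀) :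
    extChartAt 𝓘(ℝ, E) x₀ (param E x₀ z) = z :=
  (extChartAt 𝓘(ℝ, E) x₀).right_inv hz

theorem param_chart {x₀ y : M} (hy : y ∈ (extChartAt 𝓘(ℝ, E) x₀).source) :
    param E x₀ (extChartAt 𝓘(ℝ, E) x₀ y) = y :=
  (extChartAt 𝓘(ℝ, E) x₀).left_inv hy

theorem source_mem_nhds {x₀ y : M} (hy : y ∈ (extChartAt 𝓘(ℝ, E) x₀).source) :
    (extChartAt 𝓘(ℝ, E) x₀).source ∈ 𝓝 y :=
  (isOpen_extChartAt_source x₀).mem_nhds hy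

theorem chartDom_mem_nhds {x₀ y : M} (hy : y ∈ (extChartAt 𝓘(ℝ, E) x₀).source) :
    chartDom E x₀ ∈ 𝓝 (extChartAt 𝓘(ℝ, E) x₀ y) :=
  (isOpen_chartDom x₀).mem_nhds (chart_mem hy)

theorem two_le_infty : (2 : WithTop ℕ∞) ≤ ∞ :=
  WithTop.coe_le_coe.2 (le_top : (2 : ℕ∞) ≤ ⊤)

theorem mdifferentiableAt_vectorField_iff {Y : E → E} {z : E} :
    MDifferentiableAt 𝓘(ℝ, E) (𝓘(ℝ, E).prod 𝓘(ℝ, E))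
      (fun y ↦ (⟨y, Y y⟩ : TangentBundle 𝓘(ℝ, E) E)) z ↔ DifferentiableAt ℝ Y z := by
  refine ⟨fun hY ↦ ?_, fun hY ↦ ?_⟩
  · exact ((contMDiff_snd_tangentBundle_modelSpace E 𝓘(ℝ, E)
      (n := 1)).contMDiffAt.mdifferentiableAt one_ne_zero |>.comp z hY).differentiableAt
  · refine (mdifferentiableAt_totalSpace _ _).2 ⟨mdifferentiableAt_id, ?_⟩
    convert! hY.mdifferentiableAt with y
    simp

theorem mlieBracket_eq_lieBracket (X Y : Π z : E, TangentSpace 𝓘(ℝ, E) z) :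
    VectorField.mlieBracket 𝓘(ℝ, E) X Y = VectorField.lieBracket ℝ X Y := by
  rw [← VectorField.mlieBracketWithin_univ, VectorField.mlieBracketWithin_eq_lieBracketWithin]
  exact VectorField.lieBracketWithin_univ (V := X) (W := Y)

variable [IsManifold 𝓘(ℝ, E) ∞ M]

theorem contMDiffAt_param {x₀ : M} {z : E} (hz : z ∈ chartDom E x₀) :
    ContMDiffAt 𝓘(ℝ, E) 𝓘(ℝ, E) ∞ (param E x₀) z :=
  (contMDiffOn_extChartAt_symm x₀).contMDiffAt ((isOpen_chartDom x₀).mem_nhds hz)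

theorem contMDiffAt_chart {x₀ y : M} (hy : y ∈ (extChartAt 𝓘(ℝ, E) x₀).source) :
    ContMDiffAt 𝓘(ℝ, E) 𝓘(ℝ, E) ∞ (extChartAt 𝓘(ℝ, E) x₀) y :=
  contMDiffAt_extChartAt' (by simpa using hy)

theorem mdifferentiableAt_chart {x₀ y : M} (hy : y ∈ (extChartAt 𝓘(ℝ, E) x₀).source) :
    MDifferentiableAt 𝓘(ℝ, E) 𝓘(ℝ, E) (extChartAt 𝓘(ℝ, E) x₀) y :=
  (contMDiffAt_chart hy).mdifferentiableAt (by simp)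

theorem isInvertible_mfderiv_param {x₀ : M} {z : E} (hz : z ∈ chartDom E x₀) :
    (mfderiv 𝓘(ℝ, E) 𝓘(ℝ, E) (param E x₀) z).IsInvertible := by
  have hinv := isInvertible_mfderivWithin_extChartAt_symm (I := 𝓘(ℝ, E)) (x := x₀) hz
  rw [ModelWithCorners.range_eq_univ, mfderivWithin_univ] at hinv
  exact hinv

theorem dchart_mfderiv_param {x₀ : M} {z : E} (hz : z ∈ chartDom E x₀) (v : E) :
    dchart E x₀ (param E x₀ z) (mfderiv 𝓘(ℝ, E) 𝓘(ℝ, E) (param E x₀) z v) = v := by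
  have hinv := mfderiv_extChartAt_comp_mfderivWithin_extChartAt_symm (I := 𝓘(ℝ, E)) (x := x₀) hz
  rw [ModelWithCorners.range_eq_univ, mfderivWithin_univ] at hinv
  exact DFunLike.congr_fun hinv v

theorem isInvertible_dchart {x₀ y : M} (hy : y ∈ (extChartAt 𝓘(ℝ, E) x₀).source) :
    (dchart E x₀ y).IsInvertible :=
  isInvertible_mfderiv_extChartAt hy

theorem dchart_injective {x₀ y : M} (hy : y ∈ (extChartAt 𝓘(ℝ, E) x₀).source) :
    Function.Injective (dchart E x₀ y) :=
  (isInvertible_dchart hy).injective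

theorem dchart_surjective {x₀ y : M} (hy : y ∈ (extChartAt 𝓘(ℝ, E) x₀).source) :
    Function.Surjective (dchart E x₀ y) :=
  (isInvertible_dchart hy).surjective

theorem mfderiv_param_dchart {x₀ : M} {z : E} (hz : z ∈ chartDom E x₀)
    (v : TangentSpace 𝓘(ℝ, E) (param E x₀ z)) :
    mfderiv 𝓘(ℝ, E) 𝓘(ℝ, E) (param E x₀) z (dchart E x₀ (param E x₀ z) v) = v :=
  dchart_injective (param_mem_source hz) (dchart_mfderiv_param hz _)

theorem dchart_self (x₀ : M) (v : TangentSpace 𝓘(ℝ, E) x₀) : dchart E x₀ x₀ v = v :=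
  DFunLike.congr_fun (mfderiv_extChartAt_self (I := 𝓘(ℝ, E)) (x := x₀)) v

theorem coordField_chart {x₀ y : M} (hy : y ∈ (extChartAt 𝓘(ℝ, E) x₀).source)
    (X : Π x : M, TangentSpace 𝓘(ℝ, E) x) :
    coordField x₀ X (extChartAt 𝓘(ℝ, E) x₀ y) = dchart E x₀ y (X y) := by
  obtain ⟨z, hz, rfl⟩ : ∃ z ∈ chartDom E x₀, param E x₀ z = y := ⟨_, chart_mem hy, param_chart hy⟩
  rw [chart_param hz]
  exact ((isInvertible_mfderiv_param hz).inverse_apply_eq).2 (mfderiv_param_dchart hz _).symm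

theorem dchart_liftField {x₀ y : M} (hy : y ∈ (extChartAt 𝓘(ℝ, E) x₀).source) (Y : E → E) :
    dchart E x₀ y (liftField x₀ Y y) = Y (extChartAt 𝓘(ℝ, E) x₀ y) :=
  (((isInvertible_dchart hy).inverse_apply_eq).1 rfl).symm

theorem coordField_eventuallyEq {x₀ y : M} (hy : y ∈ (extChartAt 𝓘(ℝ, E) x₀).source)
    {X : Π x : M, TangentSpace 𝓘(ℝ, E) x} {Y : E → E} (hXY : X =ᶠ[𝓝 y] liftField x₀ Y) :
    coordField x₀ X =ᶠ[𝓝 (extChartAt 𝓘(ℝ, E) x₀ y)] Y := by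
  rw [← param_chart hy] at hXY
  filter_upwards [chartDom_mem_nhds hy,
    (contMDiffAt_param (chart_mem hy)).continuousAt.eventually hXY] with z hz hXz
  have hs := param_mem_source hz
  rw [← chart_param hz, coordField_chart hs, hXz, dchart_liftField hs]

theorem coordField_liftField {x₀ y : M} (hy : y ∈ (extChartAt 𝓘(ℝ, E) x₀).source) (Y : E → E) :
    coordField x₀ (liftField x₀ Y) =ᶠ[𝓝 (extChartAt 𝓘(ℝ, E) x₀ y)] Y :=
  coordField_eventuallyEq hy .rfl

theorem fderiv_coordField_liftField_const {x₀ y : M}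
    (hy : y ∈ (extChartAt 𝓘(ℝ, E) x₀).source) (a : E) :
    fderiv ℝ (coordField x₀ (liftField (M := M) x₀ fun _ ↦ a)) (extChartAt 𝓘(ℝ, E) x₀ y) = 0 := by
  rw [(coordField_liftField hy _).fderiv_eq, fderiv_const_apply]

theorem mvfderiv_eq_fderiv_dchart {x₀ y : M} (hy : y ∈ (extChartAt 𝓘(ℝ, E) x₀).source)
    {f : M → ℝ} {F : E → ℝ} (hF : DifferentiableAt ℝ F (extChartAt 𝓘(ℝ, E) x₀ y))
    (hf : f =ᶠ[𝓝 y] fun y' ↦ F (extChartAt 𝓘(ℝ, E) x₀ y')) (v : TangentSpace 𝓘(ℝ, E) y) :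
    mvfderiv 𝓘(ℝ, E) f y v = fderiv ℝ F (extChartAt 𝓘(ℝ, E) x₀ y) (dchart E x₀ y v) := by
  have hFf : mvfderiv 𝓘(ℝ, E) f y = mvfderiv 𝓘(ℝ, E) (F ∘ extChartAt 𝓘(ℝ, E) x₀) y :=
    hf.mfderiv_eq
  rw [hFf, mvfderiv_comp_apply y hF.mdifferentiableAt (mdifferentiableAt_chart hy)]
  exact DFunLike.congr_fun mfderiv_eq_fderiv (dchart E x₀ y v)

section Smoothness

variable [CompleteSpace E]

theorem differentiableAt_coordField {x₀ y : M} (hy : y ∈ (extChartAt 𝓘(ℝ, E) x₀).source)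
    {X : Π x : M, TangentSpace 𝓘(ℝ, E) x} (hX : MDiffAt (T% X) y) :
    DifferentiableAt ℝ (coordField x₀ X) (extChartAt 𝓘(ℝ, E) x₀ y) := by
  have hz := chart_mem hy
  rw [← param_chart hy] at hX
  exact mdifferentiableAt_vectorField_iff.1 (hX.mpullback_vectorField
    (contMDiffAt_param hz) (isInvertible_mfderiv_param hz) two_le_infty)

theorem contDiffAt_coordField {x₀ y : M} (hy : y ∈ (extChartAt 𝓘(ℝ, E) x₀).source)
    {X : Π x : M, TangentSpace 𝓘(ℝ, E) x} (hX : CMDiffAt ∞ (T% X) y) :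
    ContDiffAt ℝ ∞ (coordField x₀ X) (extChartAt 𝓘(ℝ, E) x₀ y) := by
  have hz := chart_mem hy
  rw [← param_chart hy] at hX
  exact contMDiffAt_vectorSpace_iff_contDiffAt.1 (hX.mpullback_vectorField_preimage
    (contMDiffAt_param hz) (isInvertible_mfderiv_param hz) (by simp))

theorem contMDiffAt_liftField {x₀ y : M} (hy : y ∈ (extChartAt 𝓘(ℝ, E) x₀).source) {Y : E → E}
    (hY : ContDiffAt ℝ ∞ Y (extChartAt 𝓘(ℝ, E) x₀ y)) : CMDiffAt ∞ (T% (liftField x₀ Y)) y :=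
  (contMDiffAt_vectorSpace_iff_contDiffAt (V := Y).2 hY).mpullback_vectorField_preimage
    (contMDiffAt_chart hy) (isInvertible_mfderiv_extChartAt hy) (by simp)

theorem mdifferentiableAt_liftField {x₀ y : M} (hy : y ∈ (extChartAt 𝓘(ℝ, E) x₀).source)
    {Y : E → E} (hY : DifferentiableAt ℝ Y (extChartAt 𝓘(ℝ, E) x₀ y)) :
    MDiffAt (T% (liftField x₀ Y)) y :=
  (mdifferentiableAt_vectorField_iff.2 hY).mpullback_vectorField (contMDiffAt_chart hy)
    (isInvertible_mfderiv_extChartAt hy) two_le_infty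

theorem mdifferentiableAt_liftField_const {x₀ y : M} (hy : y ∈ (extChartAt 𝓘(ℝ, E) x₀).source)
    (a : E) : MDiffAt (T% (liftField x₀ fun _ ↦ a)) y :=
  mdifferentiableAt_liftField hy (differentiableAt_const a)

theorem dchart_mlieBracket {x₀ y : M} (hy : y ∈ (extChartAt 𝓘(ℝ, E) x₀).source)
    {X Y : Π x : M, TangentSpace 𝓘(ℝ, E) x} (hX : MDiffAt (T% X) y) (hY : MDiffAt (T% Y) y) :
    dchart E x₀ y (VectorField.mlieBracket 𝓘(ℝ, E) X Y y) =
      fderiv ℝ (coordField x₀ Y) (extChartAt 𝓘(ℝ, E) x₀ y) (dchart E x₀ y (X y)) -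
        fderiv ℝ (coordField x₀ X) (extChartAt 𝓘(ℝ, E) x₀ y) (dchart E x₀ y (Y y)) := by
  have hmanifold : IsManifold 𝓘(ℝ, E) (minSmoothness ℝ 2) M :=
    IsManifold.of_le (n := ∞) (by simpa using two_le_infty)
  rw [← coordField_chart hy X, ← coordField_chart hy Y, ← coordField_chart hy]
  rw [← param_chart hy] at hX hY
  exact (VectorField.mpullback_mlieBracket hX hY (contMDiffAt_param (chart_mem hy))
    (by simpa using two_le_infty)).trans
      (congrFun (mlieBracket_eq_lieBracket _ _) _)

end Smoothness

section Metric

variable (g : PseudoMetric E M)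

/-- The coordinate expression of a metric in the preferred chart at `x₀`. -/
def coordMetric (x₀ : M) (z : E) : E →L[ℝ] E →L[ℝ] ℝ :=
  pullbackForm g (param E x₀) z

theorem coordMetric_chart {x₀ y : M} (hy : y ∈ (extChartAt 𝓘(ℝ, E) x₀).source)
    (a b : TangentSpace 𝓘(ℝ, E) y) :
    coordMetric g x₀ (extChartAt 𝓘(ℝ, E) x₀ y) (dchart E x₀ y a) (dchart E x₀ y b) =
      g.val y a b := by
  obtain ⟨z, hz, rfl⟩ : ∃ z ∈ chartDom E x₀, param E x₀ z = y := ⟨_, chart_mem hy, param_chart hy⟩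
  rw [chart_param hz]
  exact congrArg₂ (fun a b ↦ g.val (param E x₀ z) a b) (mfderiv_param_dchart hz a)
    (mfderiv_param_dchart hz b)

theorem pair_eq_coordMetric {x₀ y : M} (hy : y ∈ (extChartAt 𝓘(ℝ, E) x₀).source)
    (X Y : Π x : M, TangentSpace 𝓘(ℝ, E) x) :
    g.pair X Y y = coordMetric g x₀ (extChartAt 𝓘(ℝ, E) x₀ y)
      (coordField x₀ X (extChartAt 𝓘(ℝ, E) x₀ y)) (coordField x₀ Y (extChartAt 𝓘(ℝ, E) x₀ y)) := by
  rw [coordField_chart hy, coordField_chart hy, coordMetric_chart g hy, PseudoMetric.pair]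

theorem contMDiffAt_pair {X Y : Π x : M, TangentSpace 𝓘(ℝ, E) x} {x : M}
    (hX : CMDiffAt ∞ (T% X) x) (hY : CMDiffAt ∞ (T% Y) x) :
    ContMDiffAt 𝓘(ℝ, E) 𝓘(ℝ) ∞ (g.pair X Y) x := by
  have hpair : ContMDiffAt 𝓘(ℝ, E) (𝓘(ℝ, E).prod 𝓘(ℝ)) ∞
      (fun m ↦ Bundle.TotalSpace.mk' ℝ (E := Bundle.Trivial M ℝ) m (g.pair X Y m)) x :=
    ContMDiffAt.clm_bundle_apply₂ (F₁ := E) (F₂ := E) (g.contMDiff x) hX hY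
  simp only [Bundle.contMDiffAt_totalSpace] at hpair
  exact hpair.2

variable [FiniteDimensional ℝ E]

theorem contDiffAt_coordMetric {x₀ : M} {z : E} (hz : z ∈ chartDom E x₀) :
    ContDiffAt ℝ ∞ (coordMetric g x₀) z := by
  have hcomplete : CompleteSpace E := FiniteDimensional.complete ℝ E
  rw [← contMDiffAt_iff_contDiffAt]
  refine contMDiffAt_of_apply fun a b ↦ ?_
  have hs := param_mem_source hz
  refine ((contMDiffAt_pair g (contMDiffAt_liftField hs (contDiffAt_const (c := a)))
    (contMDiffAt_liftField hs (contDiffAt_const (c := b)))).comp z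
      (contMDiffAt_param hz)).congr_of_eventuallyEq ?_
  filter_upwards [(isOpen_chartDom x₀).mem_nhds hz] with y hy
  have hys := param_mem_source hy
  rw [Function.comp_apply, PseudoMetric.pair, ← coordMetric_chart g hys, dchart_liftField hys,
    dchart_liftField hys, chart_param hy]

/-- The Christoffel symbols of a metric in the preferred chart at `x₀`. -/
def christoffelAt (x₀ : M) : E → E →L[ℝ] E →L[ℝ] E :=
  christoffel (coordMetric g x₀)

theorem isChristoffel_christoffelAt (x₀ : M) :
    IsChristoffel (chartDom E x₀) (coordMetric g x₀) (christoffelAt g x₀) := by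
  refine isChristoffel_christoffel (isOpen_chartDom x₀) (fun z hz ↦ contDiffAt_coordMetric g hz)
    (fun z _ a b ↦ g.symm _ _ _) fun z hz a ha ↦ ?_
  have hs := param_mem_source hz
  obtain ⟨a, rfl⟩ := dchart_surjective hs a
  refine (congrArg _ (g.nondeg _ a fun w ↦ ?_)).trans (map_zero _)
  rw [← coordMetric_chart g hs, chart_param hz]
  exact ha _

theorem mvfderiv_pair {x₀ y : M} (hy : y ∈ (extChartAt 𝓘(ℝ, E) x₀).source)
    {X Y : Π x : M, TangentSpace 𝓘(ℝ, E) x} (hX : MDiffAt (T% X) y) (hY : MDiffAt (T% Y) y)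
    (u : TangentSpace 𝓘(ℝ, E) y) :
    mvfderiv 𝓘(ℝ, E) (g.pair X Y) y u =
      fderiv ℝ (coordMetric g x₀) (extChartAt 𝓘(ℝ, E) x₀ y) (dchart E x₀ y u)
          (dchart E x₀ y (X y)) (dchart E x₀ y (Y y)) +
        coordMetric g x₀ (extChartAt 𝓘(ℝ, E) x₀ y)
          (fderiv ℝ (coordField x₀ X) (extChartAt 𝓘(ℝ, E) x₀ y) (dchart E x₀ y u))
          (dchart E x₀ y (Y y)) +
        coordMetric g x₀ (extChartAt 𝓘(ℝ, E) x₀ y) (dchart E x₀ y (X y))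
          (fderiv ℝ (coordField x₀ Y) (extChartAt 𝓘(ℝ, E) x₀ y) (dchart E x₀ y u)) := by
  have hcomplete : CompleteSpace E := FiniteDimensional.complete ℝ E
  have hB : DifferentiableAt ℝ (coordMetric g x₀) (extChartAt 𝓘(ℝ, E) x₀ y) :=
    (contDiffAt_coordMetric g (chart_mem hy)).differentiableAt (by simp)
  have hX' := differentiableAt_coordField hy hX
  have hY' := differentiableAt_coordField hy hY
  rw [mvfderiv_eq_fderiv_dchart hy ((hB.clm_apply hX').clm_apply hY')
    (by filter_upwards [source_mem_nhds hy] with y' hy' using pair_eq_coordMetric g hy' X Y),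
    fderiv_clm_apply₂ hB hX' hY', coordField_chart hy, coordField_chart hy]

theorem dchart_leviCivita_liftField_const {x₀ y : M} (hy : y ∈ (extChartAt 𝓘(ℝ, E) x₀).source)
    (a b : E) :
    dchart E x₀ y (g.leviCivita (liftField x₀ fun _ ↦ b) y (liftField x₀ (fun _ ↦ a) y)) =
      christoffelAt g x₀ (extChartAt 𝓘(ℝ, E) x₀ y) a b := by
  have hcomplete : CompleteSpace E := FiniteDimensional.complete ℝ E
  have hΓ := isChristoffel_christoffelAt g x₀
  have hz := chart_mem hy
  let A (a b : E) : E :=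
    dchart E x₀ y (g.leviCivita (liftField x₀ fun _ ↦ b) y (liftField x₀ (fun _ ↦ a) y))
  let B := coordMetric g x₀ (extChartAt 𝓘(ℝ, E) x₀ y)
  let Γ := christoffelAt g x₀ (extChartAt 𝓘(ℝ, E) x₀ y)
  have hlift (a : E) := mdifferentiableAt_liftField_const hy a
  have torsion (a b : E) : A a b = A b a := by
    rw [← sub_eq_zero, ← map_sub, (CovariantDerivative.torsion_eq_zero_iff _).1
      g.leviCivita_torsion (hlift a) (hlift b), dchart_mlieBracket hy (hlift a) (hlift b),
      fderiv_coordField_liftField_const hy, fderiv_coordField_liftField_const hy]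
    simp
  have metric (a b c : E) : B (A a b) c + B b (A a c) = B (Γ a b) c + B b (Γ a c) := by
    rw [← hΓ.compat _ hz]
    have := g.leviCivita_metric (hlift a) (hlift b) (hlift c)
    rw [mvfderiv_pair g hy (hlift b) (hlift c), fderiv_coordField_liftField_const hy,
      fderiv_coordField_liftField_const hy, ← coordMetric_chart g hy, ← coordMetric_chart g hy,
      dchart_liftField hy, dchart_liftField hy, dchart_liftField hy] at this
    simp only [zero_apply, map_zero, add_zero] at this
    exact this.symm
  refine sub_eq_zero.1 (hΓ.nondeg _ hz _ fun c ↦ ?_)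
  refine eq_zero_of_symm_of_skew (D := fun a b c ↦ B (A a b - Γ a b) c) (fun a b c ↦ ?_)
    (fun a b c ↦ ?_) a b c
  · rw [torsion a b, hΓ.symm _ hz a b]
  · rw [hΓ.metric_symm _ hz (A a c - Γ a c) b, map_sub, map_sub, sub_apply]
    linarith [metric a b c]

theorem dchart_leviCivita {x₀ y : M} (hy : y ∈ (extChartAt 𝓘(ℝ, E) x₀).source)
    {Z : Π x : M, TangentSpace 𝓘(ℝ, E) x} (hZ : MDiffAt (T% Z) y) (v : TangentSpace 𝓘(ℝ, E) y) :
    dchart E x₀ y (g.leviCivita Z y v) =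
      fderiv ℝ (coordField x₀ Z) (extChartAt 𝓘(ℝ, E) x₀ y) (dchart E x₀ y v) +
        christoffelAt g x₀ (extChartAt 𝓘(ℝ, E) x₀ y) (dchart E x₀ y v) (dchart E x₀ y (Z y)) := by
  have hΓ := isChristoffel_christoffelAt g x₀
  have hz := chart_mem hy
  refine sub_eq_zero.1 (hΓ.nondeg _ hz _ fun w ↦ ?_)
  have hlift (a : E) := mdifferentiableAt_liftField_const (M := M) hy a
  have hv : liftField x₀ (fun _ ↦ dchart E x₀ y v) y = v :=
    dchart_injective hy (dchart_liftField hy _)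
  have hmetric := g.leviCivita_metric (hlift (dchart E x₀ y v)) hZ (hlift w)
  rw [mvfderiv_pair g hy hZ (hlift w), ← coordMetric_chart g hy, ← coordMetric_chart g hy,
    dchart_leviCivita_liftField_const g hy, fderiv_coordField_liftField_const hy, hv,
    dchart_liftField hy, hΓ.compat _ hz] at hmetric
  simp only [map_sub, map_add, sub_apply, add_apply, zero_apply, map_zero] at hmetric ⊢
  linarith

end Metric

end Coordinates

section Center

variable {E : Type*} [NormedAddCommGroup E] [NormedSpace ℝ E]
  {M : Type*} [TopologicalSpace M] [ChartedSpace E M] [IsManifold 𝓘(ℝ, E) ∞ M]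

theorem extend_eq_liftField {x₀ y : M} (hy : y ∈ (extChartAt 𝓘(ℝ, E) x₀).source)
    (v : TangentSpace 𝓘(ℝ, E) x₀) :
    (FiberBundle.extend E v : Π y : M, TangentSpace 𝓘(ℝ, E) y) y =
      liftField x₀ (fun _ ↦ dchart E x₀ x₀ v) y := by
  have hchart {y : M} (hy : y ∈ (extChartAt 𝓘(ℝ, E) x₀).source) :
      (trivializationAt E (TangentSpace 𝓘(ℝ, E)) x₀).continuousLinearMapAt ℝ y = dchart E x₀ y :=
    TangentBundle.continuousLinearMapAt_trivializationAt (by simpa using hy)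
  have hbase {y : M} (hy : y ∈ (extChartAt 𝓘(ℝ, E) x₀).source) :
      y ∈ (trivializationAt E (TangentSpace 𝓘(ℝ, E)) x₀).baseSet := by simpa using hy
  refine dchart_injective hy (Eq.trans ?_ (dchart_liftField hy _).symm)
  have hv : (trivializationAt E (TangentSpace 𝓘(ℝ, E)) x₀ ⟨x₀, v⟩).2 = dchart E x₀ x₀ v := by
    rw [← hchart (mem_extChartAt_source x₀), Bundle.Trivialization.continuousLinearMapAt_apply,
      Bundle.Trivialization.coe_linearMapAt_of_mem _ (hbase (mem_extChartAt_source x₀))]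
  rw [FiberBundle.extend, hv, ← Bundle.Trivialization.symmL_apply (R := ℝ) _ (hbase hy),
    ← hchart hy, Bundle.Trivialization.continuousLinearMapAt_symmL _ (hbase hy)]

theorem extend_eventuallyEq_liftField (x₀ : M) (v : TangentSpace 𝓘(ℝ, E) x₀) :
    (FiberBundle.extend E v : Π y : M, TangentSpace 𝓘(ℝ, E) y) =ᶠ[𝓝 x₀]
      liftField x₀ fun _ ↦ dchart E x₀ x₀ v := by
  filter_upwards [source_mem_nhds (mem_extChartAt_source (I := 𝓘(ℝ, E)) x₀)] with y hy
    using extend_eq_liftField hy v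

theorem mdifferentiableAt_of_eventuallyEq_liftField [CompleteSpace E] {x₀ y : M}
    (hy : y ∈ (extChartAt 𝓘(ℝ, E) x₀).source) {X : Π x : M, TangentSpace 𝓘(ℝ, E) x} {Y : E → E}
    (hXY : X =ᶠ[𝓝 y] liftField x₀ Y) (hY : DifferentiableAt ℝ Y (extChartAt 𝓘(ℝ, E) x₀ y)) :
    MDiffAt (T% X) y := by
  refine (mdifferentiableAt_liftField hy hY).congr_of_eventuallyEq ?_
  filter_upwards [hXY] with x hx
  rw [hx]

variable [FiniteDimensional ℝ E] (g : PseudoMetric E M)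

theorem dchart_leviCivita_of_eventuallyEq_liftField {x₀ y : M}
    (hy : y ∈ (extChartAt 𝓘(ℝ, E) x₀).source) {X : Π x : M, TangentSpace 𝓘(ℝ, E) x} {Y : E → E}
    (hXY : X =ᶠ[𝓝 y] liftField x₀ Y) (hY : DifferentiableAt ℝ Y (extChartAt 𝓘(ℝ, E) x₀ y))
    (v : TangentSpace 𝓘(ℝ, E) y) :
    dchart E x₀ y (g.leviCivita X y v) =
      fderiv ℝ Y (extChartAt 𝓘(ℝ, E) x₀ y) (dchart E x₀ y v) +
        christoffelAt g x₀ (extChartAt 𝓘(ℝ, E) x₀ y) (dchart E x₀ y v)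
          (Y (extChartAt 𝓘(ℝ, E) x₀ y)) := by
  have hcomplete : CompleteSpace E := FiniteDimensional.complete ℝ E
  rw [dchart_leviCivita g hy (mdifferentiableAt_of_eventuallyEq_liftField hy hXY hY),
    (coordField_eventuallyEq hy hXY).fderiv_eq, hXY.eq_of_nhds, dchart_liftField hy]

theorem leviCivita_extend_eventuallyEq (x₀ : M) (v w : TangentSpace 𝓘(ℝ, E) x₀) :
    (fun y ↦ g.leviCivita (FiberBundle.extend E w) y (FiberBundle.extend E v y)) =ᶠ[𝓝 x₀]
      liftField x₀ fun z ↦ christoffelAt g x₀ z (dchart E x₀ x₀ v) (dchart E x₀ x₀ w) := by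
  filter_upwards [source_mem_nhds (mem_extChartAt_source (I := 𝓘(ℝ, E)) x₀),
    (extend_eventuallyEq_liftField x₀ w).eventually_nhds] with y hy hw
  refine dchart_injective hy ?_
  rw [dchart_leviCivita_of_eventuallyEq_liftField g hy hw (differentiableAt_const _),
    extend_eq_liftField hy, dchart_liftField hy, dchart_liftField hy, fderiv_const_apply]
  simp

theorem dchart_leviCivita_leviCivita_extend (x₀ : M) (u v w : TangentSpace 𝓘(ℝ, E) x₀) :
    dchart E x₀ x₀ (g.leviCivita
        (fun y ↦ g.leviCivita (FiberBundle.extend E w) y (FiberBundle.extend E v y)) x₀ u) =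
      fderiv ℝ (christoffelAt g x₀) (extChartAt 𝓘(ℝ, E) x₀ x₀) (dchart E x₀ x₀ u)
          (dchart E x₀ x₀ v) (dchart E x₀ x₀ w) +
        christoffelAt g x₀ (extChartAt 𝓘(ℝ, E) x₀ x₀) (dchart E x₀ x₀ u)
          (christoffelAt g x₀ (extChartAt 𝓘(ℝ, E) x₀ x₀) (dchart E x₀ x₀ v)
            (dchart E x₀ x₀ w)) := by
  have hs := mem_extChartAt_source (I := 𝓘(ℝ, E)) x₀
  have hΓ : DifferentiableAt ℝ (christoffelAt g x₀) (extChartAt 𝓘(ℝ, E) x₀ x₀) :=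
    ((isChristoffel_christoffelAt g x₀).contDiffAt _ (chart_mem hs)).differentiableAt (by simp)
  have hconst (v : E) := differentiableAt_const (𝕜 := ℝ) (x := extChartAt 𝓘(ℝ, E) x₀ x₀) v
  rw [dchart_leviCivita_of_eventuallyEq_liftField g hs
      (leviCivita_extend_eventuallyEq g x₀ v w) ((hΓ.clm_apply (hconst _)).clm_apply (hconst _)),
    fderiv_clm_apply₂ hΓ (hconst _) (hconst _), fderiv_const_apply, fderiv_const_apply,
    zero_apply, map_zero, map_zero, zero_apply, add_zero, add_zero]

theorem mlieBracket_extend (x₀ : M) (u v : TangentSpace 𝓘(ℝ, E) x₀) :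
    VectorField.mlieBracket 𝓘(ℝ, E) (FiberBundle.extend E u) (FiberBundle.extend E v) x₀ = 0 := by
  have hcomplete : CompleteSpace E := FiniteDimensional.complete ℝ E
  have hs := mem_extChartAt_source (I := 𝓘(ℝ, E)) x₀
  rw [(extend_eventuallyEq_liftField x₀ u).mlieBracket_vectorField_eq
    (extend_eventuallyEq_liftField x₀ v)]
  refine dchart_injective hs ?_
  rw [dchart_mlieBracket hs (mdifferentiableAt_liftField_const hs _)
    (mdifferentiableAt_liftField_const hs _), fderiv_coordField_liftField_const hs,
    fderiv_coordField_liftField_const hs, zero_apply, zero_apply, sub_zero, map_zero]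

theorem dchart_riemann (x₀ : M) (u v w : TangentSpace 𝓘(ℝ, E) x₀) :
    dchart E x₀ x₀ (g.riemann x₀ u v w) =
      curvature (christoffelAt g x₀) (extChartAt 𝓘(ℝ, E) x₀ x₀) (dchart E x₀ x₀ u)
        (dchart E x₀ x₀ v) (dchart E x₀ x₀ w) := by
  rw [PseudoMetric.riemann, mlieBracket_extend, map_zero, sub_zero, map_sub,
    dchart_leviCivita_leviCivita_extend, dchart_leviCivita_leviCivita_extend, curvature]
  abel

theorem ricci_eq_trace_curvatureEnd (x₀ : M) (v w : TangentSpace 𝓘(ℝ, E) x₀) :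
    g.ricci x₀ v w = LinearMap.trace ℝ E (curvatureEnd (christoffelAt g x₀)
      (extChartAt 𝓘(ℝ, E) x₀ x₀) (dchart E x₀ x₀ v) (dchart E x₀ x₀ w)) := by
  rw [LinearMap.trace_eq_matrix_trace ℝ (Module.finBasis ℝ E), Matrix.trace]
  refine Finset.sum_congr rfl fun i _ ↦ ?_
  have hriemann := dchart_riemann g x₀ (Module.finBasis ℝ E i) v w
  rw [dchart_self, dchart_self x₀ (Module.finBasis ℝ E i)] at hriemann
  rw [Matrix.diag, LinearMap.toMatrix_apply]
  exact congrArg (fun v : E ↦ (Module.finBasis ℝ E).coord i v) hriemann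

theorem covDerivOneForm_eq_fderiv_sub {x₀ : M} {α : Π y : M, TangentSpace 𝓘(ℝ, E) y → ℝ}
    {A : E → E →L[ℝ] ℝ} (hA : DifferentiableAt ℝ A (extChartAt 𝓘(ℝ, E) x₀ x₀))
    (hα : ∀ᶠ y in 𝓝 x₀, ∀ v, α y v = A (extChartAt 𝓘(ℝ, E) x₀ y) (dchart E x₀ y v))
    (u w : TangentSpace 𝓘(ℝ, E) x₀) :
    g.covDerivOneForm α x₀ u w =
      fderiv ℝ A (extChartAt 𝓘(ℝ, E) x₀ x₀) (dchart E x₀ x₀ u) (dchart E x₀ x₀ w) -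
        A (extChartAt 𝓘(ℝ, E) x₀ x₀) (christoffelAt g x₀ (extChartAt 𝓘(ℝ, E) x₀ x₀)
          (dchart E x₀ x₀ u) (dchart E x₀ x₀ w)) := by
  have hs := mem_extChartAt_source (I := 𝓘(ℝ, E)) x₀
  have hw := differentiableAt_const (𝕜 := ℝ) (x := extChartAt 𝓘(ℝ, E) x₀ x₀) (dchart E x₀ x₀ w)
  have hαw : (fun y ↦ α y (FiberBundle.extend E w y)) =ᶠ[𝓝 x₀]
      fun y ↦ A (extChartAt 𝓘(ℝ, E) x₀ y) (dchart E x₀ x₀ w) := by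
    filter_upwards [hα, source_mem_nhds hs] with y hαy hy
    rw [hαy, extend_eq_liftField hy, dchart_liftField hy]
  rw [PseudoMetric.covDerivOneForm, hα.self_of_nhds,
    mvfderiv_eq_fderiv_dchart hs (hA.clm_apply hw) hαw, fderiv_clm_apply hA hw,
    dchart_leviCivita_of_eventuallyEq_liftField g hs (extend_eventuallyEq_liftField x₀ w) hw,
    fderiv_const_apply, zero_apply, zero_add]
  simp

end Center

/-! ### Maps in chart coordinates -/

section LocalMap

variable {E : Type*} [NormedAddCommGroup E] [NormedSpace ℝ E]
  {M : Type*} [TopologicalSpace M] [ChartedSpace E M]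
  {F : Type*} [NormedAddCommGroup F] [NormedSpace ℝ F]
  {N : Type*} [TopologicalSpace N] [ChartedSpace F N]
  {f : N → M} {p₀ p : N}

variable (E F) in
/-- The expression of a map in the preferred charts at `p₀` and at its image. -/
def localMap (f : N → M) (p₀ : N) (z : F) : E := extChartAt 𝓘(ℝ, E) (f p₀) (f (param F p₀ z))

variable (E F) in
/-- The points at which a map is expressed in the preferred charts at `p₀` and at its image. -/
def localSource (f : N → M) (p₀ : N) : Set N :=
  (extChartAt 𝓘(ℝ, F) p₀).source ∩ f ⁻¹' (extChartAt 𝓘(ℝ, E) (f p₀)).source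

variable (E F) in
/-- The coordinates of the points at which a map is expressed in the preferred charts at `p₀` and
at its image. -/
def localDom (f : N → M) (p₀ : N) : Set F := extChartAt 𝓘(ℝ, F) p₀ '' localSource E F f p₀

theorem mem_localSource_self (f : N → M) (p₀ : N) : p₀ ∈ localSource E F f p₀ :=
  ⟨mem_extChartAt_source p₀, mem_extChartAt_source (f p₀)⟩

theorem localMap_chart (hp : p ∈ (extChartAt 𝓘(ℝ, F) p₀).source) :
    localMap E F f p₀ (extChartAt 𝓘(ℝ, F) p₀ p) = extChartAt 𝓘(ℝ, E) (f p₀) (f p) := by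
  rw [localMap, param_chart hp]

theorem localMap_mem (hp : p ∈ localSource E F f p₀) :
    localMap E F f p₀ (extChartAt 𝓘(ℝ, F) p₀ p) ∈ chartDom E (f p₀) := by
  rw [localMap_chart hp.1]
  exact chart_mem hp.2

theorem eventually_nhds_chart_iff (hp : p ∈ (extChartAt 𝓘(ℝ, F) p₀).source) {P : F → Prop} :
    (∀ᶠ z in 𝓝 (extChartAt 𝓘(ℝ, F) p₀ p), P z) ↔
      ∀ᶠ p' in 𝓝 p, P (extChartAt 𝓘(ℝ, F) p₀ p') := by
  have hmap := map_extChartAt_nhds' (I := 𝓘(ℝ, F)) hp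
  rw [ModelWithCorners.range_eq_univ, nhdsWithin_univ] at hmap
  rw [← hmap, Filter.eventually_map]

theorem isOpen_localSource (hf : Continuous f) (p₀ : N) : IsOpen (localSource E F f p₀) :=
  (isOpen_extChartAt_source p₀).inter ((isOpen_extChartAt_source (f p₀)).preimage hf)

theorem isOpen_image_chart {U : Set N} (hU : IsOpen U)
    (hUs : U ⊆ (extChartAt 𝓘(ℝ, F) p₀).source) : IsOpen (extChartAt 𝓘(ℝ, F) p₀ '' U) := by
  refine isOpen_iff_mem_nhds.2 ?_
  rintro _ ⟨p, hp, rfl⟩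
  refine (eventually_nhds_chart_iff (hUs hp)).2 ?_
  filter_upwards [hU.mem_nhds hp] with p' hp' using Set.mem_image_of_mem _ hp'

theorem isOpen_localDom (hf : Continuous f) (p₀ : N) : IsOpen (localDom E F f p₀) :=
  isOpen_image_chart (isOpen_localSource hf p₀) Set.inter_subset_left

theorem exists_leftInverse_of_isImmersion
    (hf : Manifold.IsImmersion 𝓘(ℝ, F) 𝓘(ℝ, E) ∞ f) (p : N) :
    ∃ r : M → N, ContMDiffAt 𝓘(ℝ, E) 𝓘(ℝ, F) ∞ r (f p) ∧ ∀ᶠ p' in 𝓝 p, r (f p') = p' := by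
  have h := hf.isImmersionAt p
  let d := h.domChart.extend 𝓘(ℝ, F)
  let c := h.codChart.extend 𝓘(ℝ, E)
  have hsource : d.source = h.domChart.source := h.domChart.extend_source
  -- In the charts `d` and `c` an immersion is `u ↦ (u, 0)`, which the first projection inverts.
  have hproj : ∀ p' ∈ h.domChart.source, (h.equiv.symm (c (f p'))).1 = d p' := by
    intro p' hp'
    rw [← hsource] at hp'
    have hwritten : c (f (d.symm (d p'))) = h.equiv (d p', 0) :=
      h.writtenInCharts (d.map_source hp')
    rw [← d.left_inv hp', hwritten, d.left_inv hp', ContinuousLinearEquiv.symm_apply_apply]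
  have hp : p ∈ d.source := hsource ▸ h.mem_domChart_source
  refine ⟨fun x ↦ d.symm (h.equiv.symm (c x)).1, ?_, ?_⟩
  · have hc : ContMDiffAt 𝓘(ℝ, E) 𝓘(ℝ, E) ∞ c (f p) :=
      h.codChart.contMDiffAt_extend h.codChart_mem_maximalAtlas h.mem_codChart_source
    have hfst : ContMDiffAt 𝓘(ℝ, E) 𝓘(ℝ, F) ∞ (fun v ↦ (h.equiv.symm v).1) (c (f p)) :=
      (contDiff_fst.comp h.equiv.symm.contDiff).contMDiff.contMDiffAt
    have hd : ContMDiffAt 𝓘(ℝ, F) 𝓘(ℝ, F) ∞ d.symm ((h.equiv.symm (c (f p))).1) := by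
      rw [hproj p h.mem_domChart_source]
      refine (contMDiffOn_extend_symm h.domChart_mem_maximalAtlas).contMDiffAt ?_
      rw [← h.domChart.extend_target']
      exact h.domChart.isOpen_extend_target.mem_nhds (d.map_source hp)
    exact hd.comp (f p) (hfst.comp (f p) hc)
  · filter_upwards [h.domChart.open_source.mem_nhds h.mem_domChart_source] with p' hp'
    rw [hproj p' hp']
    exact d.left_inv (hsource ▸ hp')

variable [IsManifold 𝓘(ℝ, E) ∞ M] [IsManifold 𝓘(ℝ, F) ∞ N]

theorem contDiffAt_localMap (hf : ContMDiff 𝓘(ℝ, F) 𝓘(ℝ, E) ∞ f) (hp : p ∈ localSource E F f p₀) :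
    ContDiffAt ℝ ∞ (localMap E F f p₀) (extChartAt 𝓘(ℝ, F) p₀ p) := by
  rw [← contMDiffAt_iff_contDiffAt]
  refine ContMDiffAt.comp _ ?_ (hf.contMDiffAt.comp _ (contMDiffAt_param (chart_mem hp.1)))
  rw [param_chart hp.1]
  exact contMDiffAt_chart hp.2

theorem fderiv_localMap_dchart (hf : ContMDiff 𝓘(ℝ, F) 𝓘(ℝ, E) ∞ f)
    (hp : p ∈ localSource E F f p₀) (v : TangentSpace 𝓘(ℝ, F) p) :
    fderiv ℝ (localMap E F f p₀) (extChartAt 𝓘(ℝ, F) p₀ p) (dchart F p₀ p v) =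
      dchart E (f p₀) (f p) (mfderiv 𝓘(ℝ, F) 𝓘(ℝ, E) f p v) := by
  have hchart : localMap E F f p₀ ∘ extChartAt 𝓘(ℝ, F) p₀ =ᶠ[𝓝 p]
      extChartAt 𝓘(ℝ, E) (f p₀) ∘ f := by
    filter_upwards [source_mem_nhds hp.1] with p' hp' using localMap_chart hp'
  have hφ : DifferentiableAt ℝ (localMap E F f p₀) (extChartAt 𝓘(ℝ, F) p₀ p) :=
    (contDiffAt_localMap hf hp).differentiableAt (by simp)
  have hl := mfderiv_comp_apply p hφ.mdifferentiableAt (mdifferentiableAt_chart hp.1) v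
  have hr := mfderiv_comp_apply p (mdifferentiableAt_chart hp.2)
    (hf.contMDiffAt.mdifferentiableAt (by simp)) v
  rw [mfderiv_eq_fderiv] at hl
  exact hl.symm.trans ((DFunLike.congr_fun hchart.mfderiv_eq v).trans hr)

theorem coordMetric_localMap (g : PseudoMetric E M) (hf : ContMDiff 𝓘(ℝ, F) 𝓘(ℝ, E) ∞ f)
    (hp : p ∈ localSource E F f p₀) (v w : TangentSpace 𝓘(ℝ, F) p) :
    coordMetric g (f p₀) (localMap E F f p₀ (extChartAt 𝓘(ℝ, F) p₀ p))
        (fderiv ℝ (localMap E F f p₀) (extChartAt 𝓘(ℝ, F) p₀ p) (dchart F p₀ p v))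
        (fderiv ℝ (localMap E F f p₀) (extChartAt 𝓘(ℝ, F) p₀ p) (dchart F p₀ p w)) =
      pullbackForm g f p v w := by
  rw [fderiv_localMap_dchart hf hp, fderiv_localMap_dchart hf hp, localMap_chart hp.1,
    coordMetric_chart g hp.2]
  rfl

theorem exists_leftInverse_localMap (hf : Manifold.IsImmersion 𝓘(ℝ, F) 𝓘(ℝ, E) ∞ f)
    (hp : p ∈ localSource E F f p₀) :
    ∃ ρ : E → F, DifferentiableAt ℝ ρ (localMap E F f p₀ (extChartAt 𝓘(ℝ, F) p₀ p)) ∧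
      ∀ᶠ z in 𝓝 (extChartAt 𝓘(ℝ, F) p₀ p), ρ (localMap E F f p₀ z) = z := by
  obtain ⟨r, hr, hrf⟩ := exists_leftInverse_of_isImmersion hf p
  refine ⟨fun x ↦ extChartAt 𝓘(ℝ, F) p₀ (r (param E (f p₀) x)), ?_, ?_⟩
  · rw [localMap_chart hp.1]
    refine ((contMDiffAt_iff_contDiffAt (n := ∞)).1 ?_).differentiableAt (by simp)
    refine ContMDiffAt.comp (I' := 𝓘(ℝ, F)) _ ?_
      (ContMDiffAt.comp (I' := 𝓘(ℝ, E)) _ ?_ (contMDiffAt_param (chart_mem hp.2)))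
    · rw [param_chart hp.2, hrf.self_of_nhds]
      exact contMDiffAt_chart hp.1
    · rwa [param_chart hp.2]
  · refine (eventually_nhds_chart_iff hp.1).2 ?_
    filter_upwards [hrf, (isOpen_localSource hf.contMDiff.continuous p₀).mem_nhds hp]
      with p' hrp' hp'
    rw [localMap_chart hp'.1, param_chart hp'.2, hrp']

theorem fderiv_localMap_injective (hf : Manifold.IsImmersion 𝓘(ℝ, F) 𝓘(ℝ, E) ∞ f)
    (hp : p ∈ localSource E F f p₀) :
    Function.Injective (fderiv ℝ (localMap E F f p₀) (extChartAt 𝓘(ℝ, F) p₀ p)) := by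
  obtain ⟨ρ, hρ, hρφ⟩ := exists_leftInverse_localMap hf hp
  have hcomp : (fderiv ℝ ρ (localMap E F f p₀ (extChartAt 𝓘(ℝ, F) p₀ p))).comp
      (fderiv ℝ (localMap E F f p₀) (extChartAt 𝓘(ℝ, F) p₀ p)) = .id ℝ F := by
    rw [← fderiv_comp _ hρ ((contDiffAt_localMap hf.contMDiff hp).differentiableAt (by simp)),
      ← fderiv_id]
    exact Filter.EventuallyEq.fderiv_eq hρφ
  exact Function.LeftInverse.injective (DFunLike.congr_fun hcomp)

theorem mfderiv_injective_of_isImmersion (hf : Manifold.IsImmersion 𝓘(ℝ, F) 𝓘(ℝ, E) ∞ f) (p : N) :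
    Function.Injective (mfderiv 𝓘(ℝ, F) 𝓘(ℝ, E) f p) := by
  have hp : p ∈ localSource E F f p := mem_localSource_self f p
  intro v w hvw
  refine dchart_injective hp.1 (fderiv_localMap_injective hf hp ?_)
  rw [fderiv_localMap_dchart hf.contMDiff hp, fderiv_localMap_dchart hf.contMDiff hp, hvw]

end LocalMap

/-! ### Isolated null surfaces in chart coordinates -/

section Hypersurface

variable {E : Type*} [NormedAddCommGroup E] [NormedSpace ℝ E]
  {M : Type*} [TopologicalSpace M] [ChartedSpace E M] [IsManifold 𝓘(ℝ, E) ∞ M]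
  {F : Type*} [NormedAddCommGroup F] [NormedSpace ℝ F]
  {N : Type*} [TopologicalSpace N] [ChartedSpace F N] [IsManifold 𝓘(ℝ, F) ∞ N]
  {g : PseudoMetric E M} {ι : N → M} {p₀ p : N}

theorem exists_isExtensionAt [CompleteSpace E] [CompleteSpace F]
    (hι : Manifold.IsImmersion 𝓘(ℝ, F) 𝓘(ℝ, E) ∞ ι)
    {Y : Π p : N, TangentSpace 𝓘(ℝ, F) p} (hY : MDiffAt (T% Y) p) :
    ∃ Z, IsExtensionAt (E := E) ι Y p Z := by
  have hp : p ∈ localSource E F ι p := mem_localSource_self ι p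
  let φ := localMap E F ι p
  let z := extChartAt 𝓘(ℝ, F) p p
  obtain ⟨ρ, hρ, hρφ⟩ := exists_leftInverse_localMap hι hp
  let ζ (x : E) : E := fderiv ℝ φ (ρ x) (coordField p Y (ρ x))
  have hζ : DifferentiableAt ℝ ζ (φ z) := by
    have hpush : DifferentiableAt ℝ (fun q ↦ fderiv ℝ φ q (coordField p Y q)) (ρ (φ z)) := by
      rw [hρφ.self_of_nhds]
      exact (differentiableAt_fderiv (contDiffAt_localMap hι.contMDiff hp)).clm_apply
        (differentiableAt_coordField hp.1 hY)
    exact hpush.comp (φ z) hρ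
  refine ⟨liftField (ι p) ζ, mdifferentiableAt_liftField hp.2 ?_, ?_⟩
  · rwa [← localMap_chart hp.1]
  · filter_upwards [(isOpen_localSource hι.contMDiff.continuous p).mem_nhds hp,
      (eventually_nhds_chart_iff hp.1).1 hρφ] with p' hp' hρp'
    refine dchart_injective hp'.2 ?_
    rw [dchart_liftField hp'.2, ← localMap_chart hp'.1, ← fderiv_localMap_dchart hι.contMDiff hp',
      ← coordField_chart hp'.1]
    simp only [ζ, hρp', φ]

theorem dchart_mlieBracket_liftField_const [CompleteSpace F] {X : Π p : N, TangentSpace 𝓘(ℝ, F) p}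
    (hp : p ∈ (extChartAt 𝓘(ℝ, F) p₀).source) (hX : MDiffAt (T% X) p) (u : F) :
    dchart F p₀ p (VectorField.mlieBracket 𝓘(ℝ, F) X (liftField p₀ fun _ ↦ u) p) =
      -fderiv ℝ (coordField p₀ X) (extChartAt 𝓘(ℝ, F) p₀ p) u := by
  rw [dchart_mlieBracket hp hX (mdifferentiableAt_liftField_const hp u),
    fderiv_coordField_liftField_const hp, zero_apply, zero_sub, dchart_liftField hp]

theorem mlieBracket_liftField_const_eventuallyEq [CompleteSpace F]
    {X : Π p : N, TangentSpace 𝓘(ℝ, F) p} (hp : p ∈ (extChartAt 𝓘(ℝ, F) p₀).source)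
    (hX : ∀ p, MDiffAt (T% X) p) (u : F) :
    VectorField.mlieBracket 𝓘(ℝ, F) X (liftField p₀ fun _ ↦ u) =ᶠ[𝓝 p]
      liftField p₀ fun z ↦ -fderiv ℝ (coordField p₀ X) z u := by
  filter_upwards [source_mem_nhds hp] with p' hp'
  refine dchart_injective hp' ?_
  rw [dchart_mlieBracket_liftField_const hp' (hX p'), dchart_liftField hp']

theorem contMDiffOn_liftField_const [CompleteSpace F] {U : Set N}
    (hU : U ⊆ (extChartAt 𝓘(ℝ, F) p₀).source) (u : F) :
    CMDiff[U] ∞ (T% (liftField p₀ fun _ ↦ u)) :=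
  fun _ hp ↦ (contMDiffAt_liftField (hU hp) contDiffAt_const).contMDiffWithinAt

variable [FiniteDimensional ℝ E]

namespace IsIsolatedNullSurface

variable {l : Π p : N, TangentSpace 𝓘(ℝ, F) p}

theorem isImmersion (hN : IsIsolatedNullSurface g ι l) :
    Manifold.IsImmersion 𝓘(ℝ, F) 𝓘(ℝ, E) ∞ ι :=
  hN.null_hypersurface.immersion

theorem mdifferentiableAt (hN : IsIsolatedNullSurface g ι l) (p : N) : MDiffAt (T% l) p :=
  (hN.smooth p).mdifferentiableAt (by simp)

end IsIsolatedNullSurface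

variable [FiniteDimensional ℝ F]

theorem dchart_ambientDeriv (hι : Manifold.IsImmersion 𝓘(ℝ, F) 𝓘(ℝ, E) ∞ ι)
    (hp : p ∈ localSource E F ι p₀) {Y : Π p : N, TangentSpace 𝓘(ℝ, F) p}
    (hY : MDiffAt (T% Y) p) (v : TangentSpace 𝓘(ℝ, F) p) :
    dchart E (ι p₀) (ι p) (ambientDeriv g ι Y p v) =
      covAlong (christoffelAt g (ι p₀)) (localMap E F ι p₀)
        (fun z ↦ fderiv ℝ (localMap E F ι p₀) z (coordField p₀ Y z)) (extChartAt 𝓘(ℝ, F) p₀ p)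
        (dchart F p₀ p v) := by
  have hcompleteE : CompleteSpace E := FiniteDimensional.complete ℝ E
  have hcompleteF : CompleteSpace F := FiniteDimensional.complete ℝ F
  obtain ⟨hZ, hZι⟩ := Classical.epsilon_spec (exists_isExtensionAt (E := E) hι hY)
  rw [ambientDeriv]
  set Z := Classical.epsilon (IsExtensionAt (E := E) ι Y p)
  have hnear : (fun z ↦ coordField (ι p₀) Z (localMap E F ι p₀ z))
      =ᶠ[𝓝 (extChartAt 𝓘(ℝ, F) p₀ p)]
        fun z ↦ fderiv ℝ (localMap E F ι p₀) z (coordField p₀ Y z) := by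
    refine (eventually_nhds_chart_iff hp.1).2 ?_
    filter_upwards [(isOpen_localSource hι.contMDiff.continuous p₀).mem_nhds hp, hZι]
      with p' hp' hZp'
    rw [localMap_chart hp'.1, coordField_chart hp'.2, hZp', coordField_chart hp'.1,
      fderiv_localMap_dchart hι.contMDiff hp']
  have hφ : DifferentiableAt ℝ (localMap E F ι p₀) (extChartAt 𝓘(ℝ, F) p₀ p) :=
    (contDiffAt_localMap hι.contMDiff hp).differentiableAt (by simp)
  have hcoord : DifferentiableAt ℝ (coordField (ι p₀) Z)
      (localMap E F ι p₀ (extChartAt 𝓘(ℝ, F) p₀ p)) := by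
    rw [localMap_chart hp.1]
    exact differentiableAt_coordField hp.2 hZ
  rw [dchart_leviCivita g hp.2 hZ, ← covAlong_congr hnear, covAlong_apply,
    fderiv_fun_comp_apply hcoord hφ, localMap_chart hp.1, fderiv_localMap_dchart hι.contMDiff hp,
    coordField_chart hp.2]

namespace IsIsolatedNullSurface

variable {l : Π p : N, TangentSpace 𝓘(ℝ, F) p}

theorem lie_metric_localMap (hN : IsIsolatedNullSurface g ι l) (hp : p ∈ localSource E F ι p₀)
    (u w : F) :
    let B := coordMetric g (ι p₀)
    let φ := localMap E F ι p₀
    let L := coordField p₀ l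
    let z := extChartAt 𝓘(ℝ, F) p₀ p
    fderiv ℝ (fun y ↦ B (φ y) (fderiv ℝ φ y u) (fderiv ℝ φ y w)) z (L z) +
      B (φ z) (fderiv ℝ φ z (fderiv ℝ L z u)) (fderiv ℝ φ z w) +
      B (φ z) (fderiv ℝ φ z u) (fderiv ℝ φ z (fderiv ℝ L z w)) = 0 := by
  intro B φ _ z
  have hcomplete : CompleteSpace F := FiniteDimensional.complete ℝ F
  have hι := hN.isImmersion.contMDiff
  have hφ : ContDiffAt ℝ ∞ φ z := contDiffAt_localMap hι hp
  have hB : DifferentiableAt ℝ B (φ z) :=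
    (contDiffAt_coordMetric g (localMap_mem hp)).differentiableAt (by simp)
  have hdφ (v : F) : DifferentiableAt ℝ (fun y ↦ fderiv ℝ φ y v) z :=
    (differentiableAt_fderiv hφ).clm_apply (differentiableAt_const v)
  have hpull : (fun p' ↦ pullbackForm g ι p' (liftField p₀ (fun _ ↦ u) p')
      (liftField p₀ (fun _ ↦ w) p')) =ᶠ[𝓝 p] fun p' ↦ (fun y ↦ B (φ y) (fderiv ℝ φ y u)
        (fderiv ℝ φ y w)) (extChartAt 𝓘(ℝ, F) p₀ p') := by
    filter_upwards [(isOpen_localSource hι.continuous p₀).mem_nhds hp] with p' hp'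
    rw [← coordMetric_localMap g hι hp', dchart_liftField hp'.1, dchart_liftField hp'.1]
  have hlie := hN.lie_metric _ (isOpen_extChartAt_source p₀) _ _
    (contMDiffOn_liftField_const subset_rfl u) (contMDiffOn_liftField_const subset_rfl w) p hp.1
  rw [mvfderiv_eq_fderiv_dchart hp.1
      (((hB.comp z (hφ.differentiableAt (by simp))).clm_apply (hdφ u)).clm_apply (hdφ w)) hpull,
    ← coordMetric_localMap g hι hp, ← coordMetric_localMap g hι hp,
    dchart_mlieBracket_liftField_const hp.1 (hN.mdifferentiableAt p),
    dchart_mlieBracket_liftField_const hp.1 (hN.mdifferentiableAt p), dchart_liftField hp.1,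
    dchart_liftField hp.1, ← coordField_chart hp.1 l] at hlie
  simp only [map_neg, neg_apply, sub_neg_eq_add] at hlie
  exact hlie

theorem isNullMap (hN : IsIsolatedNullSurface g ι l) (p₀ : N) :
    IsNullMap (chartDom E (ι p₀)) (coordMetric g (ι p₀)) (localDom E F ι p₀)
      (localMap E F ι p₀) (coordField p₀ l) where
  isOpen := isOpen_localDom hN.isImmersion.contMDiff.continuous p₀
  contDiffAt := by
    rintro _ ⟨p, hp, rfl⟩
    exact contDiffAt_localMap hN.isImmersion.contMDiff hp
  mem := by
    rintro _ ⟨p, hp, rfl⟩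
    exact localMap_mem hp
  injective := by
    rintro _ ⟨p, hp, rfl⟩
    exact fderiv_localMap_injective hN.isImmersion hp
  finrank_add_one := hN.null_hypersurface.codim_one
  contDiffAt_field := by
    rintro _ ⟨p, hp, rfl⟩
    have hcomplete : CompleteSpace F := FiniteDimensional.complete ℝ F
    exact contDiffAt_coordField hp.1 (hN.smooth p)
  field_ne_zero := by
    rintro _ ⟨p, hp, rfl⟩
    rw [coordField_chart hp.1]
    exact (map_ne_zero_iff _ (dchart_injective hp.1)).2 (hN.ne_zero p)
  null := by
    rintro _ ⟨p, hp, rfl⟩ w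
    obtain ⟨w, rfl⟩ := dchart_surjective hp.1 w
    rw [coordField_chart hp.1, coordMetric_localMap g hN.isImmersion.contMDiff hp]
    exact hN.null p w
  lie_metric := by
    rintro _ ⟨p, hp, rfl⟩
    exact hN.lie_metric_localMap hp

theorem mfderiv_inducedDeriv (hN : IsIsolatedNullSurface g ι l)
    {Y : Π p : N, TangentSpace 𝓘(ℝ, F) p} (hY : MDiffAt (T% Y) p) (v : TangentSpace 𝓘(ℝ, F) p) :
    mfderiv 𝓘(ℝ, F) 𝓘(ℝ, E) ι p (inducedDeriv g ι Y p v) = ambientDeriv g ι Y p v := by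
  have hcomplete : CompleteSpace F := FiniteDimensional.complete ℝ F
  have hp : p ∈ localSource E F ι p := mem_localSource_self ι p
  obtain ⟨w, hw⟩ := (hN.isNullMap p).exists_fderiv_apply_eq_covAlong
    (isChristoffel_christoffelAt g (ι p)) (Set.mem_image_of_mem _ hp)
    (differentiableAt_coordField hp.1 hY) (dchart F p p v)
  obtain ⟨w, rfl⟩ := dchart_surjective hp.1 w
  refine Classical.epsilon_spec (p := fun w ↦
    mfderiv 𝓘(ℝ, F) 𝓘(ℝ, E) ι p w = ambientDeriv g ι Y p v) ⟨w, dchart_injective hp.2 ?_⟩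
  rw [dchart_ambientDeriv hN.isImmersion hp hY, ← hw,
    fderiv_localMap_dchart hN.isImmersion.contMDiff hp]

theorem fderiv_localMap_dchart_inducedDeriv (hN : IsIsolatedNullSurface g ι l)
    (hp : p ∈ localSource E F ι p₀) {Y : Π p : N, TangentSpace 𝓘(ℝ, F) p} {y : F → F}
    (hY : Y =ᶠ[𝓝 p] liftField p₀ y) (hy : DifferentiableAt ℝ y (extChartAt 𝓘(ℝ, F) p₀ p))
    (v : TangentSpace 𝓘(ℝ, F) p) :
    fderiv ℝ (localMap E F ι p₀) (extChartAt 𝓘(ℝ, F) p₀ p)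
        (dchart F p₀ p (inducedDeriv g ι Y p v)) =
      covAlong (christoffelAt g (ι p₀)) (localMap E F ι p₀)
        (fun z ↦ fderiv ℝ (localMap E F ι p₀) z (y z)) (extChartAt 𝓘(ℝ, F) p₀ p)
        (dchart F p₀ p v) := by
  have hcomplete : CompleteSpace F := FiniteDimensional.complete ℝ F
  have hYdiff : MDiffAt (T% Y) p := mdifferentiableAt_of_eventuallyEq_liftField hp.1 hY hy
  have hnear : (fun z ↦ fderiv ℝ (localMap E F ι p₀) z (coordField p₀ Y z))
      =ᶠ[𝓝 (extChartAt 𝓘(ℝ, F) p₀ p)] fun z ↦ fderiv ℝ (localMap E F ι p₀) z (y z) := by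
    filter_upwards [coordField_eventuallyEq hp.1 hY] with z hz
    rw [hz]
  rw [fderiv_localMap_dchart hN.isImmersion.contMDiff hp, hN.mfderiv_inducedDeriv hYdiff,
    dchart_ambientDeriv hN.isImmersion hp hYdiff, covAlong_congr hnear]

theorem inducedDeriv_liftField_const_eventuallyEq (hN : IsIsolatedNullSurface g ι l)
    (hp : p ∈ localSource E F ι p₀) {u w : F} {δ : F → F}
    (hδ : ∀ z ∈ localDom E F ι p₀, fderiv ℝ (localMap E F ι p₀) z (δ z) =
      covAlong (christoffelAt g (ι p₀)) (localMap E F ι p₀)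
        (fun y ↦ fderiv ℝ (localMap E F ι p₀) y w) z u) :
    (fun p' ↦ inducedDeriv g ι (liftField p₀ fun _ ↦ w) p' (liftField p₀ (fun _ ↦ u) p'))
      =ᶠ[𝓝 p] liftField p₀ δ := by
  filter_upwards [(isOpen_localSource hN.isImmersion.contMDiff.continuous p₀).mem_nhds hp]
    with p' hp'
  refine dchart_injective hp'.1 (fderiv_localMap_injective hN.isImmersion hp' ?_)
  rw [hN.fderiv_localMap_dchart_inducedDeriv hp' .rfl (differentiableAt_const w),
    dchart_liftField hp'.1, dchart_liftField hp'.1, hδ _ (Set.mem_image_of_mem _ hp')]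

theorem preservesConnection (hN : IsIsolatedNullSurface g ι l) (p₀ : N) :
    PreservesConnection (christoffelAt g (ι p₀)) (localDom E F ι p₀) (localMap E F ι p₀)
      (coordField p₀ l) := by
  rintro u w δ hδ _ ⟨p, hp, rfl⟩
  have hcomplete : CompleteSpace F := FiniteDimensional.complete ℝ F
  have hM := hN.isNullMap p₀
  have hz := Set.mem_image_of_mem (extChartAt 𝓘(ℝ, F) p₀) hp
  have hl := hN.mdifferentiableAt p
  have hδdiff : DifferentiableAt ℝ δ (extChartAt 𝓘(ℝ, F) p₀ p) :=
    (hM.contDiffAt_of_fderiv_eq_covAlong (isChristoffel_christoffelAt g (ι p₀)) hδ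
      hz).differentiableAt (by simp)
  have hLw : DifferentiableAt ℝ (fun z ↦ -fderiv ℝ (coordField p₀ l) z w)
      (extChartAt 𝓘(ℝ, F) p₀ p) :=
    ((differentiableAt_fderiv (hM.contDiffAt_field _ hz)).clm_apply
      (differentiableAt_const w)).neg
  have hlie := hN.lie_connection _ (isOpen_extChartAt_source p₀) _ _
    (contMDiffOn_liftField_const subset_rfl u) (contMDiffOn_liftField_const subset_rfl w) p hp.1
  have hcoord := congrArg
    (fun v ↦ fderiv ℝ (localMap E F ι p₀) (extChartAt 𝓘(ℝ, F) p₀ p) (dchart F p₀ p v)) hlie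
  simp only [map_sub, map_zero] at hcoord
  rw [hN.fderiv_localMap_dchart_inducedDeriv hp .rfl (differentiableAt_const w),
    dchart_mlieBracket_liftField_const hp.1 hl,
    hN.fderiv_localMap_dchart_inducedDeriv hp
      (mlieBracket_liftField_const_eventuallyEq hp.1 hN.mdifferentiableAt w) hLw,
    dchart_liftField hp.1, Filter.EventuallyEq.rfl.mlieBracket_vectorField_eq
      (hN.inducedDeriv_liftField_const_eventuallyEq hp hδ),
    dchart_mlieBracket hp.1 hl (mdifferentiableAt_liftField hp.1 hδdiff), dchart_liftField hp.1,
    (coordField_liftField hp.1 δ).fderiv_eq, ← coordField_chart hp.1 l, map_neg,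
    sub_neg_eq_add] at hcoord
  simpa only [map_neg, covAlong_neg, neg_apply, sub_neg_eq_add] using hcoord

theorem rotationForm_eq_rotationAlong (hN : IsIsolatedNullSurface g ι l)
    (hp : p ∈ localSource E F ι p₀) (v : TangentSpace 𝓘(ℝ, F) p) :
    rotationForm g ι l p v = rotationAlong (christoffelAt g (ι p₀)) (localMap E F ι p₀)
      (coordField p₀ l) (extChartAt 𝓘(ℝ, F) p₀ p) (dchart F p₀ p v) := by
  have hz := Set.mem_image_of_mem (extChartAt 𝓘(ℝ, F) p₀) hp
  set c := rotationAlong (christoffelAt g (ι p₀)) (localMap E F ι p₀) (coordField p₀ l)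
    (extChartAt 𝓘(ℝ, F) p₀ p) (dchart F p₀ p v)
  have hc : inducedDeriv g ι l p v = c • l p := by
    refine mfderiv_injective_of_isImmersion hN.isImmersion p (dchart_injective hp.2 ?_)
    rw [hN.mfderiv_inducedDeriv (hN.mdifferentiableAt p),
      dchart_ambientDeriv hN.isImmersion hp (hN.mdifferentiableAt p), map_smul, map_smul,
      ← fderiv_localMap_dchart hN.isImmersion.contMDiff hp, ← coordField_chart hp.1]
    exact (hN.isNullMap p₀).covAlong_normalField (isChristoffel_christoffelAt g (ι p₀)) hz _
  have hspec := Classical.epsilon_spec (p := fun c : ℝ ↦ inducedDeriv g ι l p v = c • l p) ⟨c, hc⟩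
  exact smul_left_injective ℝ (hN.ne_zero p) (hspec.symm.trans hc)

theorem ambientDeriv_self (hN : IsIsolatedNullSurface g ι l) (p : N) :
    ambientDeriv g ι l p (l p) =
      surfaceGravity g ι l p • mfderiv 𝓘(ℝ, F) 𝓘(ℝ, E) ι p (l p) := by
  have hp : p ∈ localSource E F ι p := mem_localSource_self ι p
  obtain ⟨c, hc⟩ := (hN.isNullMap p).exists_covAlong_normalField_eq_smul
    (isChristoffel_christoffelAt g (ι p)) (Set.mem_image_of_mem _ hp) (dchart F p p (l p))
  refine Classical.epsilon_spec (p := fun c : ℝ ↦ ambientDeriv g ι l p (l p) =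
    c • mfderiv 𝓘(ℝ, F) 𝓘(ℝ, E) ι p (l p)) ⟨c, dchart_injective hp.2 ?_⟩
  rw [dchart_ambientDeriv hN.isImmersion hp (hN.mdifferentiableAt p), map_smul,
    ← fderiv_localMap_dchart hN.isImmersion.contMDiff hp, ← coordField_chart hp.1]
  rw [← coordField_chart hp.1] at hc
  exact hc

theorem covAlong_normalField_self (hN : IsIsolatedNullSurface g ι l) (hext : IsExtremal g ι l)
    (hp : p ∈ localSource E F ι p₀) :
    covAlong (christoffelAt g (ι p₀)) (localMap E F ι p₀)
      (normalField (localMap E F ι p₀) (coordField p₀ l)) (extChartAt 𝓘(ℝ, F) p₀ p)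
      (coordField p₀ l (extChartAt 𝓘(ℝ, F) p₀ p)) = 0 := by
  have hself := hN.ambientDeriv_self p
  rw [hext p, zero_smul] at hself
  have hcov := dchart_ambientDeriv (g := g) hN.isImmersion hp (hN.mdifferentiableAt p) (l p)
  rw [hself, map_zero, ← coordField_chart hp.1] at hcov
  exact hcov.symm

end IsIsolatedNullSurface

end Hypersurface

/-! ### Spacelike sections in chart coordinates -/

section Section

variable {E : Type*} [NormedAddCommGroup E] [NormedSpace ℝ E]
  {M : Type*} [TopologicalSpace M] [ChartedSpace E M]
  {F : Type*} [NormedAddCommGroup F] [NormedSpace ℝ F]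
  {N : Type*} [TopologicalSpace N] [ChartedSpace F N]
  {H : Type*} [NormedAddCommGroup H] [NormedSpace ℝ H]
  {S : Type*} [TopologicalSpace S] [ChartedSpace H S]
  {ι : N → M} {l : Π p : N, TangentSpace 𝓘(ℝ, F) p} {j : S → N} {s s' : S}

variable (E F H) in
/-- The points near `s` at which both `j` and `ι` are expressed in the preferred charts at `s`,
`j s` and `ι (j s)`. -/
def sectionSource (ι : N → M) (j : S → N) (s : S) : Set S :=
  localSource F H j s ∩ j ⁻¹' localSource E F ι (j s)

variable (E F H) in
/-- The coordinates of the points of `sectionSource`. -/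
def sectionDom (ι : N → M) (j : S → N) (s : S) : Set H :=
  extChartAt 𝓘(ℝ, H) s '' sectionSource E F H ι j s

theorem mem_sectionSource_self (ι : N → M) (j : S → N) (s : S) : s ∈ sectionSource E F H ι j s :=
  ⟨mem_localSource_self j s, mem_localSource_self ι (j s)⟩

theorem isOpen_sectionSource (hι : Continuous ι) (hj : Continuous j) (s : S) :
    IsOpen (sectionSource E F H ι j s) :=
  (isOpen_localSource hj s).inter ((isOpen_localSource hι (j s)).preimage hj)

theorem isOpen_sectionDom (hι : Continuous ι) (hj : Continuous j) (s : S) :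
    IsOpen (sectionDom E F H ι j s) :=
  isOpen_image_chart (isOpen_sectionSource hι hj s) fun _ hs ↦ hs.1.1

variable [IsManifold 𝓘(ℝ, E) ∞ M] {g : PseudoMetric E M}

theorem pullbackForm_comp_apply (hι : ContMDiff 𝓘(ℝ, F) 𝓘(ℝ, E) ∞ ι)
    (hj : ContMDiff 𝓘(ℝ, H) 𝓘(ℝ, F) ∞ j) (s : S) (a b : TangentSpace 𝓘(ℝ, H) s) :
    pullbackForm g (ι ∘ j) s a b =
      pullbackForm g ι (j s) (mfderiv 𝓘(ℝ, H) 𝓘(ℝ, F) j s a)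
        (mfderiv 𝓘(ℝ, H) 𝓘(ℝ, F) j s b) := by
  have hchain (v : TangentSpace 𝓘(ℝ, H) s) := mfderiv_comp_apply s
    (hι.contMDiffAt.mdifferentiableAt (by simp)) (hj.contMDiffAt.mdifferentiableAt (by simp)) v
  exact congrArg₂ (fun v w ↦ g.val (ι (j s)) v w) (hchain a) (hchain b)

variable [IsManifold 𝓘(ℝ, F) ∞ N] [IsManifold 𝓘(ℝ, H) ∞ S] [FiniteDimensional ℝ E]

theorem rotationFormOn_eq_sectionRotation [FiniteDimensional ℝ F]
    (hN : IsIsolatedNullSurface g ι l)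
    (hj : ContMDiff 𝓘(ℝ, H) 𝓘(ℝ, F) ∞ j) (hs : s' ∈ sectionSource E F H ι j s)
    (v : TangentSpace 𝓘(ℝ, H) s') :
    rotationFormOn g ι l j s' v =
      sectionRotation (christoffelAt g (ι (j s))) (localMap E F ι (j s)) (coordField (j s) l)
        (localMap F H j s) (extChartAt 𝓘(ℝ, H) s s') (dchart H s s' v) := by
  rw [rotationFormOn, hN.rotationForm_eq_rotationAlong hs.2, sectionRotation,
    ContinuousLinearMap.comp_apply, fderiv_localMap_dchart hj hs.1, localMap_chart hs.1.1]

variable [FiniteDimensional ℝ H]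

namespace IsSpacelikeSection

theorem isSpacelikeMap (hS : IsSpacelikeSection (G := H) g ι l j)
    (hN : IsIsolatedNullSurface g ι l) (s : S) :
    IsSpacelikeMap (coordMetric g (ι (j s))) (localDom E F ι (j s)) (localMap E F ι (j s))
      (coordMetric (hS.metric hN.null_hypersurface) s) (sectionDom E F H ι j s)
      (localMap F H j s) where
  contDiffAt := by
    rintro _ ⟨s', hs', rfl⟩
    exact contDiffAt_localMap hS.immersion.contMDiff hs'.1
  mem := by
    rintro _ ⟨s', hs', rfl⟩
    rw [localMap_chart hs'.1.1]
    exact Set.mem_image_of_mem _ hs'.2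
  finrank_add_one := by
    have hcodim_one := hN.null_hypersurface.codim_one
    have hcodim_two := hS.codim_two
    lia
  metric_eq := by
    rintro _ ⟨s', hs', rfl⟩ a b
    obtain ⟨a, rfl⟩ := dchart_surjective hs'.1.1 a
    obtain ⟨b, rfl⟩ := dchart_surjective hs'.1.1 b
    rw [coordMetric_chart _ hs'.1.1, fderiv_localMap_dchart hS.immersion.contMDiff hs'.1,
      fderiv_localMap_dchart hS.immersion.contMDiff hs'.1, localMap_chart hs'.1.1,
      coordMetric_localMap g hN.isImmersion.contMDiff hs'.2]
    exact pullbackForm_comp_apply hN.isImmersion.contMDiff hS.immersion.contMDiff s' a b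
  metric_pos := by
    rintro _ ⟨s', hs', rfl⟩ a ha
    obtain ⟨a, rfl⟩ := dchart_surjective hs'.1.1 a
    rw [coordMetric_chart _ hs'.1.1]
    exact hS.spacelike s' a fun h ↦ ha (by rw [h, map_zero])

theorem isChristoffel_metric (hS : IsSpacelikeSection (G := H) g ι l j)
    (hN : IsIsolatedNullSurface g ι l) (s : S) :
    IsChristoffel (sectionDom E F H ι j s) (coordMetric (hS.metric hN.null_hypersurface) s)
      (christoffelAt (hS.metric hN.null_hypersurface) s) := by
  refine (isChristoffel_christoffelAt _ s).mono
    (isOpen_sectionDom hN.isImmersion.contMDiff.continuous hS.immersion.contMDiff.continuous s) ?_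
  rintro _ ⟨s', hs', rfl⟩
  exact chart_mem hs'.1.1

variable [FiniteDimensional ℝ F]

theorem covDerivOneForm_rotationFormOn_add_mul (hS : IsSpacelikeSection (G := H) g ι l j)
    (hN : IsIsolatedNullSurface g ι l) (s : S) (a b : TangentSpace 𝓘(ℝ, H) s) :
    (hS.metric hN.null_hypersurface).covDerivOneForm (rotationFormOn g ι l j) s a b +
        rotationFormOn g ι l j s a * rotationFormOn g ι l j s b =
      rotationHessian (christoffelAt g (ι (j s)))
        (christoffelAt (hS.metric hN.null_hypersurface) s) (localMap E F ι (j s))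
        (coordField (j s) l) (localMap F H j s) (extChartAt 𝓘(ℝ, H) s s) (dchart H s s a)
        (dchart H s s b) := by
  have hs := mem_sectionSource_self (E := E) (F := F) (H := H) ι j s
  have hj := hS.immersion.contMDiff
  have hrot : ∀ᶠ s' in 𝓝 s, ∀ v, rotationFormOn g ι l j s' v =
      sectionRotation (christoffelAt g (ι (j s))) (localMap E F ι (j s)) (coordField (j s) l)
        (localMap F H j s) (extChartAt 𝓘(ℝ, H) s s') (dchart H s s' v) := by
    filter_upwards [(isOpen_sectionSource hN.isImmersion.contMDiff.continuous hj.continuous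
      s).mem_nhds hs] with s' hs' v using rotationFormOn_eq_sectionRotation hN hj hs' v
  have hdiff := (hS.isSpacelikeMap hN s).differentiableAt_sectionRotation (hN.isNullMap (j s))
    (isChristoffel_christoffelAt g (ι (j s))) (Set.mem_image_of_mem _ hs)
  rw [covDerivOneForm_eq_fderiv_sub _ hdiff hrot, rotationHessian,
    rotationFormOn_eq_sectionRotation hN hj hs, rotationFormOn_eq_sectionRotation hN hj hs]

theorem ricci_mfderiv_comp (hS : IsSpacelikeSection (G := H) g ι l j)
    (hN : IsIsolatedNullSurface g ι l) (s : S) (a b : TangentSpace 𝓘(ℝ, H) s) :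
    g.ricci (ι (j s)) (mfderiv 𝓘(ℝ, H) 𝓘(ℝ, E) (ι ∘ j) s a)
        (mfderiv 𝓘(ℝ, H) 𝓘(ℝ, E) (ι ∘ j) s b) =
      LinearMap.trace ℝ E (curvatureEnd (christoffelAt g (ι (j s)))
        (localMap E F ι (j s) (localMap F H j s (extChartAt 𝓘(ℝ, H) s s)))
        (fderiv ℝ (localMap E F ι (j s) ∘ localMap F H j s) (extChartAt 𝓘(ℝ, H) s s)
          (dchart H s s a))
        (fderiv ℝ (localMap E F ι (j s) ∘ localMap F H j s) (extChartAt 𝓘(ℝ, H) s s)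
          (dchart H s s b))) := by
  have hs := mem_sectionSource_self (E := E) (F := F) (H := H) ι j s
  have hι := hN.isImmersion.contMDiff
  have hj := hS.immersion.contMDiff
  have hchain (v : TangentSpace 𝓘(ℝ, H) s) :
      fderiv ℝ (localMap E F ι (j s) ∘ localMap F H j s) (extChartAt 𝓘(ℝ, H) s s)
        (dchart H s s v) =
      dchart E (ι (j s)) (ι (j s)) (mfderiv 𝓘(ℝ, H) 𝓘(ℝ, E) (ι ∘ j) s v) := by
    rw [(hS.isSpacelikeMap hN s).fderiv_comp_apply (hN.isNullMap (j s))
      (Set.mem_image_of_mem _ hs), fderiv_localMap_dchart hj hs.1, localMap_chart hs.1.1,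
      fderiv_localMap_dchart hι hs.2]
    exact congrArg (dchart E (ι (j s)) (ι (j s))) (mfderiv_comp_apply s
      (hι.contMDiffAt.mdifferentiableAt (by simp))
      (hj.contMDiffAt.mdifferentiableAt (by simp)) v).symm
  rw [ricci_eq_trace_curvatureEnd, hchain, hchain, localMap_chart hs.1.1, localMap_chart hs.2.1]

end IsSpacelikeSection

end Section

end NullGeom

end

open NullGeom in
theorem theorem4_general
    {E : Type*} [NormedAddCommGroup E] [NormedSpace ℝ E] [FiniteDimensional ℝ E]
    {M : Type*} [TopologicalSpace M] [ChartedSpace E M] [IsManifold 𝓘(ℝ, E) ∞ M]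
    {F : Type*} [NormedAddCommGroup F] [NormedSpace ℝ F] [FiniteDimensional ℝ F]
    {N : Type*} [TopologicalSpace N] [ChartedSpace F N] [IsManifold 𝓘(ℝ, F) ∞ N]
    {H : Type*} [NormedAddCommGroup H] [NormedSpace ℝ H] [FiniteDimensional ℝ H]
    {S : Type*} [TopologicalSpace S] [ChartedSpace H S] [IsManifold 𝓘(ℝ, H) ∞ S]
    {g : PseudoMetric E M} {ι : N → M} {l : Π p : N, TangentSpace 𝓘(ℝ, F) p} {j : S → N}
    (hN : IsIsolatedNullSurface g ι l) (hext : IsExtremal g ι l)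
    (hS : IsSpacelikeSection (G := H) g ι l j) (s : S) (a b : TangentSpace 𝓘(ℝ, H) s) :
    let q := hS.metric hN.null_hypersurface
    let rot : Π s : S, TangentSpace 𝓘(ℝ, H) s → ℝ := rotationFormOn g ι l j
    let dφ := mfderiv 𝓘(ℝ, H) 𝓘(ℝ, E) (ι ∘ j) s
    (1 / 2 : ℝ) * (q.covDerivOneForm rot s a b + q.covDerivOneForm rot s b a)
      + rot s a * rot s b
      - (1 / 2 : ℝ) * q.ricci s a b
      + (1 / 2 : ℝ) * g.ricci (ι (j s)) (dφ a) (dφ b) = 0 := by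
  intro q rot dφ
  have hs := mem_sectionSource_self (E := E) (F := F) (H := H) ι j s
  have hext_chart := hN.covAlong_normalField_self hext hs.2
  rw [← localMap_chart hs.1.1] at hext_chart
  have htrace := (hS.isSpacelikeMap hN s).trace_curvatureEnd (hN.isNullMap (j s))
    (isChristoffel_christoffelAt g (ι (j s))) (hS.isChristoffel_metric hN s)
    (hN.preservesConnection (j s)) (Set.mem_image_of_mem _ hs) hext_chart
    (dchart H s s a) (dchart H s s b)
  rw [← hS.ricci_mfderiv_comp hN, ← ricci_eq_trace_curvatureEnd,
    ← hS.covDerivOneForm_rotationFormOn_add_mul hN,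
    ← hS.covDerivOneForm_rotationFormOn_add_mul hN] at htrace
  linear_combination (1 / 2 : ℝ) * htrace

theorem theorem4 (n : ℕ) (hn : 2 < n)
    {M : Type*} [TopologicalSpace M] [ChartedSpace (EuclideanSpace ℝ (Fin n)) M]
    [IsManifold 𝓘(ℝ, EuclideanSpace ℝ (Fin n)) ∞ M]
    {N : Type*} [TopologicalSpace N] [ChartedSpace (EuclideanSpace ℝ (Fin (n - 1))) N]
    [IsManifold 𝓘(ℝ, EuclideanSpace ℝ (Fin (n - 1))) ∞ N]
    {S : Type*} [TopologicalSpace S] [ChartedSpace (EuclideanSpace ℝ (Fin (n - 2))) S]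
    [IsManifold 𝓘(ℝ, EuclideanSpace ℝ (Fin (n - 2))) ∞ S]
    (g : NullGeom.PseudoMetric (EuclideanSpace ℝ (Fin n)) M) (hg : g.IsLorentzian)
    (ι : N → M) (l : Π p : N, TangentSpace 𝓘(ℝ, EuclideanSpace ℝ (Fin (n - 1))) p)
    (hN : NullGeom.IsIsolatedNullSurface g ι l) (hext : NullGeom.IsExtremal g ι l)
    (j : S → N) (hS : NullGeom.IsSpacelikeSection (G := EuclideanSpace ℝ (Fin (n - 2))) g ι l j)
    (s : S) (a b : TangentSpace 𝓘(ℝ, EuclideanSpace ℝ (Fin (n - 2))) s) :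
    let q := hS.metric hN.null_hypersurface
    let rot : Π s : S, TangentSpace 𝓘(ℝ, EuclideanSpace ℝ (Fin (n - 2))) s → ℝ :=
      NullGeom.rotationFormOn g ι l j
    let dφ := mfderiv 𝓘(ℝ, EuclideanSpace ℝ (Fin (n - 2))) 𝓘(ℝ, EuclideanSpace ℝ (Fin n))
      (ι ∘ j) s
    (1 / 2 : ℝ) * (q.covDerivOneForm rot s a b + q.covDerivOneForm rot s b a)
      + rot s a * rot s b
      - (1 / 2 : ℝ) * q.ricci s a b
      + (1 / 2 : ℝ) * g.ricci (ι (j s)) (dφ a) (dφ b) = 0 :=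
  theorem4_general hN hext hS s a b
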